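/- All algebras are over $\mathbb{Q}$. A positively elliptic algebra is a quotient $H^*=\mathbb{Q}[x_1,\dots,x_k]/(u_1,\dots,u_k)$, where the generators $x_i$ have positive even degrees $|x_i|$ and $u_1,\dots,u_k$ is a regular sequence of homogeneous polynomials, of degrees $|u_i|$, with respect to the induced grading; $H^*$ carries the quotient grading. Such a presentation is a pure model if every $u_i$ is a linear combination of monomials $x_1^{a_1}\cdots x_k^{a_k}$ with $a_1+\dots+a_k\ge 2$, and $|x_1|\le\dots\le|x_k|$, $|u_1|\le\dots\le|u_k|$, and $|u_i|\ge 2|x_i|$ for all $i$. The formal dimension $\operatorname{fd}H^*$ is the largest $n$ with $H^n\ne 0$. The algebra $H^*$ splits if there are positively elliptic algebras $K^*$ and $Q^*$, both non-zero in some positive degree, and degree-preserving algebra homomorphisms $\iota:K^*\to H^*$, injective, and $\pi:H^*\to Q^*$, surjective, such that $\ker\pi$ is the ideal of $H^*$ generated by $\iota(K^{>0})$. A derivation $\delta$ of $H^*$ has degree $d\in\mathbb{Z}$ if $\delta(H^n)\subseteq H^{n+d}$ for all $n$ (with $H^m=0$ for $m<0$). **Corollary 4.4.** Let $k\ge 2$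 and let $H^*=\mathbb{Q}[x_1,\dots,x_k]/(u_1,\dots,u_k)$ be a positively elliptic algebra presented by a pure model. Suppose that $H^*$ does not split and that $|x_{k-1}|+|x_k|=10$. If $H^*$ admits a non-zero derivation of negative degree, then $\operatorname{fd}H^*>20$. -/

import Mathlib

/-- Data presenting a positively elliptic algebra
`H = ℚ[x₁,…,x_k]/(u₁,…,u_k)`: generators of positive even degree and as many weighted homogeneous
relations, which form a regular sequence.  `IsWeaklyRegular` says that each `u_i` is a
non-zero-divisor modulo the previous ones; it still allows the quotient to be the zero ring. -/
structure EllipticPresentation (k : ℕ) where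
  /-- the degrees `|x_i|` of the generators -/
  deg : Fin k → ℕ
  /-- the relations `u_i` -/
  rel : Fin k → MvPolynomial (Fin k) ℚ
  /-- the degrees `|u_i|` of the relations -/
  relDeg : Fin k → ℕ
  deg_pos : ∀ i, 0 < deg i
  deg_even : ∀ i, Even (deg i)
  rel_homogeneous : ∀ i, MvPolynomial.IsWeightedHomogeneous deg (rel i) (relDeg i)
  rel_regular :
    RingTheory.Sequence.IsWeaklyRegular (MvPolynomial (Fin k) ℚ) (List.ofFn rel)

namespace EllipticPresentation

variable {k : ℕ}

/-- The ideal `(u₁,…,u_k)`. -/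
noncomputable def relIdeal (P : EllipticPresentation k) : Ideal (MvPolynomial (Fin k) ℚ) :=
  Ideal.span (Set.range P.rel)

/-- The algebra `H = ℚ[x₁,…,x_k]/(u₁,…,u_k)`. -/
abbrev Alg (P : EllipticPresentation k) : Type :=
  MvPolynomial (Fin k) ℚ ⧸ P.relIdeal

/-- The graded piece `H^n`: the image of the span of the monomials
`x₁^{a₁}⋯x_k^{a_k}` with `a₁|x₁| + … + a_k|x_k| = n`. -/
noncomputable def piece (P : EllipticPresentation k) (n : ℕ) : Submodule ℚ P.Alg :=
  (MvPolynomial.weightedHomogeneousSubmodule ℚ P.deg n).map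
    (Ideal.Quotient.mkₐ ℚ P.relIdeal).toLinearMap

/-- The presentation is a pure model: the relations lie in the span of the monomials of word length
at least two, both degree sequences are non-decreasing, and `|u_i| ≥ 2|x_i|`. -/
structure IsPureModel (P : EllipticPresentation k) : Prop where
  two_le_length : ∀ i, ∀ a ∈ (P.rel i).support, 2 ≤ a.degree
  deg_mono : Monotone P.deg
  relDeg_mono : Monotone P.relDeg
  two_mul_deg_le : ∀ i, 2 * P.deg i ≤ P.relDeg i

/-- The formal dimension (socle degree): the largest `n` with `H^n ≠ 0`. -/
noncomputable def formalDim (P : EllipticPresentation k) : ℕ :=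
  sSup {n | P.piece n ≠ ⊥}

/-- If `H^i = 0` for `i > n` and `H^n ≠ 0` (as holds for the integer `n` of Poincaré duality),
then `n` is the formal dimension. -/
theorem formalDim_eq (P : EllipticPresentation k) {n : ℕ}
    (h : ∀ i, n < i → P.piece i = ⊥) (hn : P.piece n ≠ ⊥) : P.formalDim = n :=
  IsGreatest.csSup_eq ⟨hn, fun i hi => by
    by_contra hlt
    exact hi (h i (not_le.mp hlt))⟩

/-- A derivation `δ` of `H` has degree `d ∈ ℤ` if `δ(H^n) ⊆ H^{n+d}` for all `n`, where
`H^m = 0` for `m < 0`.  As `H` lives in even degrees, the sign `(-1)^{|δ||x|}` in the graded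
Leibniz rule is always `1`, so graded derivations are derivations in the usual sense. -/
def HasDegree (P : EllipticPresentation k) (δ : Derivation ℚ P.Alg P.Alg) (d : ℤ) : Prop :=
  ∀ n : ℕ, ∀ x ∈ P.piece n,
    (∀ m : ℕ, (m : ℤ) = n + d → δ x ∈ P.piece m) ∧ ((n : ℤ) + d < 0 → δ x = 0)

/-- The algebra has a non-zero element of positive degree, that is, it is neither zero nor `ℚ`. -/
def IsNontrivial (P : EllipticPresentation k) : Prop :=
  ∃ n, 0 < n ∧ P.piece n ≠ ⊥

/-- `H` splits: there are non-trivial positively elliptic algebras `K`, `Q` and an exact sequence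
`0 → K → H → Q → 0` of graded algebras, that is, degree-preserving algebra homomorphisms
`ι : K → H` injective and `π : H → Q` surjective, such that the kernel of `π` is the ideal of `H`
generated by the image of the positive-degree elements of `K`. -/
def Splits (P : EllipticPresentation k) : Prop :=
  ∃ (l m : ℕ) (K : EllipticPresentation l) (Q : EllipticPresentation m)
    (ι : K.Alg →ₐ[ℚ] P.Alg) (π : P.Alg →ₐ[ℚ] Q.Alg),
    K.IsNontrivial ∧ Q.IsNontrivial ∧
    (∀ n, ∀ a ∈ K.piece n, ι a ∈ P.piece n) ∧
    (∀ n, ∀ a ∈ P.piece n, π a ∈ Q.piece n) ∧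
    Function.Injective ι ∧ Function.Surjective π ∧
    RingHom.ker π = Ideal.span {h | ∃ n, 0 < n ∧ ∃ a ∈ K.piece n, ι a = h}

end EllipticPresentation

/-! Suppose the formal dimension is at most 20 and halve all degrees, writing `w s` for the weights
of the variables and `d i` for those of the relations. The Hilbert series is `∏ (1 - t ^ d i) / ∏ (1
- t ^ w s)`, of degree `∑ d - ∑ w`, so `∑ d ≤ ∑ w + 10`. Together with `d i ≥ 2 * w i` this leaves
few possible weights. A derivation of weight `-e` lifts to a vector field `D = ∑ g s ∂_s` with `g s`
homogeneous of weight `w s - e` and without constant term, so `g s = 0` when `w s ≤ e`. The aim is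
to show that every `g s` lies in the ideal of relations; the derivation is then zero.

The two largest weights are (1, 4) or (2, 3). Let `z` be the heaviest variable. The relations have
only the trivial common zero, so one of them is monic in `z` (`exists_monic`). If `D = g z ∂_z`,
repeated differentiation along `z` of the expression of `D u` in the relations, `u` being the monic
one, yields `g z` in the ideal (`mem_of_quadratic`, `mem_of_monic`). For (1, 4) the field has this
form. For (2, 3) it does as soon as `g y = 0` for all `y` of weight 2, which needs proof only when
`e = 1` (`coeff_eq_zero_of_weight_two`).

Suppose then that some such `g y` is non-zero. By `pderiv_coeff_eq_zero`, `g z` has no linear term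
in the variables of weight 2. Choose `x` of weight 1 occurring in `g y`, and let the point `p`
(`dir`) have as coordinates the `x`-coefficients of the `g s` with `w s = 2`. All `g s` vanish at
`p`, and Euler's formula gives `∂_x (D f)(p) = (n / 2) f(p)` for `f` of weight `n`. For a relation
`u i` of least weight with `u i (p) ≠ 0`, this produces in `D (u i) = ∑ a j * u j` a term with `a j
(p) ≠ 0` and `d j` odd (`exists_odd_term`). Counting weights (`IsType.count`), and the fact that two
relations are non-zero on every plane spanned by a vector of weight 2 and `z`
(`not_forall_aeval_plane`), leave `d j = 3` and `d i = 4` or `6`.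

In these cases all `g y` are multiples of one linear form `ℓ`, and `ℓ * ℓ` and `ℓ * g z` lie in the
ideal generated by the relations of weight 2. Hence so does `ℓ * D (u i)`, whereas regularity of the
relations rules out the term `a j * u j` (`false_of_mul_mem`, applied in `false_of_unique` and
`false_of_pair`). -/

namespace MvPolynomial

/-! ### Weighted homogeneous polynomials, vector fields and Euler's formula. -/

section WeightedHomogeneous

variable {σ : Type*} {w : σ → ℤ} {f : MvPolynomial σ ℚ} {n : ℤ}

theorem IsWeightedHomogeneous.eq_zero_of_neg (hw : ∀ s, 0 < w s)
    (hf : IsWeightedHomogeneous w f n) (hn : n < 0) : f = 0 := by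
  refine hf.eq_zero_of_no_monomials fun m hm => ?_
  have : 0 ≤ Finsupp.weight w m := by
    rw [Finsupp.weight_apply]
    exact Finset.sum_nonneg fun s _ => nsmul_nonneg (hw s).le _
  omega

theorem IsWeightedHomogeneous.eq_C (hw : ∀ s, 0 < w s)
    (hf : IsWeightedHomogeneous w f 0) : f = C (constantCoeff f) := by
  classical
  refine hf.eq_monomial_of_unique_weight (d₀ := 0) fun m hm => ?_
  ext s
  by_contra hs
  rw [Finsupp.weight_apply] at hm
  have h1 := (Finset.sum_eq_zero_iff_of_nonneg
    fun s _ => nsmul_nonneg (hw s).le (m s)).1 hm s (Finsupp.mem_support_iff.2 hs)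
  have := hw s
  simp only [smul_eq_zero] at h1
  rcases h1 with h1 | h1
  · exact hs h1
  · omega

theorem weightedHomogeneousComponent_mul_of_isWeightedHomogeneous
    {M : Type*} [AddCancelCommMonoid M] {w : σ → M} {d : M} {u : MvPolynomial σ ℚ}
    (hu : IsWeightedHomogeneous w u d) (b : MvPolynomial σ ℚ) (n : M) :
    weightedHomogeneousComponent w (n + d) (b * u) = weightedHomogeneousComponent w n b * u := by
  classical
  let := weightedGradedAlgebra ℚ w
  have := DirectSum.coe_decompose_mul_add_of_right_mem (weightedHomogeneousSubmodule ℚ w)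
    (i := n) (a := b) ((mem_weightedHomogeneousSubmodule ℚ w d u).2 hu)
  have key (g : MvPolynomial σ ℚ) (m : M) :
      ((DirectSum.decompose (weightedHomogeneousSubmodule ℚ w) g m :
        weightedHomogeneousSubmodule ℚ w m) : MvPolynomial σ ℚ) =
          weightedHomogeneousComponent w m g := decompose'_apply ℚ w g m
  rwa [key, key] at this

/-- Integer weights let `n - d i` be negative; with positive variable weights the corresponding
coefficient is then zero, which is how most terms are discarded later. -/
theorem exists_eq_sum_of_mem_span {ι : Type*} [Fintype ι] {M : Type*} [AddCommGroup M] {w : σ → M}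
    {u : ι → MvPolynomial σ ℚ} {d : ι → M} {n : M}
    (hu : ∀ i, IsWeightedHomogeneous w (u i) (d i)) {S : Set ι}
    (hfS : f ∈ Ideal.span (u '' S)) (hf : IsWeightedHomogeneous w f n) :
    ∃ a : ι → MvPolynomial σ ℚ, (∀ i, IsWeightedHomogeneous w (a i) (n - d i)) ∧
      (∀ i ∉ S, a i = 0) ∧ f = ∑ i, a i * u i := by
  classical
  obtain ⟨b, hbS, hb⟩ : ∃ b : ι → MvPolynomial σ ℚ, (∀ i ∉ S, b i = 0) ∧ f = ∑ i, b i * u i := by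
    obtain ⟨b, hb, rfl⟩ := (Finsupp.mem_span_image_iff_linearCombination _).1 hfS
    refine ⟨b, fun i hi => ?_, ?_⟩
    · by_contra h
      exact hi ((Finsupp.mem_supported _ _).1 hb (Finsupp.mem_support_iff.2 h))
    · rw [Finsupp.linearCombination_apply, Finsupp.sum_fintype _ _ (by simp)]
      simp
  refine ⟨fun i => weightedHomogeneousComponent w (n - d i) (b i),
    fun i => weightedHomogeneousComponent_isWeightedHomogeneous .., fun i hi => by
      simp [hbS i hi], ?_⟩
  rw [← hf.weightedHomogeneousComponent_same, hb, map_sum]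
  refine Finset.sum_congr rfl fun i _ => ?_
  rw [← weightedHomogeneousComponent_mul_of_isWeightedHomogeneous (hu i), sub_add_cancel]

theorem pderiv_comm (s t : σ) (f : MvPolynomial σ ℚ) :
    pderiv s (pderiv t f) = pderiv t (pderiv s f) := by
  classical
  have : ⁅(pderiv s : Derivation ℚ (MvPolynomial σ ℚ) (MvPolynomial σ ℚ)),
      (pderiv t : Derivation ℚ (MvPolynomial σ ℚ) (MvPolynomial σ ℚ))⁆ = 0 := by
    refine derivation_ext fun i => ?_
    simp only [Derivation.commutator_apply, pderiv_X, Derivation.zero_apply]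
    by_cases h : t = i <;> by_cases h' : s = i <;> simp [h, h']
  have h := congrArg (fun D : Derivation ℚ (MvPolynomial σ ℚ) (MvPolynomial σ ℚ) => D f) this
  simpa [Derivation.commutator_apply, sub_eq_zero] using h

theorem IsWeightedHomogeneous.pderiv_sub (hf : IsWeightedHomogeneous w f n) (s : σ) :
    IsWeightedHomogeneous w (pderiv s f) (n - w s) :=
  hf.pderiv (by ring)

/-- The first order differential operator `∑ g_s ∂_s`. -/
noncomputable def vectorField [Fintype σ] (g : σ → MvPolynomial σ ℚ) :
    Derivation ℚ (MvPolynomial σ ℚ) (MvPolynomial σ ℚ) :=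
  ∑ s, g s • pderiv s

variable [Fintype σ] {g : σ → MvPolynomial σ ℚ}

theorem vectorField_apply (g : σ → MvPolynomial σ ℚ) (f : MvPolynomial σ ℚ) :
    vectorField g f = ∑ s, g s * pderiv s f := by
  classical
  have := congrFun (map_sum Derivation.coeFnAddMonoidHom (fun s => g s • pderiv s) Finset.univ) f
  rw [Finset.sum_apply] at this
  exact this

theorem IsWeightedHomogeneous.vectorField {e : ℤ}
    (hg : ∀ s, IsWeightedHomogeneous w (g s) (w s - e)) (hf : IsWeightedHomogeneous w f n) :
    IsWeightedHomogeneous w (vectorField g f) (n - e) := by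
  rw [vectorField_apply]
  refine IsWeightedHomogeneous.sum _ _ _ fun s _ => ?_
  have := (hg s).mul (hf.pderiv_sub s)
  rwa [show w s - e + (n - w s) = n - e by ring] at this

theorem pderiv_vectorField (g : σ → MvPolynomial σ ℚ) (t : σ) (f : MvPolynomial σ ℚ) :
    pderiv t (MvPolynomial.vectorField g f) = MvPolynomial.vectorField g (pderiv t f) +
      ∑ s, pderiv t (g s) * pderiv s f := by
  simp only [vectorField_apply, map_sum, pderiv_mul, ← Finset.sum_add_distrib]
  refine Finset.sum_congr rfl fun s _ => ?_
  rw [pderiv_comm t s]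
  ring

theorem IsWeightedHomogeneous.sum_weight_mul_pderiv (hf : IsWeightedHomogeneous w f n) :
    ∑ s, C (w s : ℚ) * (X s * pderiv s f) = C (n : ℚ) * f := by
  induction hf using IsWeightedHomogeneous.induction_on with
  | zero => simp
  | add p q hp hq ihp ihq => simp only [map_add, mul_add, Finset.sum_add_distrib, ihp, ihq]
  | monomial d r hd =>
    simp only [X_mul_pderiv_monomial, C_mul_monomial, smul_monomial]
    rw [← map_sum]
    congr 1
    rw [Finsupp.weight_apply, Finsupp.sum_fintype _ _ (by simp)] at hd
    rw [← hd]
    push_cast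
    rw [Finset.sum_mul]
    refine Finset.sum_congr rfl fun s _ => ?_
    simp
    ring

theorem IsWeightedHomogeneous.aeval_euler (hf : IsWeightedHomogeneous w f n) (P : σ → ℂ) :
    ∑ s, (w s : ℂ) * (P s * aeval P (pderiv s f)) = n * aeval P f := by
  have := congrArg (aeval P) hf.sum_weight_mul_pderiv
  simpa using this

theorem IsWeightedHomogeneous.exists_monomial_of_aeval_ne_zero
    (hf : IsWeightedHomogeneous w f n) {P : σ → ℂ} (h : aeval P f ≠ 0) :
    ∃ m : σ →₀ ℕ, (∀ s, m s ≠ 0 → P s ≠ 0) ∧ ∑ s, (m s : ℤ) * w s = n := by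
  rw [aeval_def, eval₂_eq'] at h
  obtain ⟨m, hm, h⟩ := Finset.exists_ne_zero_of_sum_ne_zero h
  refine ⟨m, fun s hs hP => h ?_, ?_⟩
  · rw [Finset.prod_eq_zero (Finset.mem_univ s) (by rw [hP, zero_pow hs]), mul_zero]
  · have := hf (mem_support_iff.1 hm)
    rw [Finsupp.weight_apply, Finsupp.sum_fintype _ _ (by simp)] at this
    rw [← this]
    simp

theorem IsWeightedHomogeneous.aeval_scale (hf : IsWeightedHomogeneous w f n) (P : σ → ℂ) {c : ℂ}
    (hc : c ≠ 0) : aeval (fun s => c ^ w s * P s) f = c ^ n * aeval P f := by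
  classical
  rw [aeval_def, eval₂_eq', aeval_def, eval₂_eq', Finset.mul_sum]
  refine Finset.sum_congr rfl fun m hm => ?_
  have := hf (mem_support_iff.1 hm)
  rw [Finsupp.weight_apply, Finsupp.sum_fintype _ _ (by simp)] at this
  rw [← this]
  simp only [mul_pow, Finset.prod_mul_distrib]
  have h : ∏ s, (c ^ w s) ^ m s = c ^ ∑ s, m s • w s := by
    induction (Finset.univ : Finset σ) using Finset.induction_on with
    | empty => simp
    | insert s S hs ih =>
      rw [Finset.prod_insert hs, Finset.sum_insert hs, zpow_add₀ hc, ih, ← zpow_natCast,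
        ← zpow_mul, nsmul_eq_mul, mul_comm (w s)]
  rw [h]
  ring

/-- A weighted homogeneous polynomial of positive weight has a non-trivial zero on every curve
`A + t B`, where `A` is supported in one weight, `B` in another, and the supports are disjoint. -/
theorem IsWeightedHomogeneous.exists_zero {p q : ℕ} (hp : 0 < p)
    (hf : IsWeightedHomogeneous w f n) (hn : 0 < n) (A B : σ → ℂ)
    (hA : ∀ s, A s ≠ 0 → w s = p) (hB : ∀ s, B s ≠ 0 → w s = q) :
    (∃ t : ℂ, aeval (fun s => A s + B s * t) f = 0) ∨ aeval B f = 0 := by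
  classical
  let φ : Polynomial ℂ := aeval (fun s => Polynomial.C (A s) + Polynomial.C (B s) * Polynomial.X) f
  have hφ : ∀ t, φ.eval t = aeval (fun s => A s + B s * t) f := by
    intro t
    have := comp_aeval_apply (R := ℚ)
      (fun s => Polynomial.C (A s) + Polynomial.C (B s) * Polynomial.X)
      ((Polynomial.aeval t).restrictScalars ℚ) f
    simpa [φ, Polynomial.aeval_def] using this
  -- The zero polynomial has degree `⊥` and belongs to the branch with a root; otherwise `φ` is a
  -- non-zero constant.
  by_cases hdeg : φ.degree = 0
  swap
  · obtain ⟨t, ht⟩ := IsAlgClosed.exists_root φ hdeg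
    exact Or.inl ⟨t, by rw [← hφ]; exact ht⟩
  · right
    obtain ⟨c, hc⟩ : ∃ c, φ = Polynomial.C c := ⟨_, Polynomial.eq_C_of_degree_eq_zero hdeg⟩
    have hval : ∀ t, aeval (fun s => A s + B s * t) f = c := fun t => by
      rw [← hφ, hc, Polynomial.eval_C]
    -- Scaling the point `A + B / t ^ q` by `t` gives `A t ^ p + B`, so `f` takes the value `t ^ n *
    -- c` there for `t ≠ 0`, hence also at `t = 0`.
    let ψ : Polynomial ℂ :=
      aeval (fun s => Polynomial.C (A s) * Polynomial.X ^ p + Polynomial.C (B s)) f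
    have hψ : ∀ t, ψ.eval t = aeval (fun s => A s * t ^ p + B s) f := by
      intro t
      have := comp_aeval_apply (R := ℚ)
        (fun s => Polynomial.C (A s) * Polynomial.X ^ p + Polynomial.C (B s))
        ((Polynomial.aeval t).restrictScalars ℚ) f
      simpa [ψ, Polynomial.aeval_def] using this
    have hψ' : ψ = Polynomial.X ^ n.toNat * Polynomial.C c := by
      refine Polynomial.eq_of_infinite_eval_eq _ _ ?_
      refine Set.Infinite.mono (s := {0}ᶜ) (fun t ht => ?_) (Set.finite_singleton _).infinite_compl
      have ht : t ≠ 0 := ht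
      have h1 := hf.aeval_scale (fun s => A s + B s * (t ^ q)⁻¹) ht
      rw [hval] at h1
      simp only [Set.mem_ofPred_eq, hψ, Polynomial.eval_mul, Polynomial.eval_pow, Polynomial.eval_X,
        Polynomial.eval_C]
      rw [← zpow_natCast t n.toNat, Int.toNat_of_nonneg hn.le, ← h1]
      congr 2
      funext s
      have hA' : t ^ w s * A s = A s * t ^ p := by
        by_cases h : A s = 0
        · simp [h]
        · rw [hA s h, zpow_natCast, mul_comm]
      have hB' : t ^ w s * B s = t ^ q * B s := by
        by_cases h : B s = 0
        · simp [h]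
        · rw [hB s h, zpow_natCast]
      have := pow_ne_zero q ht
      rw [mul_add, hA', ← mul_assoc, hB']
      field_simp
    have h0 := hψ 0
    rw [hψ', zero_pow hp.ne'] at h0
    have hn' : n.toNat ≠ 0 := by omega
    simpa [hn'] using h0.symm

end WeightedHomogeneous

end MvPolynomial

/-! ### The degree of a Hilbert series. -/

open PowerSeries in
theorem PowerSeries.exists_top_of_mul_prod {ι κ : Type*} [Fintype ι] [Fintype κ]
    (hc : Fintype.card ι = Fintype.card κ) {H : PowerSeries ℤ} (hH : ∀ n, 0 ≤ coeff n H)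
    {w : ι → ℕ} {d : κ → ℕ} (hw : ∀ s, 0 < w s) (hd : ∀ i, 0 < d i)
    (h : H * ∏ s, (1 - X ^ w s) = ∏ i, (1 - X ^ d i)) :
    ∃ N, N + ∑ s, w s = ∑ i, d i ∧ coeff N H ≠ 0 ∧ ∀ n, N < n → coeff n H = 0 := by
  classical
  -- `G n = (1 - X ^ n) / (1 - X)`. Since the two products have equally many factors, the powers of
  -- `1 - X` cancel, leaving `H * a = b` with `a`, `b` monic.
  let G : ℕ → Polynomial ℤ := fun n => ∑ i ∈ Finset.range n, Polynomial.X ^ i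
  have hG : ∀ n, ((G n : Polynomial ℤ) : PowerSeries ℤ) * (1 - X) = 1 - X ^ n := fun n => by
    have h1 := congrArg (fun p : Polynomial ℤ => (p : PowerSeries ℤ))
      (geom_sum_mul_neg (Polynomial.X : Polynomial ℤ) n)
    simpa [G] using h1
  have hX : (1 - X : PowerSeries ℤ) ≠ 0 := fun h0 => by
    have := congrArg (coeff 0) h0
    simp at this
  have hGm : ∀ n, 0 < n → (G n).Monic := fun n hn => Polynomial.monic_geom_sum_X hn.ne'
  have hGd : ∀ n, 0 < n → (G n).natDegree + 1 = n := fun n hn => by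
    have h1 := congrArg Polynomial.natDegree (geom_sum_mul (Polynomial.X : Polynomial ℤ) n)
    change (G n * _).natDegree = _ at h1
    rw [← Polynomial.C_1, (hGm n hn).natDegree_mul (Polynomial.monic_X_sub_C 1),
      Polynomial.natDegree_X_sub_C, Polynomial.natDegree_X_pow_sub_C] at h1
    exact h1
  set a : Polynomial ℤ := ∏ s, G (w s) with ha
  set b : Polynomial ℤ := ∏ i, G (d i) with hb
  have hab : H * (a : PowerSeries ℤ) = b := by
    have e1 : ∏ s, (1 - X ^ w s : PowerSeries ℤ) = (a : PowerSeries ℤ) * (1 - X : PowerSeries ℤ)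
        ^ Fintype.card ι := by
      simp only [← hG, Finset.prod_mul_distrib, Finset.prod_const, Finset.card_univ, ha]
      congr 1
      exact (map_prod (Polynomial.coeToPowerSeries.ringHom (R := ℤ)) _ _).symm
    have e2 : ∏ i, (1 - X ^ d i : PowerSeries ℤ) = (b : PowerSeries ℤ) * (1 - X : PowerSeries ℤ)
        ^ Fintype.card κ := by
      simp only [← hG, Finset.prod_mul_distrib, Finset.prod_const, Finset.card_univ, hb]
      congr 1
      exact (map_prod (Polynomial.coeToPowerSeries.ringHom (R := ℤ)) _ _).symm
    rw [e1, e2, hc, ← mul_assoc] at h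
    exact mul_right_cancel₀ (pow_ne_zero _ hX) h
  have ham : a.Monic := Polynomial.monic_prod_of_monic _ _ fun s _ => hGm _ (hw s)
  have hbm : b.Monic := Polynomial.monic_prod_of_monic _ _ fun s _ => hGm _ (hd s)
  have had : a.natDegree + Fintype.card ι = ∑ s, w s := by
    rw [ha, Polynomial.natDegree_prod_of_monic _ _ fun s _ => hGm _ (hw s), ← Finset.card_univ,
      Finset.card_eq_sum_ones, ← Finset.sum_add_distrib]
    exact Finset.sum_congr rfl fun s _ => hGd _ (hw s)
  have hbd : b.natDegree + Fintype.card κ = ∑ i, d i := by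
    rw [hb, Polynomial.natDegree_prod_of_monic _ _ fun s _ => hGm _ (hd s), ← Finset.card_univ,
      Finset.card_eq_sum_ones, ← Finset.sum_add_distrib]
    exact Finset.sum_congr rfl fun s _ => hGd _ (hd s)
  have ha0 : a.coeff 0 = 1 := by
    rw [ha, Polynomial.coeff_zero_prod]
    refine Finset.prod_eq_one fun s _ => ?_
    have := hw s
    simp [G, Polynomial.coeff_X_pow, this]
  have hapos : ∀ n, 0 ≤ a.coeff n := by
    have : ∀ S : Finset ι, ∀ n, 0 ≤ (∏ s ∈ S, G (w s)).coeff n := fun S => by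
      induction S using Finset.induction_on with
      | empty =>
        intro n
        rw [Finset.prod_empty, Polynomial.coeff_one]
        split_ifs <;> simp
      | insert i S hi ih =>
        intro n
        rw [Finset.prod_insert hi, Polynomial.coeff_mul]
        refine Finset.sum_nonneg fun p _ => mul_nonneg ?_ (ih _)
        rw [Polynomial.finsetSum_coeff]
        refine Finset.sum_nonneg fun j _ => ?_
        rw [Polynomial.coeff_X_pow]
        split_ifs <;> simp
    exact this _
  -- As `a` has constant term 1 and no negative coefficients, `H` is bounded by `b` coefficientwise
  -- and is therefore a polynomial.
  have hle : ∀ n, coeff n H ≤ b.coeff n := fun n => by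
    rw [← Polynomial.coeff_coe, ← hab, coeff_mul]
    have h1 := Finset.single_le_sum (f := fun p : ℕ × ℕ => coeff p.1 H * coeff p.2 (a :
        PowerSeries ℤ))
      (s := Finset.HasAntidiagonal.antidiagonal n) (fun p _ => mul_nonneg (hH _) (by
        rw [Polynomial.coeff_coe]
        exact hapos _)) (a := (n, 0)) (by simp)
    simpa [ha0] using h1
  set p : Polynomial ℤ := trunc (b.natDegree + 1) H with hp
  have hpH : (p : PowerSeries ℤ) = H := by
    ext n
    rw [Polynomial.coeff_coe, hp, coeff_trunc]
    split_ifs with hn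
    · rfl
    · refine le_antisymm (hH n) ((hle n).trans ?_)
      rw [Polynomial.coeff_eq_zero_of_natDegree_lt (by omega)]
  have hpab : p * a = b := by
    rw [← hpH] at hab
    exact_mod_cast hab
  have hp0 : p ≠ 0 := fun h0 => hbm.ne_zero (by rw [← hpab, h0, zero_mul])
  have hdeg := Polynomial.natDegree_mul hp0 ham.ne_zero
  rw [hpab] at hdeg
  refine ⟨p.natDegree, by omega, ?_, fun n hn => ?_⟩
  · rw [← hpH, Polynomial.coeff_coe]
    exact Polynomial.leadingCoeff_ne_zero.2 hp0
  · rw [← hpH, Polynomial.coeff_coe]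
    exact Polynomial.coeff_eq_zero_of_natDegree_lt hn

/-! ### Hilbert series of quotients by regular sequences. -/

namespace MvPolynomial

section Hilbert

variable {σ : Type*} {w : σ → ℕ}

/-- The graded piece of degree `n` of the quotient of a weighted polynomial ring. -/
noncomputable def gradedPiece (w : σ → ℕ) (I : Ideal (MvPolynomial σ ℚ)) (n : ℕ) :
    Submodule ℚ (MvPolynomial σ ℚ ⧸ I) :=
  (weightedHomogeneousSubmodule ℚ w n).map (Ideal.Quotient.mkₐ ℚ I).toLinearMap

theorem mem_gradedPiece {I : Ideal (MvPolynomial σ ℚ)} {n : ℕ} {x : MvPolynomial σ ℚ ⧸ I} :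
    x ∈ gradedPiece w I n ↔ ∃ f, IsWeightedHomogeneous w f n ∧ Ideal.Quotient.mk I f = x :=
  Iff.rfl

/-- An ideal containing the weighted homogeneous components of its elements. -/
def IsComponentClosed (w : σ → ℕ) (I : Ideal (MvPolynomial σ ℚ)) : Prop :=
  ∀ f ∈ I, ∀ n, weightedHomogeneousComponent w n f ∈ I

theorem isComponentClosed_span {ι : Type*} {u : ι → MvPolynomial σ ℚ} {d : ι → ℕ}
    (hu : ∀ i, IsWeightedHomogeneous w (u i) (d i)) (S : Set ι) :
    IsComponentClosed w (Ideal.span (u '' S)) := by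
  classical
  intro f hf n
  let := weightedGradedAlgebra ℚ w
  refine weightedHomogeneousComponent_mem_of_mem ℚ w (Ideal.homogeneous_span _ _ ?_) hf n
  rintro _ ⟨i, -, rfl⟩
  exact ⟨d i, hu i⟩

theorem weightedHomogeneousComponent_mul_eq_zero {d n : ℕ} {u : MvPolynomial σ ℚ}
    (hu : IsWeightedHomogeneous w u d) (b : MvPolynomial σ ℚ) (hn : ¬d ≤ n) :
    weightedHomogeneousComponent w n (b * u) = 0 := by
  classical
  let := weightedGradedAlgebra ℚ w
  have := DirectSum.coe_decompose_mul_of_right_mem_of_not_le (weightedHomogeneousSubmodule ℚ w)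
    (a := b) ((mem_weightedHomogeneousSubmodule ℚ w d u).2 hu) hn
  rwa [show ((DirectSum.decompose (weightedHomogeneousSubmodule ℚ w) (b * u) n :
    weightedHomogeneousSubmodule ℚ w n) : MvPolynomial σ ℚ) =
      weightedHomogeneousComponent w n (b * u) from decompose'_apply ℚ w _ _] at this

theorem finrank_map_add_finrank_inf_ker {V V' : Type*} [AddCommGroup V] [Module ℚ V]
    [AddCommGroup V'] [Module ℚ V'] (F : V →ₗ[ℚ] V') (W : Submodule ℚ V)
    [FiniteDimensional ℚ W] :
    Module.finrank ℚ (W.map F) + Module.finrank ℚ ↥(W ⊓ LinearMap.ker F) = Module.finrank ℚ W := by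
  have h := LinearMap.finrank_range_add_finrank_ker (F.domRestrict W)
  rw [LinearMap.range_domRestrict] at h
  rw [← h, LinearMap.ker_domRestrict, ← Submodule.map_comap_subtype]
  congr 1
  exact (Submodule.equivMapOfInjective _ W.injective_subtype _).symm.finrank_eq

/-- The variables are themselves a regular sequence, with quotient `ℚ`; this determines the Hilbert
series of the polynomial ring. -/
theorem X_regular (S : Set σ) (i : σ) (hi : i ∉ S) (a : MvPolynomial σ ℚ)
    (ha : a * X i ∈ Ideal.span ((X : σ → MvPolynomial σ ℚ) '' S)) :
    a ∈ Ideal.span ((X : σ → MvPolynomial σ ℚ) '' S) := by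
  classical
  rw [mem_ideal_span_X_image] at ha ⊢
  intro m hm
  obtain ⟨j, hj, hne⟩ := ha (m + Finsupp.single i 1) (by
    rw [mem_support_iff, coeff_mul_X]
    exact mem_support_iff.1 hm)
  refine ⟨j, hj, ?_⟩
  rwa [Finsupp.add_apply, Finsupp.single_eq_of_ne (ne_of_mem_of_not_mem hj hi), add_zero] at hne


theorem finiteDimensional_gradedPiece [Finite σ] (hw : ∀ s, 0 < w s) (I : Ideal (MvPolynomial σ
    ℚ)) (n : ℕ) :
    FiniteDimensional ℚ (gradedPiece w I n) := by
  have := Module.Finite.iff_fg.2 (weightedHomogeneousSubmodule_fg ℚ w (fun s => (hw s).ne') n)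
  exact Module.Finite.map _ _

/-- The Hilbert series of the quotient of a weighted polynomial ring. -/
noncomputable def hilbertSeries (w : σ → ℕ) (I : Ideal (MvPolynomial σ ℚ)) : PowerSeries ℤ :=
  PowerSeries.mk fun n => (Module.finrank ℚ (gradedPiece w I n) : ℤ)

/-- Multiplication by `u` gives, in each degree, the exact sequence `0 → (R/I)(-d) → R/I → R/J → 0`.
-/
theorem hilbertSeries_sup_span [Finite σ] (hw : ∀ s, 0 < w s) {I J : Ideal (MvPolynomial σ ℚ)}
    (hI : IsComponentClosed w I) {u : MvPolynomial σ ℚ} {d : ℕ} (hu : IsWeightedHomogeneous w u d)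
    (hJ : J = I ⊔ Ideal.span {u}) (hreg : ∀ a, a * u ∈ I → a ∈ I) :
    hilbertSeries w J = hilbertSeries w I * (1 - PowerSeries.X ^ d) := by
  classical
  have hIJ : I ≤ J := hJ ▸ le_sup_left
  let F : (MvPolynomial σ ℚ ⧸ I) →ₗ[ℚ] (MvPolynomial σ ℚ ⧸ J) :=
    (Ideal.Quotient.factorₐ ℚ hIJ).toLinearMap
  let m : (MvPolynomial σ ℚ ⧸ I) →ₗ[ℚ] (MvPolynomial σ ℚ ⧸ I) :=
    LinearMap.mulRight ℚ (Ideal.Quotient.mk I u)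
  have hm : Function.Injective m := by
    rw [injective_iff_map_eq_zero]
    intro x hx
    obtain ⟨f, rfl⟩ := Ideal.Quotient.mk_surjective x
    have : f * u ∈ I := by
      rw [← Ideal.Quotient.eq_zero_iff_mem, map_mul]
      exact hx
    exact Ideal.Quotient.eq_zero_iff_mem.2 (hreg f this)
  have hmap (n : ℕ) : (gradedPiece w I n).map F = gradedPiece w J n := by
    rw [gradedPiece, gradedPiece, ← Submodule.map_comp]
    rfl
  have hker (n : ℕ) : gradedPiece w I n ⊓ LinearMap.ker F =
      if d ≤ n then (gradedPiece w I (n - d)).map m else ⊥ := by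
    apply le_antisymm
    · rintro x ⟨hx, hxF⟩
      obtain ⟨f, hf, rfl⟩ := mem_gradedPiece.1 hx
      have hfJ : f ∈ J := Ideal.Quotient.eq_zero_iff_mem.1 hxF
      rw [hJ] at hfJ
      obtain ⟨c, hc, y, hy, hfb⟩ := Submodule.mem_sup.1 hfJ
      obtain ⟨b, rfl⟩ := Ideal.mem_span_singleton'.1 hy
      have hcomp := congrArg (weightedHomogeneousComponent w n) hfb
      rw [map_add, hf.weightedHomogeneousComponent_same] at hcomp
      split_ifs with hn
      · refine ⟨Ideal.Quotient.mk I (weightedHomogeneousComponent w (n - d) b),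
          mem_gradedPiece.2 ⟨_, weightedHomogeneousComponent_isWeightedHomogeneous .., rfl⟩, ?_⟩
        change Ideal.Quotient.mk I _ * Ideal.Quotient.mk I u = _
        rw [← map_mul, ← weightedHomogeneousComponent_mul_of_isWeightedHomogeneous hu,
          Nat.sub_add_cancel hn, Ideal.Quotient.eq, ← hcomp, sub_add_cancel_right]
        exact neg_mem (hI c hc n)
      · rw [weightedHomogeneousComponent_mul_eq_zero hu b hn, add_zero] at hcomp
        rw [Submodule.mem_bot, Ideal.Quotient.eq_zero_iff_mem, ← hcomp]
        exact hI c hc n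
    · split_ifs with hn
      · rintro _ ⟨x, hx, rfl⟩
        obtain ⟨f, hf, rfl⟩ := mem_gradedPiece.1 hx
        refine ⟨mem_gradedPiece.2 ⟨f * u, ?_, map_mul _ _ _⟩, ?_⟩
        · have := hf.mul hu
          rwa [Nat.sub_add_cancel hn] at this
        · refine (Ideal.Quotient.eq_zero_iff_mem (I := J) (a := f * u)).2 ?_
          rw [hJ]
          exact Ideal.mul_mem_left _ _ (Ideal.mem_sup_right (Ideal.mem_span_singleton_self u))
      · exact bot_le
  ext n
  have hfin := finiteDimensional_gradedPiece hw I n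
  have h1 := finrank_map_add_finrank_inf_ker F (gradedPiece w I n)
  rw [hmap, hker] at h1
  rw [mul_sub, mul_one, map_sub, PowerSeries.coeff_mul_X_pow']
  simp only [hilbertSeries, PowerSeries.coeff_mk]
  split_ifs with hn
  · rw [if_pos hn, ← (Submodule.equivMapOfInjective m hm (gradedPiece w I (n - d))).finrank_eq]
      at h1
    omega
  · rw [if_neg hn, finrank_bot] at h1
    omega

theorem hilbertSeries_span [Finite σ] (hw : ∀ s, 0 < w s) {ι : Type*} {u : ι → MvPolynomial σ ℚ}
    {d : ι → ℕ}
    (hu : ∀ i, IsWeightedHomogeneous w (u i) (d i))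
    (hreg : ∀ (S : Set ι), ∀ i ∉ S, ∀ a, a * u i ∈ Ideal.span (u '' S) → a ∈ Ideal.span (u '' S))
    (S : Finset ι) : hilbertSeries w (Ideal.span (u '' S)) =
      hilbertSeries w ⊥ * ∏ i ∈ S, (1 - PowerSeries.X ^ d i) := by
  classical
  induction S using Finset.induction_on with
  | empty => simp
  | insert i S hi ih =>
    rw [Finset.prod_insert hi, mul_comm (1 - PowerSeries.X ^ d i), ← mul_assoc, ← ih]
    refine hilbertSeries_sup_span hw (isComponentClosed_span hu _) (hu i) ?_
      (hreg S i (by simpa using hi))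
    rw [Finset.coe_insert, Set.image_insert_eq, Ideal.span_insert, sup_comm]

theorem hilbertSeries_span_X (hw : ∀ s, 0 < w s) :
    hilbertSeries w (Ideal.span ((X : σ → MvPolynomial σ ℚ) '' Set.univ)) = 1 := by
  classical
  ext n
  rw [hilbertSeries, PowerSeries.coeff_mk, PowerSeries.coeff_one]
  split_ifs with hn
  · subst hn
    have : gradedPiece w (Ideal.span ((X : σ → MvPolynomial σ ℚ) '' Set.univ)) 0 =
        Submodule.span ℚ {1} := by
      apply le_antisymm
      · intro x hx
        obtain ⟨f, hf, rfl⟩ := mem_gradedPiece.1 hx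
        rw [Submodule.mem_span_singleton]
        have hfC : f = C (constantCoeff f) := by
          refine hf.eq_monomial_of_unique_weight (d₀ := 0) fun m hm => Finsupp.ext ?_
          exact (weightedDegree_eq_zero_iff (nonTorsionWeight_of fun s => (hw s).ne')).1 hm
        refine ⟨constantCoeff f, ?_⟩
        conv_rhs => rw [hfC]
        exact (Algebra.algebraMap_eq_smul_one _).symm
      · rw [Submodule.span_singleton_le_iff_mem]
        exact mem_gradedPiece.2 ⟨1, isWeightedHomogeneous_one ℚ w, map_one _⟩
    rw [this, finrank_span_singleton]
    · simp
    · intro h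
      have : (1 : MvPolynomial σ ℚ) ∈ Ideal.span ((X : σ → MvPolynomial σ ℚ) '' Set.univ) :=
        Ideal.Quotient.eq_zero_iff_mem.1 h
      rw [mem_ideal_span_X_image] at this
      simpa using this 0 (by simp)
  · have : gradedPiece w (Ideal.span ((X : σ → MvPolynomial σ ℚ) '' Set.univ)) n = ⊥ := by
      rw [eq_bot_iff]
      intro x hx
      obtain ⟨f, hf, rfl⟩ := mem_gradedPiece.1 hx
      rw [Submodule.mem_bot, Ideal.Quotient.eq_zero_iff_mem, mem_ideal_span_X_image]
      intro m hm
      by_contra! h0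
      have hm0 : m = 0 := by
        ext s
        exact h0 s (Set.mem_univ s)
      have := hf (mem_support_iff.1 hm)
      rw [hm0, map_zero] at this
      exact hn this.symm
    rw [this, finrank_bot]
    rfl

/-- The multiplicativity formula is used twice, for the relations and for the variables, and the
series of the polynomial ring is eliminated. -/
theorem hilbertSeries_mul_prod [Fintype σ] (hw : ∀ s, 0 < w s) {ι : Type*} [Fintype ι]
    {u : ι → MvPolynomial σ ℚ} {d : ι → ℕ} (hu : ∀ i, IsWeightedHomogeneous w (u i) (d i))
    (hreg : ∀ (S : Set ι), ∀ i ∉ S, ∀ a, a * u i ∈ Ideal.span (u '' S) → a ∈ Ideal.span (u '' S)) :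
    hilbertSeries w (Ideal.span (Set.range u)) * ∏ s, (1 - PowerSeries.X ^ w s) =
      ∏ i, (1 - PowerSeries.X ^ d i) := by
  have h1 := hilbertSeries_span hw hu hreg Finset.univ
  have h2 := hilbertSeries_span hw (isWeightedHomogeneous_X ℚ w) X_regular Finset.univ
  rw [Finset.coe_univ] at h1 h2
  rw [Set.image_univ] at h1
  rw [hilbertSeries_span_X hw] at h2
  rw [h1, mul_right_comm, ← h2, one_mul]

end Hilbert

end MvPolynomial

/-! ### Permuting homogeneous regular sequences. -/

namespace MvPolynomial

/-- A graded Krull intersection: as `d > 0`, a multiple of `u ^ (m + 1)` has no component of weight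
`m`. -/
theorem IsComponentClosed.mem_of_forall {σ : Type*} {w : σ → ℕ} {I : Ideal (MvPolynomial σ ℚ)}
    (hI : IsComponentClosed w I) {u : MvPolynomial σ ℚ} {d : ℕ} (hd : 0 < d)
    (hu : IsWeightedHomogeneous w u d) {x : MvPolynomial σ ℚ}
    (hx : ∀ n : ℕ, ∃ b, x - u ^ n * b ∈ I) : x ∈ I := by
  classical
  have h : ∀ m, weightedHomogeneousComponent w m x ∈ I := fun m => by
    obtain ⟨b, hb⟩ := hx (m + 1)
    have h1 := hI _ hb m
    have h2 : ¬ (m + 1) * d ≤ m := by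
      rw [not_le]
      nlinarith
    rwa [map_sub, mul_comm, weightedHomogeneousComponent_mul_eq_zero (by simpa using hu.pow (m + 1))
      b h2, sub_zero] at h1
  rw [← sum_weightedHomogeneousComponent w x, finsum_eq_sum _
      (weightedHomogeneousComponent_finsupp x)]
  exact sum_mem fun m _ => h m

open RingTheory.Sequence in
open scoped Pointwise in
/-- A weighted homogeneous regular sequence of elements of positive degree can be permuted. -/
theorem mem_span_of_mul_mem_span {σ : Type*} {w : σ → ℕ} {k : ℕ}
    {u : Fin k → MvPolynomial σ ℚ} {d : Fin k → ℕ} (hd : ∀ i, 0 < d i)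
    (hu : ∀ i, IsWeightedHomogeneous w (u i) (d i))
    (hreg : IsWeaklyRegular (MvPolynomial σ ℚ) (List.ofFn u)) (S : Set (Fin k)) (i : Fin k)
    (hi : i ∉ S) (a : MvPolynomial σ ℚ) (ha : a * u i ∈ Ideal.span (u '' S)) :
    a ∈ Ideal.span (u '' S) := by
  classical
  set F := (List.finRange k).filter (fun j => decide (j ∈ S))
  set N := (List.finRange k).filter (fun j => !decide (j ∈ S))
  have hperm : (List.ofFn u).Perm (F.map u ++ u i :: (N.erase i).map u) := by
    rw [List.ofFn_eq_map, ← List.map_cons, ← List.map_append]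
    refine List.Perm.map u ?_
    refine (List.filter_append_perm (fun j => decide (j ∈ S)) _).symm.trans ?_
    exact List.Perm.append_left _ (List.perm_cons_erase (by simp [hi]))
  -- Exchanging neighbours requires a Nakayama property: a submodule `K` with `K = u j • K` is zero.
  -- Its elements are divisible by every power of `u j`.
  have h := hreg.prototype_perm hperm fun b c rs' hsub => by
    intro K hK
    have hmem : ∀ r ∈ b :: c :: rs', ∃ j, u j = r := fun r hr => by
      have := hsub.subset hr
      rwa [List.mem_ofFn] at this
    obtain ⟨j, rfl⟩ := hmem b (by simp)
    have hspan : (Ideal.ofList rs' • ⊤ : Submodule (MvPolynomial σ ℚ) (MvPolynomial σ ℚ)) =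
        Ideal.span (u '' {j | u j ∈ rs'}) := by
      rw [smul_eq_mul, Ideal.mul_top, Ideal.ofList]
      congr 1
      ext r
      refine ⟨fun hr => ?_, ?_⟩
      · obtain ⟨j, rfl⟩ := hmem r (by simp [show r ∈ rs' from hr])
        exact ⟨j, hr, rfl⟩
      · rintro ⟨j, hj, rfl⟩
        exact hj
    rw [eq_bot_iff]
    intro y hy
    have hn : ∀ n : ℕ, ∃ y' ∈ K, y = u j ^ n • y' := fun n => by
      induction n with
      | zero => exact ⟨y, hy, by simp⟩
      | succ n ih =>
        obtain ⟨y', hy', e⟩ := ih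
        rw [hK] at hy'
        obtain ⟨y'', hy'', e'⟩ := (Submodule.mem_smul_pointwise_iff_exists _ _ _).1 hy'
        exact ⟨y'', hy'', by rw [e, ← e', smul_smul, pow_succ]⟩
    obtain ⟨x, rfl⟩ := Submodule.Quotient.mk_surjective _ y
    rw [Submodule.mem_bot, Submodule.Quotient.mk_eq_zero, hspan]
    refine (isComponentClosed_span hu _).mem_of_forall (hd j) (hu j) fun n => ?_
    obtain ⟨y', -, e⟩ := hn n
    obtain ⟨x', rfl⟩ := Submodule.Quotient.mk_surjective _ y'
    rw [← Submodule.Quotient.mk_smul, Submodule.Quotient.eq, hspan] at e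
    exact ⟨x', e⟩
  rw [isWeaklyRegular_append_iff, isWeaklyRegular_cons_iff] at h
  have h1 := (isSMulRegular_quotient_iff_mem_of_smul_mem _ _).1 h.2.1 a
  have hspan : (Ideal.ofList (F.map u) • ⊤ : Submodule (MvPolynomial σ ℚ) (MvPolynomial σ ℚ)) =
      Ideal.span (u '' S) := by
    rw [smul_eq_mul, Ideal.mul_top, Ideal.ofList]
    congr 1
    ext r
    simp [F]
  rw [hspan, smul_eq_mul, mul_comm] at h1
  exact h1 ha

end MvPolynomial

/-! ### Complete intersections in halved degrees; derivations along a single variable. -/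

open MvPolynomial

/-- A complete intersection `ℚ[x]/(u)` with as many relations as variables, in halved degrees,
whose socle degree is at most `10`. -/
structure PureCI (σ : Type*) [Fintype σ] where
  /-- the weights of the variables -/
  w : σ → ℤ
  /-- the weights of the relations -/
  d : σ → ℤ
  /-- the relations -/
  u : σ → MvPolynomial σ ℚ
  w_pos : ∀ s, 0 < w s
  hom : ∀ i, IsWeightedHomogeneous w (u i) (d i)
  two_mul_le : ∀ i, 2 * w i ≤ d i
  sum_le : ∑ i, d i ≤ ∑ i, w i + 10
  lin : ∀ i s, constantCoeff (pderiv s (u i)) = 0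
  regular : ∀ (S : Set σ), ∀ i ∉ S, ∀ a, a * u i ∈ Ideal.span (u '' S) → a ∈ Ideal.span (u '' S)
  exists_ne : ∀ P : σ → ℂ, P ≠ 0 → ∃ i, aeval P (u i) ≠ 0

namespace PureCI

variable {σ : Type*} [Fintype σ] (A : PureCI σ)

/-- The ideal of relations. -/
noncomputable def ideal : Ideal (MvPolynomial σ ℚ) := Ideal.span (Set.range A.u)

theorem u_mem (i : σ) : A.u i ∈ A.ideal := Ideal.subset_span ⟨i, rfl⟩

theorem span_le_ideal (S : Set σ) : Ideal.span (A.u '' S) ≤ A.ideal :=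
  Ideal.span_mono (Set.image_subset_range _ _)

theorem exists_rep_span {f : MvPolynomial σ ℚ} {n : ℤ} {S : Set σ} (hf : f ∈ Ideal.span (A.u '' S))
    (hn : IsWeightedHomogeneous A.w f n) : ∃ a : σ → MvPolynomial σ ℚ,
      (∀ i, IsWeightedHomogeneous A.w (a i) (n - A.d i)) ∧ (∀ i ∉ S, a i = 0) ∧
        f = ∑ i, a i * A.u i :=
  exists_eq_sum_of_mem_span A.hom hf hn

theorem exists_rep {f : MvPolynomial σ ℚ} {n : ℤ} (hf : f ∈ A.ideal)
    (hn : IsWeightedHomogeneous A.w f n) : ∃ a : σ → MvPolynomial σ ℚ,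
      (∀ i, IsWeightedHomogeneous A.w (a i) (n - A.d i)) ∧ f = ∑ i, a i * A.u i := by
  rw [ideal, ← Set.image_univ] at hf
  obtain ⟨a, ha, -, h⟩ := A.exists_rep_span hf hn
  exact ⟨a, ha, h⟩

variable {A}

theorem eq_zero {f : MvPolynomial σ ℚ} {n : ℤ} (hf : IsWeightedHomogeneous A.w f n) (hn : n < 0) :
    f = 0 :=
  hf.eq_zero_of_neg A.w_pos hn

theorem pderiv_eq_zero {f : MvPolynomial σ ℚ} {n : ℤ} (hf : IsWeightedHomogeneous A.w f n) {s : σ}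
    (hn : n < A.w s) : pderiv s f = 0 :=
  eq_zero (hf.pderiv_sub s) (by linarith)

theorem pderiv_pderiv_eq_zero {f : MvPolynomial σ ℚ} {n : ℤ} (hf : IsWeightedHomogeneous A.w f n)
    {s t : σ} (hn : n < A.w s + A.w t) : pderiv s (pderiv t f) = 0 :=
  pderiv_eq_zero (hf.pderiv_sub t) (by linarith)

theorem pderiv_u_eq_zero {i s : σ} (h : A.d i ≤ A.w s) : pderiv s (A.u i) = 0 := by
  rcases h.lt_or_eq with h | h
  · exact pderiv_eq_zero (A.hom i) h
  · have := (A.hom i).pderiv_sub s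
    rw [h, sub_self] at this
    rw [this.eq_C A.w_pos, A.lin, map_zero]

theorem two_le_d (i : σ) : 2 ≤ A.d i := by
  have := A.two_mul_le i
  have := A.w_pos i
  omega

/-- A homogeneous derivation of degree `-e`, preserving the ideal of relations. -/
structure IsNegDer (A : PureCI σ) (g : σ → MvPolynomial σ ℚ) (e : ℤ) : Prop where
  pos : 0 < e
  hom : ∀ s, IsWeightedHomogeneous A.w (g s) (A.w s - e)
  const : ∀ s, constantCoeff (g s) = 0
  map_u : ∀ i, vectorField g (A.u i) ∈ A.ideal

namespace IsNegDer

variable {g : σ → MvPolynomial σ ℚ} {e : ℤ}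

theorem map_mem (h : A.IsNegDer g e) {f : MvPolynomial σ ℚ} (hf : f ∈ A.ideal) :
    vectorField g f ∈ A.ideal := by
  induction hf using Submodule.span_induction with
  | mem x hx =>
    obtain ⟨i, rfl⟩ := hx
    exact h.map_u i
  | zero => simp
  | add x y _ _ hx hy => simpa using add_mem hx hy
  | smul a x hx ih =>
    simp only [smul_eq_mul, Derivation.leibniz]
    exact add_mem (Ideal.mul_mem_left _ _ ih) (Ideal.mul_mem_right _ _ hx)

theorem coeff_eq_zero (h : A.IsNegDer g e) {s : σ} (hs : A.w s ≤ e) : g s = 0 := by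
  rcases hs.lt_or_eq with hs | hs
  · exact eq_zero (h.hom s) (by linarith)
  · have := h.hom s
    rw [hs, sub_self] at this
    rw [this.eq_C A.w_pos, h.const, map_zero]

theorem exists_rep (h : A.IsNegDer g e) (i : σ) : ∃ a : σ → MvPolynomial σ ℚ,
    (∀ j, IsWeightedHomogeneous A.w (a j) (A.d i - e - A.d j)) ∧
      vectorField g (A.u i) = ∑ j, a j * A.u j :=
  A.exists_rep (h.map_u i) ((A.hom i).vectorField h.hom)

theorem apply_of_forall_ne {z : σ} (hz : ∀ s ≠ z, g s = 0) (f : MvPolynomial σ ℚ) :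
    vectorField g f = g z * pderiv z f := by
  rw [vectorField_apply, Finset.sum_eq_single z]
  · intro s _ hs
    rw [hz s hs, zero_mul]
  · simp

theorem pderiv_self (h : A.IsNegDer g e) (z : σ) : pderiv z (g z) = 0 :=
  pderiv_eq_zero (h.hom z) (by linarith [h.pos])

end IsNegDer

/-- Regularity in the form used to compare two representations of one element: the relation `u i` is
a non-zero-divisor modulo all the others. -/
theorem mul_mem_of_sum_mul_eq_zero {b : σ → MvPolynomial σ ℚ} (hb : ∑ j, b j * A.u j = 0) (i : σ) :
    b i ∈ Ideal.span (A.u '' {i}ᶜ) := by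
  classical
  refine A.regular _ i (by simp) _ ?_
  rw [← Finset.add_sum_erase _ _ (Finset.mem_univ i)] at hb
  rw [eq_neg_of_add_eq_zero_left hb]
  refine neg_mem (sum_mem fun j hj => Ideal.mul_mem_left _ _ (Ideal.subset_span ⟨j, ?_, rfl⟩))
  simpa using Finset.ne_of_mem_erase hj

theorem mem_of_C_mul_mem {I : Ideal (MvPolynomial σ ℚ)} {c : ℚ} (hc : c ≠ 0)
    {f : MvPolynomial σ ℚ} (h : C c * f ∈ I) : f ∈ I := by
  have := I.mul_mem_left (C c⁻¹) h
  rwa [← mul_assoc, ← C_mul, inv_mul_cancel₀ hc, C_1, one_mul] at this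

/-- A derivation `h ∂_z` of negative degree vanishes if a relation is quadratic in `z`. -/
theorem IsNegDer.mem_of_quadratic {g : σ → MvPolynomial σ ℚ} {e : ℤ} (h : A.IsNegDer g e) {z : σ}
    (hz : ∀ s ≠ z, g s = 0) {v : σ} {c : ℚ} (hc : c ≠ 0)
    (hv : pderiv z (pderiv z (A.u v)) = C c) : g z ∈ A.ideal := by
  have hD := IsNegDer.apply_of_forall_ne hz
  obtain ⟨a, -, hsum⟩ := h.exists_rep v
  -- Both `∂_z (u i) * D (u v)` and `∂_z (u v) * D (u i)` equal `g z * ∂_z (u i) * ∂_z (u v)`. The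
  -- difference of their representations is a syzygy, and `μ i = 0` by weight.
  have key (i : σ) : a i * pderiv z (A.u i) ∈ A.ideal := by
    obtain ⟨μ, hμ, hμsum⟩ := h.exists_rep i
    have h0 : μ i = 0 := eq_zero (hμ i) (by linarith [h.pos])
    have : ∑ j, (pderiv z (A.u i) * a j - pderiv z (A.u v) * μ j) * A.u j = 0 := by
      simp only [sub_mul, Finset.sum_sub_distrib, mul_assoc, ← Finset.mul_sum]
      rw [← hsum, ← hμsum, hD, hD]
      ring
    have := A.span_le_ideal _ (mul_mem_of_sum_mul_eq_zero this i)
    rwa [h0, mul_zero, sub_zero, mul_comm] at this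
  have h1 := congrArg (pderiv z) hsum
  rw [hD, pderiv_mul, h.pderiv_self, zero_mul, zero_add, hv, map_sum] at h1
  refine mem_of_C_mul_mem hc ?_
  rw [mul_comm, h1]
  refine sum_mem fun i _ => ?_
  rw [pderiv_mul]
  exact add_mem (Ideal.mul_mem_left _ _ (A.u_mem i)) (key i)

theorem pderiv_mem_span {S : Set σ} {z : σ} (hS : ∀ i ∈ S, pderiv z (A.u i) = 0)
    {f : MvPolynomial σ ℚ} (hf : f ∈ Ideal.span (A.u '' S)) :
    pderiv z f ∈ Ideal.span (A.u '' S) := by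
  induction hf using Submodule.span_induction with
  | mem x hx =>
    obtain ⟨i, hi, rfl⟩ := hx
    simp [hS i hi]
  | zero => simp
  | add x y _ _ hx hy => simpa using add_mem hx hy
  | smul a x hx ih =>
    simp only [smul_eq_mul, pderiv_mul]
    exact add_mem (Ideal.mul_mem_left _ _ hx) (Ideal.mul_mem_left _ _ ih)

theorem iterate_pderiv_C_mul {z : σ} {a : MvPolynomial σ ℚ} (ha : pderiv z a = 0)
    (f : MvPolynomial σ ℚ) (n : ℕ) : (pderiv z)^[n] (a * f) = a * (pderiv z)^[n] f := by
  induction n with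
  | zero => rfl
  | succ n ih => rw [Function.iterate_succ_apply', ih, Function.iterate_succ_apply', pderiv_mul, ha,
      zero_mul, zero_add]

/-- A derivation `h ∂_z` of negative degree vanishes if a relation is monic in `z` and at most one
further relation, linear in `z` and of no higher degree, involves `z`. -/
theorem IsNegDer.mem_of_monic {g : σ → MvPolynomial σ ℚ} {e : ℤ} (h : A.IsNegDer g e) {z : σ}
    (hz : ∀ s ≠ z, g s = 0) {v i₁ : σ} (hne : i₁ ≠ v) {c : ℚ} (hc : c ≠ 0) {p : ℕ}
    (hv : (pderiv z)^[p + 1] (A.u v) = C c) (hi₁ : pderiv z (pderiv z (A.u i₁)) = 0)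
    (hoth : ∀ i ≠ v, pderiv z (A.u i) ≠ 0 → i = i₁ ∧ A.d i ≤ A.d v) : g z ∈ A.ideal := by
  classical
  have hD := IsNegDer.apply_of_forall_ne hz
  -- The relations in `S` are free of `z`, so `∂_z` preserves the ideal they generate.
  set S : Set σ := {i | i ≠ v ∧ i ≠ i₁} with hSdef
  have hS : ∀ i ∈ S, pderiv z (A.u i) = 0 := fun i hi => by
    by_contra h'
    exact hi.2 (hoth i hi.1 h').1
  have hT : ∀ {f}, f ∈ Ideal.span (A.u '' S) → pderiv z f ∈ Ideal.span (A.u '' S) :=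
    pderiv_mem_span hS
  have split (a : σ → MvPolynomial σ ℚ) (ha : a v = 0) :
      ∑ j, a j * A.u j - a i₁ * A.u i₁ ∈ Ideal.span (A.u '' S) := by
    rw [← Finset.add_sum_erase _ _ (Finset.mem_univ i₁), add_sub_cancel_left]
    refine sum_mem fun j hj => ?_
    by_cases hjv : j = v
    · rw [hjv, ha, zero_mul]; exact zero_mem _
    · exact Ideal.mul_mem_left _ _ (Ideal.subset_span ⟨j, ⟨hjv, Finset.ne_of_mem_erase hj⟩, rfl⟩)
  -- In `D (u i₁)` the coefficients of `u i₁` and of `u v` have negative weight, the latter because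
  -- `d i₁ ≤ d v`.
  have hf : g z * pderiv z (A.u i₁) ∈ Ideal.span (A.u '' S) := by
    by_cases h0 : pderiv z (A.u i₁) = 0
    · rw [h0, mul_zero]; exact zero_mem _
    · obtain ⟨μ, hμ, hμsum⟩ := h.exists_rep i₁
      have h1 : μ i₁ = 0 := eq_zero (hμ i₁) (by linarith [h.pos])
      have h2 : μ v = 0 := eq_zero (hμ v) (by linarith [h.pos, (hoth i₁ hne h0).2])
      have := split μ h2
      rwa [h1, zero_mul, sub_zero, ← hμsum, hD] at this
  obtain ⟨a, ha, hsum⟩ := h.exists_rep v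
  have hav : a v = 0 := eq_zero (ha v) (by linarith [h.pos])
  have ht := split a hav
  rw [← hsum] at ht
  set W := a i₁
  -- Modulo `S`, `g z * ∂_z (u v) ≡ W * u i₁`. Multiplied by `∂_z (u i₁)`, the left side lies in the
  -- ideal of `S` by `hf`, and regularity cancels `u i₁`.
  have hfw : pderiv z (A.u i₁) * W ∈ Ideal.span (A.u '' S) := by
    refine A.regular S i₁ (by simp [hSdef]) _ ?_
    have h1 := Ideal.mul_mem_left _ (pderiv z (A.u i₁)) ht
    have h2 := Ideal.mul_mem_left _ (pderiv z (A.u v)) hf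
    rw [hD] at h1
    have := sub_mem h2 h1
    convert this using 1
    ring
  have hfwn (n : ℕ) : pderiv z (A.u i₁) * (pderiv z)^[n] W ∈ Ideal.span (A.u '' S) := by
    induction n with
    | zero => exact hfw
    | succ n ih =>
      have := hT ih
      rwa [pderiv_mul, hi₁, zero_mul, zero_add, ← Function.iterate_succ_apply' (pderiv z)] at this
  -- The product-rule terms containing `∂_z (u i₁)` vanish modulo `S` by `hfwn`. After `p`
  -- derivatives the left side is `c * g z`, as `g z` is free of `z`.
  have hn (n : ℕ) : (pderiv z)^[n] (vectorField g (A.u v)) - (pderiv z)^[n] W * A.u i₁ ∈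
      Ideal.span (A.u '' S) := by
    induction n with
    | zero => exact ht
    | succ n ih =>
      have h1 := add_mem (hT ih) (hfwn n)
      rw [map_sub, pderiv_mul] at h1
      rw [Function.iterate_succ_apply', Function.iterate_succ_apply']
      convert h1 using 1
      ring
  have h1 := A.span_le_ideal _ (hn p)
  rw [hD, iterate_pderiv_C_mul (h.pderiv_self z), ← Function.iterate_succ_apply, hv] at h1
  have h2 := add_mem h1 (Ideal.mul_mem_left _ ((pderiv z)^[p] W) (A.u_mem i₁))
  rw [sub_add_cancel, mul_comm] at h2
  exact mem_of_C_mul_mem hc h2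

/-- Some relation is monic in a given variable. -/
theorem exists_monic (A : PureCI σ) (z : σ) : ∃ (v : σ) (p : ℕ) (c : ℚ),
    A.d v = (p + 2) * A.w z ∧ c ≠ 0 ∧ (pderiv z)^[p + 2] (A.u v) = C c := by
  classical
  obtain ⟨v, hv⟩ := A.exists_ne (Pi.single z 1) (by simp)
  have step (n : ℕ) : ∀ f : MvPolynomial σ ℚ, IsWeightedHomogeneous A.w f (n * A.w z) →
      aeval (Pi.single z (1 : ℂ)) f ≠ 0 → ∃ c : ℚ, c ≠ 0 ∧ (pderiv z)^[n] f = C c := by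
    induction n with
    | zero =>
      intro f hf h
      rw [Nat.cast_zero, zero_mul] at hf
      refine ⟨constantCoeff f, fun h0 => h ?_, hf.eq_C A.w_pos⟩
      rw [hf.eq_C A.w_pos, h0]
      simp
    | succ n ih =>
      intro f hf h
      have h1 := hf.aeval_euler (Pi.single z (1 : ℂ))
      rw [Finset.sum_eq_single z (fun s _ hs => by simp [hs]) (by simp)] at h1
      refine ih (pderiv z f) ?_ fun h0 => ?_
      · have := hf.pderiv_sub z
        convert this using 1
        push_cast
        ring
      · rw [h0, mul_zero, mul_zero] at h1
        have := A.w_pos z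
        rcases mul_eq_zero.1 h1.symm with h2 | h2
        · norm_cast at h2
          rcases mul_eq_zero.1 h2 with h3 | h3 <;> omega
        · exact h h2
  obtain ⟨m, hm, hsum⟩ := (A.hom v).exists_monomial_of_aeval_ne_zero hv
  have hm' : ∀ s ≠ z, m s = 0 := fun s hs => by
    by_contra h
    exact hm s h (by simp [hs])
  rw [Finset.sum_eq_single z (fun s _ hs => by simp [hm' s hs]) (by simp)] at hsum
  have hw := A.w_pos z
  obtain ⟨c, hc, hcv⟩ := step (m z) (A.u v) (by rw [hsum]; exact A.hom v) hv
  -- A relation that is non-zero on the `z`-axis contains a pure power of `z`; exponent 1 is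
  -- excluded by the absence of linear terms.
  have h2 : 2 ≤ m z := by
    by_contra hlt
    have : m z = 0 ∨ m z = 1 := by omega
    rcases this with h | h
    · rw [h] at hsum
      have := A.two_le_d v
      omega
    · rw [h, Nat.cast_one, one_mul] at hsum
      rw [h, Function.iterate_one, pderiv_u_eq_zero hsum.ge] at hcv
      exact hc (C_injective σ ℚ (by rw [← hcv, map_zero]))
  obtain ⟨p, hp⟩ := Nat.exists_eq_add_of_le' h2
  refine ⟨v, p, c, ?_, hc, by rwa [← hp]⟩
  rw [← hsum, hp]
  push_cast
  ring

end PureCI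

/-! ### A variable of weight 4; counting relations by weight; restriction to weighted planes. -/

namespace PureCI

variable {σ : Type*} [Fintype σ] {A : PureCI σ}

theorem forall_mem_of_weight_four [Nontrivial σ] {z : σ} (hz : A.w z = 4)
    (hw : ∀ s ≠ z, A.w s = 1) {g : σ → MvPolynomial σ ℚ} {e : ℤ} (h : A.IsNegDer g e) (s : σ) :
    g s ∈ A.ideal := by
  classical
  have hg : ∀ s ≠ z, g s = 0 := fun s hs => h.coeff_eq_zero (by rw [hw s hs]; linarith [h.pos])
  by_cases hs : s = z
  swap
  · rw [hg s hs]; exact zero_mem _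
  rw [hs]
  obtain ⟨v, p, c, hd, hc, hv⟩ := A.exists_monic z
  rw [hz] at hd
  rcases p with _ | p
  · exact h.mem_of_quadratic hg hc hv
  obtain ⟨i₁, hi₁⟩ := _root_.exists_ne v
  -- Here `d v ≥ 12`, a second relation involving `z` has weight at least 5 and the others at least
  -- 2. For `N` relations the sum is at least `2 * N + 13`, against the bound `N + 13`.
  have hfree (i : σ) (hi : i ≠ v) : pderiv z (A.u i) = 0 := by
    by_contra h0
    have h5 : 4 < A.d i := by
      by_contra hle
      exact h0 (pderiv_u_eq_zero (by omega))
    have hsum := A.sum_le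
    rw [← Finset.add_sum_erase _ A.w (Finset.mem_univ z),
      ← Finset.add_sum_erase _ A.d (Finset.mem_univ v),
      ← Finset.add_sum_erase _ A.d (Finset.mem_erase.2 ⟨hi, Finset.mem_univ i⟩)] at hsum
    have h1 : ∑ s ∈ Finset.univ.erase z, A.w s = (Fintype.card σ : ℤ) - 1 := by
      rw [Finset.sum_congr rfl fun s hs => hw s (Finset.ne_of_mem_erase hs)]
      simp [Finset.card_erase_of_mem, Fintype.card_pos_iff.2 ⟨z⟩]
    have h2 : ((Fintype.card σ : ℤ) - 2) * 2 ≤ ∑ s ∈ (Finset.univ.erase v).erase i, A.d s := by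
      have := Finset.card_nsmul_le_sum ((Finset.univ.erase v).erase i) A.d 2
        fun s _ => two_le_d s
      have hcard : (((Finset.univ.erase v).erase i).card : ℤ) = Fintype.card σ - 2 := by
        rw [Finset.card_erase_of_mem (Finset.mem_erase.2 ⟨hi, Finset.mem_univ i⟩),
          Finset.card_erase_of_mem (Finset.mem_univ v), Finset.card_univ]
        have := Fintype.one_lt_card (α := σ)
        omega
      rw [nsmul_eq_mul, hcard] at this
      exact this
    have h3 := Fintype.one_lt_card (α := σ)
    push_cast at hd
    rw [hz, h1] at hsum
    have : (0 : ℤ) ≤ p := Nat.cast_nonneg p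
    linarith
  exact h.mem_of_monic hg hi₁ hc hv (by rw [hfree i₁ hi₁, map_zero])
    fun i hi hne => absurd (hfree i hi) hne

/-- The number of relations of weight `j`. -/
noncomputable def num (A : PureCI σ) (j : ℤ) : ℕ := by
  classical exact (Finset.univ.filter fun i => A.d i = j).card

theorem ne_of_num_eq_zero {j : ℤ} (h : A.num j = 0) (i : σ) : A.d i ≠ j := by
  classical
  intro hi
  have : i ∈ Finset.univ.filter fun i => A.d i = j := by simpa using hi
  rw [num, Finset.card_eq_zero] at h
  simp [h] at this

theorem num_pos {i : σ} : 0 < A.num (A.d i) := by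
  by_contra h
  exact ne_of_num_eq_zero (by omega : A.num (A.d i) = 0) i rfl

theorem num_pos_of_eq {i : σ} {j : ℤ} (h : A.d i = j) : 0 < A.num j := h ▸ num_pos

theorem eq_of_num_le_one {j : ℤ} (h : A.num j ≤ 1) {i i' : σ} (hi : A.d i = j) (hi' : A.d i' = j) :
    i = i' := by
  classical
  rw [num, Finset.card_le_one] at h
  exact h i (by simpa using hi) i' (by simpa using hi')

theorem two_le_num {j : ℤ} {i i' : σ} (hi : A.d i = j) (hi' : A.d i' = j) (h : i ≠ i') :
    2 ≤ A.num j := by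
  by_contra hlt
  exact h (eq_of_num_le_one (by omega) hi hi')

/-- The variables have weights `1` and `2` with at least one of weight `2`, except for a single
variable of weight `3`. -/
structure IsType (A : PureCI σ) (z : σ) : Prop where
  w_eq : ∀ s, A.w s = 3 ↔ s = z
  w_or : ∀ s, A.w s = 1 ∨ A.w s = 2 ∨ A.w s = 3
  exists_two : ∃ y, A.w y = 2

/-- The number of variables of weight `j`. -/
noncomputable def numVar (A : PureCI σ) (j : ℤ) : ℕ := by
  classical exact (Finset.univ.filter fun i => A.w i = j).card

theorem eq_of_numVar_le_one {j : ℤ} (h : A.numVar j ≤ 1) {i i' : σ} (hi : A.w i = j)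
    (hi' : A.w i' = j) : i = i' := by
  classical
  rw [numVar, Finset.card_le_one] at h
  exact h i (by simpa using hi) i' (by simpa using hi')

theorem numVar_pos {j : ℤ} {i : σ} (h : A.w i = j) : 0 < A.numVar j := by
  classical
  exact Finset.card_pos.2 ⟨i, by simpa using h⟩

/-- The number of relations whose weight lies in a given interval. -/
noncomputable def numIco (A : PureCI σ) (j k : ℤ) : ℕ := by
  classical exact (Finset.univ.filter fun i => j ≤ A.d i ∧ A.d i < k).card

theorem numIco_pos {j k : ℤ} {i : σ} (h : j ≤ A.d i) (h' : A.d i < k) : 0 < A.numIco j k := by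
  classical
  exact Finset.card_pos.2 ⟨i, by simp [h, h']⟩

/-- The number of relations of weight at least `12`. -/
noncomputable def numGe (A : PureCI σ) : ℕ := by
  classical exact (Finset.univ.filter fun i => 12 ≤ A.d i).card

theorem numGe_pos {i : σ} (h : 12 ≤ A.d i) : 0 < A.numGe := by
  classical
  exact Finset.card_pos.2 ⟨i, by simpa using h⟩

theorem indicator_sum {d : ℤ} (hd : 2 ≤ d) :
    (if d = 2 then 1 else 0) + (if d = 3 then 1 else 0) + (if d = 4 then 1 else 0) +
      (if d = 5 then 1 else 0) + (if d = 6 then 1 else 0) + (if d = 7 then 1 else 0) +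
      (if d = 8 then 1 else 0) + (if d = 9 then 1 else 0) + (if 10 ≤ d ∧ d < 12 then 1 else 0) +
      (if 12 ≤ d then 1 else 0) = 1 ∧
    2 * (if d = 2 then 1 else 0) + 3 * (if d = 3 then 1 else 0) + 4 * (if d = 4 then 1 else 0) +
      5 * (if d = 5 then 1 else 0) + 6 * (if d = 6 then 1 else 0) + 7 * (if d = 7 then 1 else 0) +
      8 * (if d = 8 then 1 else 0) + 9 * (if d = 9 then 1 else 0) +
      10 * (if 10 ≤ d ∧ d < 12 then 1 else 0) + 12 * (if 12 ≤ d then 1 else 0) ≤ d := by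
  rcases (by omega : d = 2 ∨ d = 3 ∨ d = 4 ∨ d = 5 ∨ d = 6 ∨ d = 7 ∨ d = 8 ∨ d = 9 ∨
    (10 ≤ d ∧ d < 12) ∨ 12 ≤ d) with h | h | h | h | h | h | h | h | h | h
  all_goals first
    | (subst h; norm_num)
    | skip
  · rw [if_pos h]
    split_ifs <;> omega
  · rw [if_pos h]
    split_ifs <;> omega

/-- By `d i ≥ 2 * w i`, relations of weight at most 3 are indexed by variables of weight 1, and
those of weight at most 5 by variables of weight at most 2. The last inequality is `∑ d ≤ ∑ w + 10`,
with weights from 10 on rounded down to 10 or 12. All later exclusions by weight are linear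
arithmetic in these four facts. -/
theorem IsType.count {z : σ} (h : A.IsType z) :
    A.num 2 + A.num 3 ≤ A.numVar 1 ∧
    A.num 2 + A.num 3 + A.num 4 + A.num 5 ≤ A.numVar 1 + A.numVar 2 ∧
    A.num 2 + A.num 3 + A.num 4 + A.num 5 + A.num 6 + A.num 7 + A.num 8 + A.num 9 +
      A.numIco 10 12 + A.numGe = A.numVar 1 + A.numVar 2 + 1 ∧
    2 * A.num 2 + 3 * A.num 3 + 4 * A.num 4 + 5 * A.num 5 + 6 * A.num 6 + 7 * A.num 7 +
      8 * A.num 8 + 9 * A.num 9 + 10 * A.numIco 10 12 + 12 * A.numGe ≤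
        A.numVar 1 + 2 * A.numVar 2 + 13 := by
  classical
  have hz : (Finset.univ.filter fun i => A.w i = 3).card = 1 := by
    rw [Finset.card_eq_one]
    exact ⟨z, by ext; simp [h.w_eq]⟩
  simp only [num, numVar, numIco, numGe, Finset.card_filter] at hz ⊢
  have hw : ∑ s, A.w s = (∑ s, if A.w s = 1 then 1 else 0 : ℕ) +
      2 * (∑ s, if A.w s = 2 then 1 else 0 : ℕ) + 3 * (∑ s, if A.w s = 3 then 1 else 0 : ℕ) := by
    push_cast
    simp only [Finset.mul_sum, ← Finset.sum_add_distrib]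
    refine Finset.sum_congr rfl fun s _ => ?_
    rcases h.w_or s with h | h | h <;> simp [h]
  have hcard : ∑ _s : σ, 1 = (∑ s, if A.w s = 1 then 1 else 0) +
      (∑ s, if A.w s = 2 then 1 else 0) + (∑ s, if A.w s = 3 then 1 else 0) := by
    simp only [← Finset.sum_add_distrib]
    refine Finset.sum_congr rfl fun s _ => ?_
    rcases h.w_or s with h | h | h <;> simp [h]
  have hb (i : σ) := A.two_mul_le i
  have hp (i : σ) := A.w_pos i
  refine ⟨?_, ?_, ?_, ?_⟩
  · simp only [← Finset.sum_add_distrib]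
    refine Finset.sum_le_sum fun s _ => ?_
    have := hb s
    rcases h.w_or s with h | h | h <;> split_ifs <;> omega
  · simp only [← Finset.sum_add_distrib]
    refine Finset.sum_le_sum fun s _ => ?_
    have := hb s
    rcases h.w_or s with h | h | h <;> split_ifs <;> omega
  · rw [hz] at hcard
    rw [← hcard]
    simp only [← Finset.sum_add_distrib]
    exact Finset.sum_congr rfl fun s _ => (indicator_sum (two_le_d s)).1
  · have hsum := A.sum_le
    rw [hw, hz] at hsum
    have : ((2 * (∑ i, if A.d i = 2 then 1 else 0) + 3 * (∑ i, if A.d i = 3 then 1 else 0) +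
        4 * (∑ i, if A.d i = 4 then 1 else 0) + 5 * (∑ i, if A.d i = 5 then 1 else 0) +
        6 * (∑ i, if A.d i = 6 then 1 else 0) + 7 * (∑ i, if A.d i = 7 then 1 else 0) +
        8 * (∑ i, if A.d i = 8 then 1 else 0) + 9 * (∑ i, if A.d i = 9 then 1 else 0) +
        10 * (∑ i, if 10 ≤ A.d i ∧ A.d i < 12 then 1 else 0) +
        12 * (∑ i, if 12 ≤ A.d i then 1 else 0) : ℕ) : ℤ) ≤ ∑ i, A.d i := by
      push_cast
      simp only [Finset.mul_sum, ← Finset.sum_add_distrib]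
      exact Finset.sum_le_sum fun s _ => (indicator_sum (two_le_d s)).2
    omega

/-- The point with coordinate `t` at `z` and coordinates `e` elsewhere. -/
noncomputable def plane (z : σ) (e : σ → ℂ) (t : ℂ) (s : σ) : ℂ := by
  classical exact e s + (if s = z then 1 else 0) * t

variable {z : σ} {e : σ → ℂ} {f : MvPolynomial σ ℚ} {n : ℤ}

/-- Only coordinates of weights 2 and 3 survive on the plane. A form of weight 1 therefore vanishes
there, forms of weights 2 and 4 do not see `z`, and in weight 5 only products of `z` with a variable
of weight 2 remain. The following lemmas obtain this from Euler's formula. -/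
theorem IsType.euler_plane (h : A.IsType z) (he : ∀ s, e s ≠ 0 → A.w s = 2)
    (hf : IsWeightedHomogeneous A.w f n) (t : ℂ) :
    2 * ∑ s, e s * aeval (plane z e t) (pderiv s f) + 3 * (t * aeval (plane z e t) (pderiv z f)) =
      n * aeval (plane z e t) f := by
  classical
  have h1 := hf.aeval_euler (plane z e t)
  rw [← h1, Finset.mul_sum]
  have h2 : (3 * (t * aeval (plane z e t) (pderiv z f)) : ℂ) =
      ∑ s, if s = z then 3 * (t * aeval (plane z e t) (pderiv s f)) else 0 := by simp
  rw [h2, ← Finset.sum_add_distrib]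
  refine Finset.sum_congr rfl fun s _ => ?_
  by_cases hs : s = z
  · have hw := (h.w_eq s).2 hs
    have h0 : e s = 0 := by
      by_contra h0
      have := he s h0
      omega
    rw [if_pos hs, h0, hw, plane, if_pos hs, h0]
    push_cast
    ring
  · rw [if_neg hs, plane, if_neg hs]
    by_cases h0 : e s = 0
    · simp [h0]
    · rw [he s h0]
      push_cast
      ring

theorem aeval_eq_constantCoeff (hf : IsWeightedHomogeneous A.w f 0) (P : σ → ℂ) :
    aeval P f = ((constantCoeff f : ℚ) : ℂ) := by
  conv_lhs => rw [hf.eq_C A.w_pos]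
  simp

theorem sum_mul_eq_zero_of_two (he : ∀ s, e s ≠ 0 → A.w s = 2) {φ : σ → ℂ}
    (hφ : ∀ s, A.w s = 2 → φ s = 0) : ∑ s, e s * φ s = 0 := by
  refine Finset.sum_eq_zero fun s _ => ?_
  by_cases h0 : e s = 0
  · rw [h0, zero_mul]
  · rw [hφ s (he s h0), mul_zero]

namespace IsType

variable (h : A.IsType z) (he : ∀ s, e s ≠ 0 → A.w s = 2)
include h he

theorem aeval_plane_one (hf : IsWeightedHomogeneous A.w f 1) (t : ℂ) :
    aeval (plane z e t) f = 0 := by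
  have h1 := h.euler_plane he hf t
  have hz := (h.w_eq z).2 rfl
  rw [sum_mul_eq_zero_of_two he fun s hs => by
    rw [pderiv_eq_zero hf (by omega), map_zero], pderiv_eq_zero hf (by omega)] at h1
  simpa using h1.symm

theorem aeval_plane_two (hf : IsWeightedHomogeneous A.w f 2) (t : ℂ) :
    aeval (plane z e t) f = ∑ s, e s * ((constantCoeff (pderiv s f) : ℚ) : ℂ) := by
  have h1 := h.euler_plane he hf t
  have hz := (h.w_eq z).2 rfl
  rw [pderiv_eq_zero hf (s := z) (by omega), map_zero] at h1
  have h2 : ∑ s, e s * aeval (plane z e t) (pderiv s f) =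
      ∑ s, e s * ((constantCoeff (pderiv s f) : ℚ) : ℂ) := by
    refine Finset.sum_congr rfl fun s _ => ?_
    by_cases h0 : e s = 0
    · simp [h0]
    · have := hf.pderiv_sub s
      rw [he s h0, sub_self] at this
      rw [aeval_eq_constantCoeff this]
  rw [h2] at h1
  push_cast at h1
  linear_combination -h1 / 2

theorem aeval_plane_u_of_le {i : σ} (hi : A.d i ≤ 3) (t : ℂ) : aeval (plane z e t) (A.u i) = 0 := by
  have hz := (h.w_eq z).2 rfl
  have h2 := two_le_d (A := A) i
  have h1 := h.euler_plane he (A.hom i) t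
  rw [pderiv_u_eq_zero (i := i) (s := z) (by omega), map_zero, mul_zero, mul_zero, add_zero,
    sum_mul_eq_zero_of_two he fun s hs => ?_, mul_zero] at h1
  · rcases mul_eq_zero.1 h1.symm with h3 | h3
    · norm_cast at h3
      omega
    · exact h3
  · rcases (by omega : A.d i = 2 ∨ A.d i = 3) with hi | hi
    · rw [pderiv_u_eq_zero (by omega), map_zero]
    · have := (A.hom i).pderiv_sub s
      rw [hi, hs] at this
      exact h.aeval_plane_one he this t

theorem aeval_plane_four (hf : IsWeightedHomogeneous A.w f 4) (t : ℂ) :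
    2 * aeval (plane z e t) f =
      ∑ s, e s * ∑ r, e r * ((constantCoeff (pderiv r (pderiv s f)) : ℚ) : ℂ) := by
  have hz := (h.w_eq z).2 rfl
  have h1 := h.euler_plane he hf t
  have h3 := hf.pderiv_sub z
  rw [hz] at h3
  rw [h.aeval_plane_one he h3] at h1
  have h2 : ∑ s, e s * aeval (plane z e t) (pderiv s f) =
      ∑ s, e s * ∑ r, e r * ((constantCoeff (pderiv r (pderiv s f)) : ℚ) : ℂ) := by
    refine Finset.sum_congr rfl fun s _ => ?_
    by_cases h0 : e s = 0
    · simp [h0]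
    · have := hf.pderiv_sub s
      rw [he s h0] at this
      rw [h.aeval_plane_two he this]
  rw [h2] at h1
  push_cast at h1
  linear_combination -h1 / 2

theorem aeval_plane_five (hf : IsWeightedHomogeneous A.w f 5) (t : ℂ) :
    aeval (plane z e t) f = t * ∑ s, e s * ((constantCoeff (pderiv s (pderiv z f)) : ℚ) : ℂ) := by
  have hz := (h.w_eq z).2 rfl
  have h1 := h.euler_plane he hf t
  have h3 := hf.pderiv_sub z
  rw [hz] at h3
  rw [h.aeval_plane_two he h3] at h1
  have h2 : ∑ s, e s * aeval (plane z e t) (pderiv s f) =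
      t * ∑ s, e s * ((constantCoeff (pderiv s (pderiv z f)) : ℚ) : ℂ) := by
    rw [Finset.mul_sum]
    refine Finset.sum_congr rfl fun s _ => ?_
    by_cases h0 : e s = 0
    · simp [h0]
    · have h4 := hf.pderiv_sub s
      rw [he s h0] at h4
      have h5 := h.euler_plane he h4 t
      have h6 := h4.pderiv_sub z
      rw [hz] at h6
      rw [aeval_eq_constantCoeff h6, pderiv_comm z s, sum_mul_eq_zero_of_two he fun r hr => by
        have := h4.pderiv_sub r
        rw [hr] at this
        exact h.aeval_plane_one he this t] at h5
      push_cast at h5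
      linear_combination -e s * h5 / 3
  rw [h2] at h1
  push_cast at h1
  linear_combination -h1 / 5

/-- On the plane spanned by a vector of weight `2` and the variable `z`, at least two relations are
non-zero. -/
theorem not_forall_aeval_plane (hne : e ≠ 0) (i : σ)
    (hj : ∀ j ≠ i, ∀ r t : ℂ, aeval (plane z (r • e) t) (A.u j) = 0) : False := by
  classical
  have hz := (h.w_eq z).2 rfl
  have hi := two_le_d (A := A) i
  have hplane : plane z ((0 : ℂ) • e) 1 = fun s => if s = z then 1 else 0 := by
    funext s
    simp [plane]
  have hez : e z = 0 := by
    by_contra h0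
    have := he z h0
    omega
  -- If only `u i` could be non-zero on the plane, its zero on this curve would be a non-trivial
  -- common zero of all relations.
  rcases (A.hom i).exists_zero (p := 2) (q := 3) two_pos (by omega) e
    (fun s => if s = z then 1 else 0) he
    (fun s hs => by
      have : s = z := by by_contra h0; simp [h0] at hs
      rw [this, hz]; rfl) with ⟨t, ht⟩ | ht
  · obtain ⟨j, hj'⟩ := A.exists_ne (plane z e t) (fun h0 => hne (by
      have h1 : t = 0 := by
        have := congrFun h0 z
        simpa [plane, hez] using this
      funext s
      have := congrFun h0 s
      simpa [plane, h1] using this))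
    by_cases hji : j = i
    · rw [hji] at hj'
      exact hj' ht
    · have := hj j hji 1 t
      rw [one_smul] at this
      exact hj' this
  · obtain ⟨j, hj'⟩ := A.exists_ne (plane z ((0 : ℂ) • e) 1) (fun h0 => by
      have := congrFun h0 z
      simp [plane] at this)
    by_cases hji : j = i
    · rw [hji, hplane] at hj'
      exact hj' ht
    · exact hj' (hj j hji 0 1)

end IsType

end PureCI

/-! ### Weights 1, 2, 3: fields along `z`, and derivatives of products of low weight. -/

namespace PureCI

variable {σ : Type*} [Fintype σ] {A : PureCI σ} {z : σ} {g : σ → MvPolynomial σ ℚ}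

theorem IsType.numVar_two_pos (h : A.IsType z) : 0 < A.numVar 2 :=
  numVar_pos h.exists_two.choose_spec

/-- A non-zero form of weight `1` has a non-zero derivative along a variable of weight `1`. -/
theorem IsType.exists_pderiv_ne_zero (h : A.IsType z) {f : MvPolynomial σ ℚ}
    (hf : IsWeightedHomogeneous A.w f 1) (h0 : f ≠ 0) : ∃ x, A.w x = 1 ∧ pderiv x f ≠ 0 := by
  by_contra! hx
  apply h0
  have := hf.sum_weight_mul_pderiv
  rw [Int.cast_one, C_1, one_mul] at this
  rw [← this]
  refine Finset.sum_eq_zero fun s _ => ?_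
  rcases h.w_or s with hs | hs | hs
  · rw [hx s hs, mul_zero, mul_zero]
  · rw [pderiv_eq_zero hf (by omega), mul_zero, mul_zero]
  · rw [pderiv_eq_zero hf (by omega), mul_zero, mul_zero]

/-- A power of `z` beyond the cube needs a relation of weight at least 12, which the count excludes.
-/
theorem IsType.exists_monic_cases (h : A.IsType z) :
    (∃ v c, A.d v = 6 ∧ c ≠ 0 ∧ pderiv z (pderiv z (A.u v)) = C c) ∨
    (∃ v c, A.d v = 9 ∧ c ≠ 0 ∧ pderiv z (pderiv z (pderiv z (A.u v))) = C c) := by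
  obtain ⟨v, p, c, hd, hc, hv⟩ := A.exists_monic z
  rw [(h.w_eq z).2 rfl] at hd
  rcases (by omega : p = 0 ∨ p = 1 ∨ 2 ≤ p) with hp | hp | hp
  · subst hp
    exact Or.inl ⟨v, c, by simpa using hd, hc, hv⟩
  · subst hp
    exact Or.inr ⟨v, c, by simpa using hd, hc, hv⟩
  · have := numGe_pos (A := A) (i := v) (by omega)
    have := h.count
    have := h.numVar_two_pos
    omega

/-- In the cubic case the other relations have weight at most 6. If one is quadratic in `z`,
`mem_of_quadratic` applies to it; otherwise they are at most linear in `z`, and at most one of them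
involves `z`. -/
theorem IsType.mem_of_forall_ne [Nontrivial σ] (h : A.IsType z) {e : ℤ} (hD : A.IsNegDer g e)
    (hg : ∀ s ≠ z, g s = 0) : g z ∈ A.ideal := by
  have hz := (h.w_eq z).2 rfl
  rcases h.exists_monic_cases with ⟨v, c, hd, hc, hv⟩ | ⟨v, c, hd, hc, hv⟩
  · exact hD.mem_of_quadratic hg hc hv
  have h9 := num_pos_of_eq hd
  obtain ⟨c1, c2, c3, c4⟩ := h.count
  have hb := h.numVar_two_pos
  have lower (i : σ) (hi : pderiv z (A.u i) ≠ 0) : 4 ≤ A.d i := by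
    by_contra hlt
    exact hi (pderiv_u_eq_zero (by omega))
  have upper (i : σ) (hiv : i ≠ v) : A.d i ≤ 6 := by
    by_contra hlt
    rcases (by omega : A.d i = 7 ∨ A.d i = 8 ∨ A.d i = 9 ∨ (10 ≤ A.d i ∧ A.d i < 12) ∨
      12 ≤ A.d i) with hi | hi | hi | hi | hi
    · have := num_pos_of_eq hi
      omega
    · have := num_pos_of_eq hi
      omega
    · have := two_le_num hi hd hiv
      omega
    · have := numIco_pos hi.1 hi.2
      omega
    · have := numGe_pos hi
      omega
  by_cases hq : ∃ i, i ≠ v ∧ pderiv z (pderiv z (A.u i)) ≠ 0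
  · obtain ⟨i, hi, hne⟩ := hq
    have h6 := upper i hi
    have h2 := ((A.hom i).pderiv_sub z).pderiv_sub z
    have h6' : A.d i = 6 := by
      by_contra h6'
      exact hne (eq_zero h2 (by omega))
    rw [hz, h6', show (6 : ℤ) - 3 - 3 = 0 by norm_num] at h2
    have h3 := h2.eq_C A.w_pos
    refine hD.mem_of_quadratic hg (fun h0 => hne ?_) h3
    rw [h3, h0, map_zero]
  push Not at hq
  have uniq (i i' : σ) (hi : i ≠ v) (hi' : i' ≠ v) (hne : pderiv z (A.u i) ≠ 0)
      (hne' : pderiv z (A.u i') ≠ 0) : i = i' := by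
    by_contra hii
    have a1 := lower i hne
    have a2 := lower i' hne'
    have a3 := upper i hi
    have a4 := upper i' hi'
    -- The count admits two such relations only in weight 4 and without variables of weight 1; but
    -- then `∂_z (u i)` would be a non-zero form of weight 1.
    have h44 : A.d i = 4 ∧ A.numVar 1 = 0 := by
      rcases (by omega : A.d i = 4 ∨ A.d i = 5 ∨ A.d i = 6) with e1 | e1 | e1 <;>
      rcases (by omega : A.d i' = 4 ∨ A.d i' = 5 ∨ A.d i' = 6) with e2 | e2 | e2 <;>
      have n1 := num_pos_of_eq e1 <;> have n2 := num_pos_of_eq e2 <;>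
      first
        | (have n3 := two_le_num e1 e2 hii; refine ⟨by omega, by omega⟩)
        | (exfalso; omega)
    have h1 := (A.hom i).pderiv_sub z
    rw [h44.1, hz] at h1
    obtain ⟨x, hx, -⟩ := h.exists_pderiv_ne_zero h1 hne
    have := numVar_pos hx
    omega
  by_cases hex : ∃ i, i ≠ v ∧ pderiv z (A.u i) ≠ 0
  · obtain ⟨i₁, hi₁, hne⟩ := hex
    exact hD.mem_of_monic (p := 2) hg hi₁ hc hv (hq i₁ hi₁)
      fun i hi hi' => ⟨uniq i i₁ hi hi₁ hi' hne, by have := upper i hi; omega⟩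
  · push Not at hex
    obtain ⟨i₁, hi₁⟩ := _root_.exists_ne v
    exact hD.mem_of_monic (p := 2) hg hi₁ hc hv (hq i₁ hi₁)
      fun i hi hi' => absurd (hex i hi) hi'

section Terms

variable {a : MvPolynomial σ ℚ} {i r s : σ}

theorem pderiv_pderiv_mul (a b : MvPolynomial σ ℚ) : pderiv r (pderiv s (a * b)) =
    pderiv r (pderiv s a) * b + pderiv s a * pderiv r b + pderiv r a * pderiv s b +
      a * pderiv r (pderiv s b) := by
  simp only [pderiv_mul, map_add]
  ring

theorem term_of_lt {n : ℤ} (ha : IsWeightedHomogeneous A.w a (n - A.d i)) (h : n < A.d i) :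
    a = 0 :=
  eq_zero ha (by omega)

theorem term_five_two_three (ha : IsWeightedHomogeneous A.w a (5 - A.d i)) (hr : A.w r = 2)
    (hs : A.w s = 3) : pderiv r (pderiv s (a * A.u i)) =
      if A.d i = 5 then a * pderiv r (pderiv s (A.u i)) else 0 := by
  have h2 := two_le_d (A := A) i
  rw [pderiv_pderiv_mul, pderiv_pderiv_eq_zero ha (by omega), zero_mul, zero_add]
  rcases (by omega : A.d i = 2 ∨ A.d i = 3 ∨ A.d i = 4 ∨ A.d i = 5 ∨ 5 < A.d i) with
    h | h | h | h | h
  · rw [pderiv_u_eq_zero (s := r) (by omega), pderiv_u_eq_zero (s := s) (by omega)]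
    simp [h]
  · rw [pderiv_eq_zero ha (s := s) (by omega), pderiv_u_eq_zero (s := s) (by omega)]
    simp [h]
  · rw [pderiv_eq_zero ha (s := s) (by omega), pderiv_eq_zero ha (s := r) (by omega),
      pderiv_pderiv_eq_zero (A.hom i) (by omega)]
    simp [h]
  · rw [pderiv_eq_zero ha (s := s) (by omega), pderiv_eq_zero ha (s := r) (by omega)]
    simp [h]
  · rw [term_of_lt ha h]
    simp

theorem term_five_two_two (ha : IsWeightedHomogeneous A.w a (5 - A.d i)) (hr : A.w r = 2)
    (hs : A.w s = 2) : pderiv r (pderiv s (a * A.u i)) =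
      (if A.d i = 3 then pderiv s a * pderiv r (A.u i) + pderiv r a * pderiv s (A.u i) else 0) +
      (if A.d i = 4 then a * pderiv r (pderiv s (A.u i)) else 0) +
      if A.d i = 5 then a * pderiv r (pderiv s (A.u i)) else 0 := by
  have h2 := two_le_d (A := A) i
  rw [pderiv_pderiv_mul, pderiv_pderiv_eq_zero ha (by omega), zero_mul, zero_add]
  rcases (by omega : A.d i = 2 ∨ A.d i = 3 ∨ A.d i = 4 ∨ A.d i = 5 ∨ 5 < A.d i) with
    h | h | h | h | h
  · rw [pderiv_u_eq_zero (s := r) (by omega), pderiv_u_eq_zero (s := s) (by omega)]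
    simp [h]
  · rw [pderiv_pderiv_eq_zero (A.hom i) (by omega)]
    simp [h]
  · rw [pderiv_eq_zero ha (s := s) (by omega), pderiv_eq_zero ha (s := r) (by omega)]
    simp [h]
  · rw [pderiv_eq_zero ha (s := s) (by omega), pderiv_eq_zero ha (s := r) (by omega)]
    simp [h]
  · rw [term_of_lt ha h]
    simp

theorem term_five_three (ha : IsWeightedHomogeneous A.w a (5 - A.d i)) (hs : A.w s = 3) :
    pderiv s (a * A.u i) = (if A.d i = 2 then pderiv s a * A.u i else 0) +
      (if A.d i = 4 then a * pderiv s (A.u i) else 0) +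
      if A.d i = 5 then a * pderiv s (A.u i) else 0 := by
  have h2 := two_le_d (A := A) i
  rw [pderiv_mul]
  rcases (by omega : A.d i = 2 ∨ A.d i = 3 ∨ A.d i = 4 ∨ A.d i = 5 ∨ 5 < A.d i) with
    h | h | h | h | h
  · rw [pderiv_u_eq_zero (s := s) (by omega)]
    simp [h]
  · rw [pderiv_u_eq_zero (s := s) (by omega), pderiv_eq_zero ha (s := s) (by omega)]
    simp [h]
  · rw [pderiv_eq_zero ha (s := s) (by omega)]
    simp [h]
  · rw [pderiv_eq_zero ha (s := s) (by omega)]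
    simp [h]
  · rw [term_of_lt ha h]
    simp

theorem term_four_two_two (ha : IsWeightedHomogeneous A.w a (4 - A.d i)) (hr : A.w r = 2)
    (hs : A.w s = 2) : pderiv r (pderiv s (a * A.u i)) =
      if A.d i = 4 then a * pderiv r (pderiv s (A.u i)) else 0 := by
  have h2 := two_le_d (A := A) i
  rw [pderiv_pderiv_mul, pderiv_pderiv_eq_zero ha (by omega), zero_mul, zero_add]
  rcases (by omega : A.d i = 2 ∨ A.d i = 3 ∨ A.d i = 4 ∨ 4 < A.d i) with h | h | h | h
  · rw [pderiv_u_eq_zero (s := r) (by omega), pderiv_u_eq_zero (s := s) (by omega)]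
    simp [h]
  · rw [pderiv_pderiv_eq_zero (A.hom i) (by omega), pderiv_eq_zero ha (s := s) (by omega),
      pderiv_eq_zero ha (s := r) (by omega)]
    simp [h]
  · rw [pderiv_eq_zero ha (s := s) (by omega), pderiv_eq_zero ha (s := r) (by omega)]
    simp [h]
  · rw [term_of_lt ha h]
    simp

theorem term_four_three (ha : IsWeightedHomogeneous A.w a (4 - A.d i)) (hs : A.w s = 3) :
    pderiv s (a * A.u i) = if A.d i = 4 then a * pderiv s (A.u i) else 0 := by
  have h2 := two_le_d (A := A) i
  rw [pderiv_mul, pderiv_eq_zero ha (s := s) (by omega), zero_mul, zero_add]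
  rcases (by omega : A.d i = 2 ∨ A.d i = 3 ∨ A.d i = 4 ∨ 4 < A.d i) with h | h | h | h
  · rw [pderiv_u_eq_zero (s := s) (by omega)]
    simp
  · rw [pderiv_u_eq_zero (s := s) (by omega)]
    simp
  · simp [h]
  · rw [term_of_lt ha h]
    simp

theorem term_three_two (ha : IsWeightedHomogeneous A.w a (3 - A.d i)) (hs : A.w s = 2) :
    pderiv s (a * A.u i) = if A.d i = 3 then a * pderiv s (A.u i) else 0 := by
  have h2 := two_le_d (A := A) i
  rw [pderiv_mul, pderiv_eq_zero ha (s := s) (by omega), zero_mul, zero_add]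
  rcases (by omega : A.d i = 2 ∨ A.d i = 3 ∨ 3 < A.d i) with h | h | h
  · rw [pderiv_u_eq_zero (s := s) (by omega)]
    simp
  · simp [h]
  · rw [term_of_lt ha h]
    simp

theorem sum_ite_eq_single {φ : σ → MvPolynomial σ ℚ} {n : ℤ} (hn : A.num n ≤ 1) (hi : A.d i = n) :
    (∑ j, if A.d j = n then φ j else 0) = φ i := by
  rw [Finset.sum_eq_single i]
  · rw [if_pos hi]
  · intro j _ hj
    rw [if_neg fun h => hj (eq_of_num_le_one hn h hi)]
  · simp

theorem sum_ite_eq_zero {φ : σ → MvPolynomial σ ℚ} {n : ℤ} (hn : A.num n = 0) :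
    (∑ j, if A.d j = n then φ j else 0) = 0 :=
  Finset.sum_eq_zero fun j _ => if_neg (ne_of_num_eq_zero hn j)

theorem num_pos_of_sum_ite_ne_zero {φ : σ → MvPolynomial σ ℚ} {n : ℤ}
    (h : (∑ j, if A.d j = n then φ j else 0) ≠ 0) : ∃ j, A.d j = n ∧ φ j ≠ 0 := by
  obtain ⟨j, -, hj⟩ := Finset.exists_ne_zero_of_sum_ne_zero h
  by_cases hd : A.d j = n
  · exact ⟨j, hd, by simpa [hd] using hj⟩
  · simp [hd] at hj

end Terms

end PureCI

/-! ### Derivations of weight -1: the linear part of `g z` in the variables of weight 2. -/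

namespace PureCI

variable {σ : Type*} [Fintype σ] {A : PureCI σ} {z : σ} {g : σ → MvPolynomial σ ℚ}

theorem IsType.exists_unique_weight_two (h : A.IsType z) (hb : A.numVar 2 = 1) : ∃ y, ∀ s, A.w s
    = 2 ↔ s = y := by
  obtain ⟨y, hy⟩ := h.exists_two
  exact ⟨y, fun s => ⟨fun hs => eq_of_numVar_le_one hb.le hs hy, fun hs => hs ▸ hy⟩⟩

section DegreeOne

variable (h : A.IsType z) (hD : A.IsNegDer g 1)
include h hD

theorem vectorField_of_le_one {f : MvPolynomial σ ℚ} {n : ℤ} (hf : IsWeightedHomogeneous A.w f n)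
    (hn : n ≤ 1) : vectorField g f = 0 := by
  rw [vectorField_apply]
  refine Finset.sum_eq_zero fun s _ => ?_
  rcases h.w_or s with hs | hs | hs
  · rw [hD.coeff_eq_zero hs.le, zero_mul]
  · rw [pderiv_eq_zero hf (by omega), mul_zero]
  · rw [pderiv_eq_zero hf (by omega), mul_zero]

/-- All coefficients have weight at most 2, so none involves `z`. -/
theorem pderiv_three_vectorField (f : MvPolynomial σ ℚ) :
    pderiv z (vectorField g f) = vectorField g (pderiv z f) := by
  rw [pderiv_vectorField, add_eq_left]
  refine Finset.sum_eq_zero fun s _ => ?_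
  have hz := (h.w_eq z).2 rfl
  rw [pderiv_eq_zero (hD.hom s) (by rcases h.w_or s with hs | hs | hs <;> omega), zero_mul]

/-- Of the coefficients, only `g z` has weight as large as 2, so only it can involve `y`. -/
theorem pderiv_two_vectorField {y : σ} (hy : A.w y = 2) (f : MvPolynomial σ ℚ) :
    pderiv y (vectorField g f) = vectorField g (pderiv y f) + pderiv y (g z) * pderiv z f := by
  rw [pderiv_vectorField, Finset.sum_eq_single z]
  · intro s _ hs
    have : A.w s ≠ 3 := fun h' => hs ((h.w_eq s).1 h')
    rw [pderiv_eq_zero (hD.hom s) (by rcases h.w_or s with hs | hs | hs <;> omega), zero_mul]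
  · simp

theorem pderiv_two_coeff {y : σ} (hy : A.w y = 2) :
    pderiv y (g z) = C (constantCoeff (pderiv y (g z))) := by
  have := (hD.hom z).pderiv_sub y
  rw [hy, (h.w_eq z).2 rfl] at this
  exact this.eq_C A.w_pos

/-- On forms of weight `2`, the derivation is `∑ g_y ∂_y` over the variables of weight `2`. -/
theorem vectorField_two {f : MvPolynomial σ ℚ} (hf : IsWeightedHomogeneous A.w f 2)
    {φ : σ → MvPolynomial σ ℚ} (hφ : ∀ s, A.w s = 2 → φ s = g s * pderiv s f)
    (hφ' : ∀ s, A.w s ≠ 2 → φ s = 0) : vectorField g f = ∑ s, φ s := by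
  rw [vectorField_apply]
  refine Finset.sum_congr rfl fun s _ => ?_
  rcases h.w_or s with hs | hs | hs
  · rw [hD.coeff_eq_zero hs.le, zero_mul, hφ' s (by omega)]
  · rw [hφ s hs]
  · rw [pderiv_eq_zero hf (by omega), mul_zero, hφ' s (by omega)]

theorem vectorField_two_of_unique {y : σ} (hy : ∀ s, A.w s = 2 ↔ s = y) {f : MvPolynomial σ ℚ}
    (hf : IsWeightedHomogeneous A.w f 2) : vectorField g f = g y * pderiv y f := by
  classical
  rw [vectorField_two h hD hf (φ := fun s => if s = y then g s * pderiv s f else 0)]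
  · simp
  · intro s hs
    rw [if_pos ((hy s).1 hs)]
  · intro s hs
    rw [if_neg fun h => hs ((hy s).2 h)]

theorem numVar_one_pos {y : σ} (hgy : g y ≠ 0) (hy : A.w y = 2) : 0 < A.numVar 1 := by
  have := hD.hom y
  rw [hy] at this
  obtain ⟨x, hx, -⟩ := h.exists_pderiv_ne_zero this hgy
  exact numVar_pos hx

/-- The part of a combination of relations supported in weight `5`. -/
theorem exists_weight_five {v : σ} {ζ : ℚ} (hv : A.d v = 6)
    (hζ : pderiv z (pderiv z (A.u v)) = C ζ) :
    ∃ a : σ → MvPolynomial σ ℚ, (∀ j, IsWeightedHomogeneous A.w (a j) (5 - A.d j)) ∧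
      vectorField g (A.u v) = ∑ j, a j * A.u j ∧ ∀ r, A.w r = 2 →
        (∑ j, if A.d j = 5 then a j * pderiv r (pderiv z (A.u j)) else 0) =
          pderiv r (g z) * C ζ := by
  have hz := (h.w_eq z).2 rfl
  obtain ⟨a, ha, hsum⟩ := hD.exists_rep v
  rw [hv, show (6 : ℤ) - 1 = 5 by norm_num] at ha
  refine ⟨a, ha, hsum, fun r hr => ?_⟩
  have h1 := congrArg (fun f => pderiv r (pderiv z f)) hsum
  simp only [map_sum, term_five_two_three (ha _) hr hz] at h1
  rw [← h1, pderiv_three_vectorField h hD, pderiv_two_vectorField h hD hr, hζ]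
  have := ((A.hom v).pderiv_sub z).pderiv_sub r
  rw [vectorField_of_le_one h hD this (by omega), zero_add]

theorem pderiv_coeff_eq_zero_of_quadratic {v : σ} {ζ : ℚ} (hv : A.d v = 6) (hζ0 : ζ ≠ 0)
    (hζ : pderiv z (pderiv z (A.u v)) = C ζ) {y₀ : σ} (hy₀ : A.w y₀ = 2) (hgy : g y₀ ≠ 0) {r : σ}
    (hr : A.w r = 2) : pderiv r (g z) = 0 := by
  classical
  by_contra hm
  have hz := (h.w_eq z).2 rfl
  set m : σ → ℚ := fun s => constantCoeff (pderiv s (g z)) with hmdef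
  have hmC : ∀ s, A.w s = 2 → pderiv s (g z) = C (m s) := fun s hs => pderiv_two_coeff h hD hs
  have hmr : m r ≠ 0 := fun h0 => hm (by rw [hmC r hr, h0, map_zero])
  obtain ⟨a, ha, -, h5⟩ := exists_weight_five h hD hv hζ
  replace h5 : ∀ s, A.w s = 2 → (∑ j, if A.d j = 5 then a j * pderiv s (pderiv z (A.u j)) else 0) =
      C (m s * ζ) := fun s hs => by rw [h5 s hs, hmC s hs, C_mul]
  obtain ⟨i5, hi5, -⟩ := num_pos_of_sum_ite_ne_zero (A := A) (n := 5) (by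
    rw [h5 r hr]
    exact fun h0 => mul_ne_zero hmr hζ0 (C_injective σ ℚ (by rw [h0, map_zero])))
  -- `U` is the weight 5 part of the expression of `D (u v)`. By `h5` its terms mixing `z` with
  -- weight 2 variables are `ζ * z * ∑ m s * X s`.
  set U : MvPolynomial σ ℚ := ∑ j, if A.d j = 5 then a j * A.u j else 0 with hU
  have hUmem : U ∈ A.ideal := sum_mem fun j _ => by
    split_ifs
    · exact Ideal.mul_mem_left _ _ (A.u_mem j)
    · exact zero_mem _
  have hUhom : IsWeightedHomogeneous A.w U 5 := IsWeightedHomogeneous.sum _ _ _ fun j _ => by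
    split_ifs with hj
    · have := (ha j).mul (A.hom j)
      rwa [sub_add_cancel] at this
    · exact isWeightedHomogeneous_zero ..
  have hUz : ∀ s, A.w s = 2 → pderiv s (pderiv z U) = C (m s * ζ) := fun s hs => by
    rw [← h5 s hs, hU, map_sum, map_sum]
    refine Finset.sum_congr rfl fun j _ => ?_
    split_ifs with hj
    · have := ha j
      rw [hj, sub_self] at this
      rw [this.eq_C A.w_pos, pderiv_C_mul, pderiv_C_mul]
    · simp
  obtain ⟨b, hb, hbsum⟩ := A.exists_rep (hD.map_mem hUmem) (hUhom.vectorField hD.hom)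
  rw [show (5 : ℤ) - 1 = 4 by norm_num] at hb
  -- `D U` is again in the ideal, now in weight 4, and its quadratic part is `ζ` times the square of
  -- the linear form with coefficients `m`.
  have h4 : ∀ s t, A.w s = 2 → A.w t = 2 →
      (∑ j, if A.d j = 4 then b j * pderiv s (pderiv t (A.u j)) else 0) =
        C (2 * ζ * m s * m t) := fun s t hs ht => by
    have h1 := congrArg (fun f => pderiv s (pderiv t f)) hbsum
    simp only [map_sum, term_four_two_two (hb _) hs ht] at h1
    rw [← h1, pderiv_two_vectorField h hD ht, map_add, pderiv_two_vectorField h hD hs, hmC t ht,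
      hmC s hs, pderiv_C_mul, hUz s hs,
      vectorField_of_le_one h hD ((hUhom.pderiv_sub t).pderiv_sub s) (by omega), zero_add,
      pderiv_comm z t, hUz t ht]
    simp only [← C_mul, ← C_add]
    congr 1
    ring
  obtain ⟨i4, hi4, -⟩ := num_pos_of_sum_ite_ne_zero (A := A) (n := 4) (by
    rw [h4 r r hr hr]
    exact fun h0 => (by positivity : 2 * ζ * m r * m r ≠ 0)
      (C_injective σ ℚ (by rw [h0, map_zero])))
  obtain ⟨c1, c2, c3, c4⟩ := h.count
  have n1 := numVar_one_pos h hD hgy hy₀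
  have n4 := num_pos_of_eq hi4
  have n5 := num_pos_of_eq hi5
  have n6 := num_pos_of_eq hv
  -- Relations of weights 4, 5 and 6 and a variable of weight 1 all occur; little room is left in
  -- the count.
  have n4' : A.num 4 = 1 := by omega
  have n5' : A.num 5 = 1 := by omega
  have hb2 : A.numVar 2 ≤ 2 := by omega
  have κ5 := ha i5
  rw [hi5, sub_self] at κ5
  have κ4 := hb i4
  rw [hi4, sub_self] at κ4
  simp only [sum_ite_eq_single n5'.le hi5] at h5
  simp only [sum_ite_eq_single n4'.le hi4] at h4
  obtain ⟨k5, hk5⟩ : ∃ k, a i5 = C k := ⟨_, κ5.eq_C A.w_pos⟩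
  obtain ⟨k4, hk4⟩ : ∃ k, b i4 = C k := ⟨_, κ4.eq_C A.w_pos⟩
  rw [hk5] at h5
  rw [hk4] at h4
  have hk5' : k5 ≠ 0 := by
    rintro rfl
    have := h5 r hr
    rw [map_zero, zero_mul] at this
    exact mul_ne_zero hmr hζ0 (C_injective σ ℚ (by rw [← this, map_zero]))
  have hk4' : k4 ≠ 0 := by
    rintro rfl
    have := h4 r r hr hr
    rw [map_zero, zero_mul] at this
    exact (by positivity : 2 * ζ * m r * m r ≠ 0) (C_injective σ ℚ (by rw [← this, map_zero]))
  rcases (by have := h.numVar_two_pos; omega : A.numVar 2 = 1 ∨ A.numVar 2 = 2) with hb1 | hb1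
  · have n3 : A.num 3 = 0 := by omega
    obtain ⟨y, hy⟩ := h.exists_unique_weight_two hb1
    have hyw := (hy y).2 rfl
    obtain rfl := (hy y₀).1 hy₀
    obtain rfl := (hy r).1 hr
    have e1 : g r * pderiv r (pderiv r (A.u i4)) + C (m r) * pderiv z (A.u i4) = 0 := by
      obtain ⟨c, hc, hcsum⟩ := hD.exists_rep i4
      rw [hi4, show (4 : ℤ) - 1 = 3 by norm_num] at hc
      have h1 := congrArg (pderiv r) hcsum
      simp only [map_sum, term_three_two (hc _) hr, sum_ite_eq_zero n3] at h1
      have h2 := (A.hom i4).pderiv_sub r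
      rw [hi4, hr] at h2
      rwa [pderiv_two_vectorField h hD hr, hmC r hr, vectorField_two_of_unique h hD hy h2] at h1
    have e2 : g r * C (m r * ζ) = C k4 * pderiv z (A.u i4) := by
      have h1 := congrArg (pderiv z) hbsum
      simp only [map_sum, term_four_three (hb _) hz, sum_ite_eq_single n4'.le hi4, hk4] at h1
      have h2 := hUhom.pderiv_sub z
      rw [hz] at h2
      rwa [pderiv_three_vectorField h hD, vectorField_two_of_unique h hD hy h2, hUz r hr] at h1
    have e3 := h4 r r hr hr
    -- Eliminate `∂_z (u i4)` between `e1` and `e2`, using `e3`.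
    have e4 : g r * C (3 * ζ * m r * m r) = 0 := by
      have : g r * C (3 * ζ * m r * m r) =
          g r * C (2 * ζ * m r * m r) + C (m r) * (g r * C (m r * ζ)) := by
        simp only [C_mul, map_ofNat]
        ring
      rw [this, e2, ← e3]
      linear_combination C k4 * e1
    rcases mul_eq_zero.1 e4 with h0 | h0
    · exact hgy h0
    · exact (by positivity : 3 * ζ * m r * m r ≠ 0) (C_injective σ ℚ (by rw [h0, map_zero]))
  · obtain ⟨y₁, y₂, hne, hy⟩ : ∃ y₁ y₂ : σ, y₁ ≠ y₂ ∧ ∀ s, A.w s = 2 ↔ s = y₁ ∨ s = y₂ := by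
      rw [numVar, Finset.card_eq_two] at hb1
      obtain ⟨y₁, y₂, hne, hy⟩ := hb1
      refine ⟨y₁, y₂, hne, fun s => ?_⟩
      have := congrArg (s ∈ ·) hy
      simpa using this
    have hy₁ := (hy y₁).2 (Or.inl rfl)
    have hy₂ := (hy y₂).2 (Or.inr rfl)
    -- A vector annihilated by `m`. The form `m ^ 2` in weight 4 and `z * m` in weight 5 vanish on
    -- the plane it spans with `z`, so only `u v` can be non-zero there.
    let e : σ → ℂ := fun s => if s = y₁ then (m y₂ : ℂ) else if s = y₂ then -(m y₁ : ℂ) else 0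
    have he : ∀ s, e s ≠ 0 → A.w s = 2 := fun s hs => by
      rw [hy]
      by_contra! h0
      simp [e, h0.1, h0.2] at hs
    have hsum0 : ∑ s, e s * (m s : ℂ) = 0 := by
      rw [Finset.sum_eq_add_of_mem y₁ y₂ (Finset.mem_univ _) (Finset.mem_univ _) hne]
      · simp only [e, if_true, if_neg hne.symm]
        ring
      · rintro s - ⟨h1, h2⟩
        simp [e, h1, h2]
    have he0 : e ≠ 0 := fun h0 => by
      have h1 := congrFun h0 y₁
      have h2 := congrFun h0 y₂
      simp only [e, if_true, if_neg hne.symm, Pi.zero_apply, neg_eq_zero, Rat.cast_eq_zero] at h1 h2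
      rcases (hy r).1 hr with rfl | rfl
      · exact hmr h2
      · exact hmr h1
    have hCc : ∀ (k q : ℚ) (f : MvPolynomial σ ℚ), C k * f = C q →
        (k : ℂ) * ((constantCoeff f : ℚ) : ℂ) = q := fun k q f hf => by
      have := congrArg constantCoeff hf
      rw [map_mul, constantCoeff_C, constantCoeff_C] at this
      exact_mod_cast this
    refine h.not_forall_aeval_plane he he0 v fun j hj c t => ?_
    have hce : ∀ s, (c • e) s ≠ 0 → A.w s = 2 := fun s hs => he s fun h0 => hs (by simp [h0])
    have hsumc : ∑ s, (c • e) s * (m s : ℂ) = 0 := by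
      simp only [Pi.smul_apply, smul_eq_mul, mul_assoc, ← Finset.mul_sum, hsum0, mul_zero]
    have hj2 := two_le_d (A := A) j
    have hk5c : (k5 : ℂ) ≠ 0 := by exact_mod_cast hk5'
    have hk4c : (k4 : ℂ) ≠ 0 := by exact_mod_cast hk4'
    have congr0 : ∀ (φ ψ : σ → ℂ), (∀ s, A.w s = 2 → φ s = ψ s) →
        ∑ s, (c • e) s * φ s = ∑ s, (c • e) s * ψ s := fun φ ψ hφ =>
      Finset.sum_congr rfl fun s _ => by
        by_cases h0 : (c • e) s = 0
        · rw [h0, zero_mul, zero_mul]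
        · rw [hφ s (hce s h0)]
    rcases (by omega : A.d j ≤ 3 ∨ A.d j = 4 ∨ A.d j = 5 ∨ 6 ≤ A.d j) with h' | h' | h' | h'
    · exact h.aeval_plane_u_of_le hce h' t
    · obtain rfl := eq_of_num_le_one n4'.le h' hi4
      have h1 := A.hom j
      rw [h'] at h1
      have h2 := h.aeval_plane_four hce h1 t
      rw [congr0 _ (fun s => (m s : ℂ) * 0) fun s hs => ?_] at h2
      · simpa using h2
      · rw [congr0 _ (fun t => (2 * ζ * m s / k4 : ℂ) * m t) fun t ht => ?_]
        · simp only [mul_left_comm _ (2 * ζ * m s / k4 : ℂ), ← Finset.mul_sum, hsumc]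
          ring
        · have := hCc _ _ _ (h4 t s ht hs)
          push_cast at this
          field_simp
          linear_combination this
    · obtain rfl := eq_of_num_le_one n5'.le h' hi5
      have h1 := A.hom j
      rw [h'] at h1
      rw [h.aeval_plane_five hce h1 t, congr0 _ (fun s => (ζ / k5 : ℂ) * m s) fun s hs => ?_]
      · simp only [mul_left_comm _ (ζ / k5 : ℂ), ← Finset.mul_sum, hsumc]
        ring
      · have := hCc _ _ _ (h5 s hs)
        push_cast at this
        field_simp
        linear_combination this
    · exfalso
      rcases (by omega : A.d j = 6 ∨ A.d j = 7 ∨ A.d j = 8 ∨ A.d j = 9 ∨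
        (10 ≤ A.d j ∧ A.d j < 12) ∨ 12 ≤ A.d j) with hi | hi | hi | hi | hi | hi
      · have := two_le_num hi hv hj
        omega
      · have := num_pos_of_eq hi
        omega
      · have := num_pos_of_eq hi
        omega
      · have := num_pos_of_eq hi
        omega
      · have := numIco_pos hi.1 hi.2
        omega
      · have := numGe_pos hi
        omega

/-- `∂_r ∂_z ∂_z` maps `D (u v)` to `ζ * ∂_r (g z)`, and annihilates the right-hand side once all
relations other than `u v` have weight at most 4. -/
theorem pderiv_coeff_eq_zero_of_cubic {v : σ} {ζ : ℚ} (hv : A.d v = 9) (hζ0 : ζ ≠ 0)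
    (hζ : pderiv z (pderiv z (pderiv z (A.u v))) = C ζ) {y₀ : σ} (hy₀ : A.w y₀ = 2)
    (hgy : g y₀ ≠ 0) {r : σ} (hr : A.w r = 2) : pderiv r (g z) = 0 := by
  classical
  have hz := (h.w_eq z).2 rfl
  obtain ⟨c1, c2, c3, c4⟩ := h.count
  have n1 := numVar_one_pos h hD hgy hy₀
  have n9 := num_pos_of_eq hv
  have hlist : ∀ j, A.d j ≤ 5 ∨ j = v := fun j => by
    by_contra! hj
    rcases (by omega : A.d j = 6 ∨ A.d j = 7 ∨ A.d j = 8 ∨ A.d j = 9 ∨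
      (10 ≤ A.d j ∧ A.d j < 12) ∨ 12 ≤ A.d j) with hi | hi | hi | hi | hi | hi
    · have := num_pos_of_eq hi
      omega
    · have := num_pos_of_eq hi
      omega
    · have := num_pos_of_eq hi
      omega
    · have := two_le_num hi hv hj.2
      omega
    · have := numIco_pos hi.1 hi.2
      omega
    · have := numGe_pos hi
      omega
  -- On the `r`-axis, relations of weight 2, 3, 5 and the one of odd weight 9 vanish. Hence one of
  -- weight 4 exists, and the count then excludes weight 5.
  have n5 : A.num 5 = 0 := by
    let e : σ → ℂ := Pi.single r 1
    have he : ∀ s, e s ≠ 0 → A.w s = 2 := fun s hs => by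
      by_cases hsr : s = r
      · rw [hsr, hr]
      · simp [e, hsr] at hs
    obtain ⟨j, hj⟩ := A.exists_ne (plane z e 0) fun h0 => by
      have := congrFun h0 r
      simp [plane, e] at this
    have h2 := two_le_d (A := A) j
    rcases hlist j with hj5 | rfl
    · rcases (by omega : A.d j ≤ 3 ∨ A.d j = 4 ∨ A.d j = 5) with h' | h' | h'
      · exact absurd (h.aeval_plane_u_of_le he h' 0) hj
      · have := num_pos_of_eq h'
        omega
      · have h1 := A.hom j
        rw [h'] at h1
        exact absurd (by rw [h.aeval_plane_five he h1 0, zero_mul]) hj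
    · exfalso
      obtain ⟨m, hm, hsum⟩ := (A.hom j).exists_monomial_of_aeval_ne_zero hj
      rw [Finset.sum_eq_single r, hr, hv] at hsum
      · omega
      · intro s _ hs
        have : m s = 0 := by
          by_contra h0
          exact hm s h0 (by simp [plane, e, hs])
        simp [this]
      · simp
  obtain ⟨a, ha, hsum⟩ := hD.exists_rep v
  rw [hv, show (9 : ℤ) - 1 = 8 by norm_num] at ha
  have h1 := congrArg (fun f => pderiv r (pderiv z (pderiv z f))) hsum
  simp only [map_sum] at h1
  rw [Finset.sum_eq_zero, pderiv_three_vectorField h hD, pderiv_three_vectorField h hD,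
    pderiv_two_vectorField h hD hr, hζ,
    vectorField_of_le_one h hD ((((A.hom v).pderiv_sub z).pderiv_sub z).pderiv_sub r) (by omega),
    zero_add] at h1
  · rcases mul_eq_zero.1 h1 with h0 | h0
    · exact h0
    · exact absurd (C_injective σ ℚ (by rw [h0, map_zero])) hζ0
  intro j _
  have h2 := two_le_d (A := A) j
  rcases hlist j with hj5 | rfl
  · have h5 := ne_of_num_eq_zero n5 j
    rw [pderiv_pderiv_mul]
    rcases (by omega : A.d j = 2 ∨ A.d j = 3 ∨ A.d j = 4) with h' | h' | h'
    · rw [pderiv_u_eq_zero (s := z) (by omega)]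
      simp only [mul_zero, map_zero, add_zero, pderiv_mul]
      rw [pderiv_u_eq_zero (s := r) (by omega),
        pderiv_eq_zero (((ha j).pderiv_sub z).pderiv_sub z) (by omega)]
      simp
    · rw [pderiv_u_eq_zero (s := z) (by omega), pderiv_pderiv_eq_zero (ha j) (by omega)]
      simp
    · rw [pderiv_pderiv_eq_zero (ha j) (by omega), pderiv_pderiv_eq_zero (A.hom j) (by omega)]
      simp only [zero_mul, zero_add, mul_zero, add_zero, map_add, pderiv_mul]
      rw [pderiv_eq_zero ((ha j).pderiv_sub z) (by omega),
        pderiv_eq_zero ((A.hom j).pderiv_sub z) (by omega)]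
      simp
  · rw [eq_zero (ha j) (by omega)]
    simp

theorem pderiv_coeff_eq_zero {y₀ : σ} (hy₀ : A.w y₀ = 2) (hgy : g y₀ ≠ 0) {r : σ}
    (hr : A.w r = 2) : pderiv r (g z) = 0 := by
  rcases h.exists_monic_cases with ⟨v, c, hd, hc, hv⟩ | ⟨v, c, hd, hc, hv⟩
  · exact pderiv_coeff_eq_zero_of_quadratic h hD hd hc hv hy₀ hgy hr
  · exact pderiv_coeff_eq_zero_of_cubic h hD hd hc hv hy₀ hgy hr

end DegreeOne

end PureCI

/-! ### Evaluation at the point `dir A g x`. -/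

namespace PureCI

variable {σ : Type*} [Fintype σ] {A : PureCI σ} {z : σ} {g : σ → MvPolynomial σ ℚ}

/-- The derivatives along `x` of the coefficients of a derivation at the variables of weight `2`. -/
noncomputable def dir (A : PureCI σ) (g : σ → MvPolynomial σ ℚ) (x s : σ) : ℂ :=
  if A.w s = 2 then ((constantCoeff (pderiv x (g s)) : ℚ) : ℂ) else 0

theorem w_of_dir_ne_zero {x s : σ} (hs : dir A g x s ≠ 0) : A.w s = 2 := by
  by_contra h
  exact hs (if_neg h)

theorem even_of_aeval_plane_ne_zero {e : σ → ℂ} (he : ∀ s, e s ≠ 0 → A.w s = 2)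
    {f : MvPolynomial σ ℚ} {n : ℤ} (hf : IsWeightedHomogeneous A.w f n)
    (h0 : aeval (plane z e 0) f ≠ 0) : Even n := by
  obtain ⟨m, hm, hsum⟩ := hf.exists_monomial_of_aeval_ne_zero h0
  rw [← hsum]
  refine Finset.even_sum _ fun s _ => ?_
  by_cases hs : m s = 0
  · simp [hs]
  · have := hm s hs
    simp only [plane, mul_zero, add_zero] at this
    rw [he s this]
    exact even_two.mul_left _

theorem IsType.aeval_plane_smul_eq_zero (h : A.IsType z) {e : σ → ℂ}
    (he : ∀ s, e s ≠ 0 → A.w s = 2) {f : MvPolynomial σ ℚ} (hf : IsWeightedHomogeneous A.w f 4)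
    (h0 : aeval (plane z e 0) f = 0) (r t : ℂ) : aeval (plane z (r • e) t) f = 0 := by
  have h1 := h.aeval_plane_four he hf 0
  have h2 := h.aeval_plane_four (e := r • e) (fun s hs => he s fun h0 => hs (by simp [h0])) hf t
  simp only [Pi.smul_apply, smul_eq_mul, mul_assoc, ← Finset.mul_sum,
    mul_left_comm _ r] at h2
  rw [← h1, h0] at h2
  simpa using h2

/-- Otherwise every relation except `u i` vanishes on the plane spanned by `dir A g x` and `z`. -/
theorem IsType.exists_second_relation (h : A.IsType z) {x : σ} (h0 : dir A g x ≠ 0) (i : σ)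
    (hmin : ∀ j, A.d j < 6 → aeval (plane z (dir A g x) 0) (A.u j) = 0)
    (h5 : ∀ j, A.d j = 5 →
      ∑ s, dir A g x s * ((constantCoeff (pderiv s (pderiv z (A.u j))) : ℚ) : ℂ) = 0) :
    ∃ j ≠ i, 6 ≤ A.d j := by
  by_contra! hlt
  have he : ∀ s, dir A g x s ≠ 0 → A.w s = 2 := fun s => w_of_dir_ne_zero
  refine h.not_forall_aeval_plane he h0 i fun j hj r t => ?_
  have h2 := two_le_d (A := A) j
  have h3 := hlt j hj
  have her : ∀ s, (r • dir A g x) s ≠ 0 → A.w s = 2 := fun s hs => he s fun h0 => hs (by simp [h0])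
  have h1 := A.hom j
  rcases (by omega : A.d j ≤ 3 ∨ A.d j = 4 ∨ A.d j = 5) with h' | h' | h'
  · exact h.aeval_plane_u_of_le her h' t
  · rw [h'] at h1
    exact h.aeval_plane_smul_eq_zero he h1 (hmin j (by omega)) r t
  · rw [h'] at h1
    rw [h.aeval_plane_five her h1 t]
    simp only [Pi.smul_apply, smul_eq_mul, mul_assoc, ← Finset.mul_sum, h5 j h', mul_zero]

theorem six_le_count {j : σ} (hj : 6 ≤ A.d j) {i : σ} (hi : A.d i = 6) (hij : j ≠ i) :
    2 ≤ A.num 6 ∨ 0 < A.num 7 ∨ 0 < A.num 8 ∨ 0 < A.num 9 ∨ 0 < A.numIco 10 12 ∨ 0 < A.numGe := by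
  rcases (by omega : A.d j = 6 ∨ A.d j = 7 ∨ A.d j = 8 ∨ A.d j = 9 ∨
    (10 ≤ A.d j ∧ A.d j < 12) ∨ 12 ≤ A.d j) with h' | h' | h' | h' | h' | h'
  · exact Or.inl (two_le_num h' hi hij)
  · exact Or.inr (Or.inl (num_pos_of_eq h'))
  · exact Or.inr (Or.inr (Or.inl (num_pos_of_eq h')))
  · exact Or.inr (Or.inr (Or.inr (Or.inl (num_pos_of_eq h'))))
  · exact Or.inr (Or.inr (Or.inr (Or.inr (Or.inl (numIco_pos h'.1 h'.2)))))
  · exact Or.inr (Or.inr (Or.inr (Or.inr (Or.inr (numGe_pos h')))))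

section DegreeOne

variable (h : A.IsType z) (hD : A.IsNegDer g 1) (hm : ∀ r, A.w r = 2 → pderiv r (g z) = 0)
include h hD hm

theorem pderiv_two_vectorField' {y : σ} (hy : A.w y = 2) (f : MvPolynomial σ ℚ) :
    pderiv y (vectorField g f) = vectorField g (pderiv y f) := by
  rw [pderiv_two_vectorField h hD hy, hm y hy, zero_mul, add_zero]

variable {x : σ} (hx : A.w x = 1)
include hx

/-- At this point the `∂_x (g s)` are the coordinates of the point itself, so the sum is the one in
Euler's formula. -/
theorem sum_aeval_pderiv {f : MvPolynomial σ ℚ} {n : ℤ} (hf : IsWeightedHomogeneous A.w f n) :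
    2 * aeval (plane z (dir A g x) 0) (∑ s, pderiv x (g s) * pderiv s f) =
      n * aeval (plane z (dir A g x) 0) f := by
  rw [← h.euler_plane (fun s => w_of_dir_ne_zero) hf 0, zero_mul, mul_zero, add_zero, map_sum]
  congr 1
  refine Finset.sum_congr rfl fun s _ => ?_
  rw [map_mul]
  rcases h.w_or s with hs | hs | hs
  · rw [hD.coeff_eq_zero hs.le, dir, if_neg (by omega)]
    simp
  · have := (hD.hom s).pderiv_sub x
    rw [hs, hx] at this
    rw [aeval_eq_constantCoeff this, dir, if_pos hs]
  · have := (hD.hom s).pderiv_sub x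
    rw [hs, hx] at this
    rw [h.aeval_plane_one (fun s => w_of_dir_ne_zero) this, dir, if_neg (by omega), zero_mul]

/-- Every `g s` vanishes at the point: those at variables of weight 2 are forms of weight 1, and `g
z`, of weight 2, has no linear term by `hm`. -/
theorem aeval_vectorField (f : MvPolynomial σ ℚ) :
    aeval (plane z (dir A g x) 0) (vectorField g f) = 0 := by
  have he : ∀ s, dir A g x s ≠ 0 → A.w s = 2 := fun s => w_of_dir_ne_zero
  rw [vectorField_apply, map_sum]
  refine Finset.sum_eq_zero fun s _ => ?_
  rw [map_mul]
  have h1 := hD.hom s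
  rcases h.w_or s with hs | hs | hs
  · rw [hD.coeff_eq_zero hs.le, map_zero, zero_mul]
  · rw [hs] at h1
    rw [h.aeval_plane_one he h1, zero_mul]
  · rw [hs] at h1
    rw [h.aeval_plane_two he h1, sum_mul_eq_zero_of_two he, zero_mul]
    intro r hr
    rw [(h.w_eq s).1 hs, hm r hr]
    simp

theorem aeval_pderiv_vectorField {f : MvPolynomial σ ℚ} {n : ℤ}
    (hf : IsWeightedHomogeneous A.w f n) :
    2 * aeval (plane z (dir A g x) 0) (pderiv x (vectorField g f)) =
      n * aeval (plane z (dir A g x) 0) f := by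
  rw [pderiv_vectorField, map_add, aeval_vectorField h hD hm hx, zero_add,
    sum_aeval_pderiv h hD hm hx hf]

/-- Applied to `vectorField g (u j)`, the second derivative along `x` takes the value `2 * ∂_x (u
j)` at the point. -/
theorem vectorField_ne_zero {j : σ} (hj : A.d j = 3)
    (hne : aeval (plane z (dir A g x) 0) (pderiv x (A.u j)) ≠ 0) : vectorField g (A.u j) ≠ 0 := by
  intro h0
  have hz := (h.w_eq z).2 rfl
  have hf := (A.hom j).pderiv_sub x
  rw [hj, hx] at hf
  have h1 := congrArg (fun f => pderiv x (pderiv x f)) h0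
  simp only [map_zero] at h1
  rw [pderiv_vectorField, map_add] at h1
  have h2 := aeval_pderiv_vectorField h hD hm hx hf
  have h3 := sum_aeval_pderiv h hD hm hx hf
  have h4 : pderiv x (∑ s, pderiv x (g s) * pderiv s (A.u j)) =
      ∑ s, pderiv x (g s) * pderiv s (pderiv x (A.u j)) := by
    rw [map_sum]
    refine Finset.sum_congr rfl fun s _ => ?_
    rw [pderiv_mul, pderiv_comm x s]
    rcases h.w_or s with hs | hs | hs
    · simp [hD.coeff_eq_zero hs.le]
    · rw [pderiv_pderiv_eq_zero (hD.hom s) (by omega), zero_mul, zero_add]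
    · rw [pderiv_u_eq_zero (s := s) (by omega), mul_zero, zero_add]
  rw [h4] at h1
  have h5 := congrArg (aeval (plane z (dir A g x) 0)) h1
  rw [map_add, map_zero] at h5
  push_cast at h2 h3
  exact hne (by linear_combination h5 / 2 - h2 / 4 - h3 / 4)

/-- Apply `∂_x` at the point: the left side of `hsum` becomes `(d i / 2) * u i`, which is non-zero,
and minimality removes the terms `∂_x (a j) * u j`. A form non-zero at the point has even weight, so
`d j - 1` is even. -/
theorem exists_odd_term {i : σ} (hi : aeval (plane z (dir A g x) 0) (A.u i) ≠ 0)
    (hmin : ∀ j, A.d j < A.d i → aeval (plane z (dir A g x) 0) (A.u j) = 0)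
    {a : σ → MvPolynomial σ ℚ}
    (ha : ∀ j, IsWeightedHomogeneous A.w (a j) (A.d i - 1 - A.d j))
    (hsum : vectorField g (A.u i) = ∑ j, a j * A.u j) :
    ∃ j, Odd (A.d j) ∧ A.d j < A.d i ∧ aeval (plane z (dir A g x) 0) (a j) ≠ 0 ∧
      aeval (plane z (dir A g x) 0) (pderiv x (A.u j)) ≠ 0 := by
  have h1 := aeval_pderiv_vectorField h hD hm hx (A.hom i)
  have h2 : aeval (plane z (dir A g x) 0) (pderiv x (vectorField g (A.u i))) ≠ 0 := by
    intro h0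
    rw [h0, mul_zero] at h1
    rcases mul_eq_zero.1 h1.symm with h3 | h3
    · have := two_le_d (A := A) i
      norm_cast at h3
      omega
    · exact hi h3
  rw [hsum, map_sum, map_sum] at h2
  obtain ⟨j, -, hj⟩ := Finset.exists_ne_zero_of_sum_ne_zero h2
  have hlt : A.d j < A.d i := by
    by_contra hle
    rw [eq_zero (ha j) (by omega)] at hj
    simp at hj
  rw [pderiv_mul, map_add, map_mul, map_mul, hmin j hlt, mul_zero, zero_add] at hj
  refine ⟨j, ?_, hlt, left_ne_zero_of_mul hj, right_ne_zero_of_mul hj⟩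
  have := even_of_aeval_plane_ne_zero (fun s => w_of_dir_ne_zero) ((A.hom j).pderiv_sub x)
    (right_ne_zero_of_mul hj)
  rw [hx] at this
  simpa using this.add_one

/-- `D (∂_z (u j)) = ∂_z (D (u j))` only involves `∂_z` of relations of weight 4, so it is zero; by
the Euler identity `∂_z (u j)` then vanishes at the point. -/
theorem sum_dir_eq_zero (h4 : A.num 4 = 0) {j : σ} (hj : A.d j = 5) :
    ∑ s, dir A g x s * ((constantCoeff (pderiv s (pderiv z (A.u j))) : ℚ) : ℂ) = 0 := by
  have hz := (h.w_eq z).2 rfl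
  have hf := (A.hom j).pderiv_sub z
  rw [hj, hz] at hf
  rw [← h.aeval_plane_two (fun s => w_of_dir_ne_zero) hf 0]
  have h1 := aeval_pderiv_vectorField h hD hm hx hf
  obtain ⟨b, hb, hsum⟩ := hD.exists_rep j
  rw [hj, show (5 : ℤ) - 1 = 4 by norm_num] at hb
  have h2 := congrArg (pderiv z) hsum
  simp only [map_sum, term_four_three (hb _) hz, sum_ite_eq_zero h4] at h2
  rw [← pderiv_three_vectorField h hD, h2] at h1
  push_cast at h1
  simpa using h1.symm

theorem false_of_num_four_eq_zero (h0 : dir A g x ≠ 0) {i : σ}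
    (hi : A.d i = 6) (hmin : ∀ j, A.d j < 6 → aeval (plane z (dir A g x) 0) (A.u j) = 0)
    (h4 : A.num 4 = 0) (h5 : 0 < A.num 5) : False := by
  obtain ⟨j, hj, hj6⟩ := h.exists_second_relation h0 i hmin
    fun j hj => sum_dir_eq_zero h hD hm hx h4 hj
  have := six_le_count hj6 hi hj
  have := h.count
  have := num_pos_of_eq hi
  have := numVar_pos hx
  omega

/-- If the term of odd weight in the image of a relation of weight `6` has weight `5`. -/
theorem false_of_weight_five (h0 : dir A g x ≠ 0) {i : σ} (hi : A.d i = 6)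
    (hmin : ∀ j, A.d j < 6 → aeval (plane z (dir A g x) 0) (A.u j) = 0)
    {a : σ → MvPolynomial σ ℚ} (ha : ∀ j, IsWeightedHomogeneous A.w (a j) (5 - A.d j))
    (hrel : ∀ r, A.w r = 2 →
      (∑ j, if A.d j = 5 then a j * pderiv r (pderiv z (A.u j)) else 0) = 0)
    {j : σ} (hj : A.d j = 5) (haj : a j ≠ 0) : False := by
  obtain ⟨c1, c2, c3, c4⟩ := h.count
  have n1 := numVar_pos hx
  have n5 := num_pos_of_eq hj
  have n6 := num_pos_of_eq hi
  have hb := h.numVar_two_pos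
  by_cases n4 : A.num 4 = 0
  · exact false_of_num_four_eq_zero h hD hm hx h0 hi hmin n4 n5
  have n5' : A.num 5 = 1 := by omega
  have hj' := ha j
  rw [hj, sub_self] at hj'
  -- The only relation of weight 5 is `u j`, so `hrel` has a single term.
  have hz0 : ∀ r, A.w r = 2 → pderiv r (pderiv z (A.u j)) = 0 := fun r hr => by
    have := hrel r hr
    rw [sum_ite_eq_single n5'.le hj] at this
    exact (mul_eq_zero.1 this).resolve_left haj
  obtain ⟨k, hk, hk6⟩ := h.exists_second_relation h0 i hmin fun j' hj' => by
    obtain rfl := eq_of_num_le_one n5'.le hj' hj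
    refine sum_mul_eq_zero_of_two (fun s => w_of_dir_ne_zero) fun s hs => ?_
    rw [hz0 s hs]
    simp
  have := six_le_count hk6 hi hk
  omega

end DegreeOne

end PureCI

/-! ### Multiplication by a linear form modulo the relations of weight 2. -/

namespace PureCI

variable {σ : Type*} [Fintype σ] {A : PureCI σ} {z : σ} {g : σ → MvPolynomial σ ℚ}

/-- The ideal generated by the relations of weight `2`. -/
noncomputable def quadIdeal (A : PureCI σ) : Ideal (MvPolynomial σ ℚ) :=
  Ideal.span (A.u '' {i | A.d i = 2})

theorem mem_quadIdeal {f : MvPolynomial σ ℚ} (hf : f ∈ A.ideal)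
    (hn : IsWeightedHomogeneous A.w f 2) : f ∈ A.quadIdeal := by
  obtain ⟨a, ha, rfl⟩ := A.exists_rep hf hn
  refine sum_mem fun i _ => ?_
  have h2 := two_le_d (A := A) i
  by_cases hi : A.d i = 2
  · exact Ideal.mul_mem_left _ _ (Ideal.subset_span ⟨i, hi, rfl⟩)
  · rw [eq_zero (ha i) (by omega), zero_mul]
    exact zero_mem _

theorem eq_zero_of_mem_ideal {f : MvPolynomial σ ℚ} (hf : f ∈ A.ideal)
    (hn : IsWeightedHomogeneous A.w f 1) : f = 0 := by
  obtain ⟨a, ha, rfl⟩ := A.exists_rep hf hn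
  refine Finset.sum_eq_zero fun i _ => ?_
  have h2 := two_le_d (A := A) i
  rw [eq_zero (ha i) (by omega), zero_mul]

theorem num_two_pos {f : MvPolynomial σ ℚ} (hf : f ∈ A.ideal)
    (hn : IsWeightedHomogeneous A.w f 2) (hne : f ≠ 0) : 0 < A.num 2 := by
  obtain ⟨a, ha, rfl⟩ := A.exists_rep hf hn
  obtain ⟨i, -, hi⟩ := Finset.exists_ne_zero_of_sum_ne_zero hne
  have h2 := two_le_d (A := A) i
  refine num_pos_of_eq (i := i) (le_antisymm ?_ h2)
  by_contra hlt
  exact hi (by rw [eq_zero (ha i) (by omega), zero_mul])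

section Syzygy

variable {ℓ : MvPolynomial σ ℚ} {e : σ → ℂ}

/-- Comparing `ℓ * f` with its representation by relations of weight 2 gives a syzygy, so `ℓ * a j`
lies in the ideal of the relations other than `u j`. If `d i = 4`, it has weight 1 and must be zero.
If `d i = 6`, it has weight 3 and no other relation of weight 3 is available, so `a j` involves no
variable of weight 2 and vanishes at `e`. -/
theorem IsType.false_of_mul_mem (h : A.IsType z) (he : ∀ s, e s ≠ 0 → A.w s = 2)
    (hℓ : IsWeightedHomogeneous A.w ℓ 1)
    (hℓ0 : ℓ ≠ 0) {i j : σ} (hj : A.d j = 3) {f : MvPolynomial σ ℚ} (hf : ℓ * f ∈ A.quadIdeal)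
    {a : σ → MvPolynomial σ ℚ} (ha : ∀ k, IsWeightedHomogeneous A.w (a k) (A.d i - 1 - A.d k))
    (hsum : f = ∑ k, a k * A.u k)
    (hne : aeval (plane z e 0) (a j) ≠ 0) (hi : A.d i = 4 ∨ A.d i = 6 ∧ A.num 3 ≤ 1) : False := by
  have hlf : IsWeightedHomogeneous A.w (ℓ * f) (A.d i) := by
    rw [hsum, Finset.mul_sum]
    refine IsWeightedHomogeneous.sum _ _ _ fun k _ => ?_
    convert hℓ.mul ((ha k).mul (A.hom k)) using 1
    ring
  obtain ⟨b, -, hb0, hb⟩ := A.exists_rep_span hf hlf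
  have h0 : ∑ k, (ℓ * a k - b k) * A.u k = 0 := by
    simp only [sub_mul, Finset.sum_sub_distrib, mul_assoc, ← Finset.mul_sum]
    rw [← hsum, ← hb, sub_self]
  have hmem := mul_mem_of_sum_mul_eq_zero h0 j
  rw [hb0 j (by simp [hj]), sub_zero] at hmem
  have hla := hℓ.mul (ha j)
  rw [hj] at hla
  rcases hi with hi | ⟨hi, h3⟩
  · rw [hi] at hla
    have := eq_zero_of_mem_ideal (A.span_le_ideal _ hmem) (by simpa using hla)
    rw [(mul_eq_zero.1 this).resolve_left hℓ0] at hne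
    simp at hne
  · have haj := ha j
    rw [hi, show (1 : ℤ) + (6 - 1 - 3) = 3 by norm_num] at hla
    rw [hi, hj, show (6 : ℤ) - 1 - 3 = 2 by norm_num] at haj
    obtain ⟨c, hc, hc0, hcsum⟩ := A.exists_rep_span hmem hla
    refine hne ?_
    rw [h.aeval_plane_two he haj]
    refine sum_mul_eq_zero_of_two he fun y hy => ?_
    have h1 := congrArg (pderiv y) hcsum
    simp only [map_sum, term_three_two (hc _) hy] at h1
    rw [sum_ite_eq_single h3 hj, hc0 j (by simp), zero_mul, pderiv_mul,
      pderiv_eq_zero hℓ (by omega), zero_mul, zero_add] at h1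
    rw [(mul_eq_zero.1 h1).resolve_left hℓ0]
    simp

variable {c : σ → ℚ} (h : A.IsType z) (hD : A.IsNegDer g 1)
  (hg : ∀ y, A.w y = 2 → g y = C (c y) * ℓ) (H2 : ℓ * ℓ ∈ A.quadIdeal)
include h hD hg H2

theorem mul_coeff_mem {s : σ} (hs : s ≠ z) : ℓ * g s ∈ A.quadIdeal := by
  rcases h.w_or s with h1 | h1 | h1
  · rw [hD.coeff_eq_zero h1.le, mul_zero]
    exact zero_mem _
  · rw [hg s h1, mul_left_comm]
    exact Ideal.mul_mem_left _ _ H2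
  · exact absurd ((h.w_eq s).1 h1) hs

theorem mul_vectorField_mem_of_weight_two {f : MvPolynomial σ ℚ}
    (hf : IsWeightedHomogeneous A.w f 2) : ℓ * vectorField g f ∈ A.quadIdeal := by
  have hz := (h.w_eq z).2 rfl
  rw [vectorField_apply, Finset.mul_sum]
  refine sum_mem fun s _ => ?_
  by_cases hs : s = z
  · rw [hs, pderiv_eq_zero hf (by omega), mul_zero, mul_zero]
    exact zero_mem _
  · rw [← mul_assoc]
    exact Ideal.mul_mem_right _ _ (mul_coeff_mem h hD hg H2 hs)

theorem mul_vectorField_mem (hgz : ℓ * g z ∈ A.quadIdeal) (f : MvPolynomial σ ℚ) :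
    ℓ * vectorField g f ∈ A.quadIdeal := by
  rw [vectorField_apply, Finset.mul_sum]
  refine sum_mem fun s _ => ?_
  rw [← mul_assoc]
  refine Ideal.mul_mem_right _ _ ?_
  by_cases hs : s = z
  · exact hs ▸ hgz
  · exact mul_coeff_mem h hD hg H2 hs

/-- Second derivatives of `D (u v) = ∑ a j * u j` along weight 2 variables, together with `tau`, put
`ℓ * a j` in `quadIdeal` for `d j = 4`. The derivative along `z` then expresses `ζ * g z` by terms
that `ℓ` multiplies into `quadIdeal`. The hypothesis `tau` says that the Hessians of the relations
of weight 4 in these variables can be inverted. -/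
theorem mul_coeff_three_mem (hm : ∀ r, A.w r = 2 → pderiv r (g z) = 0)
    (H1 : ∀ k, A.d k = 3 → ∀ y, A.w y = 2 → ℓ * pderiv y (A.u k) ∈ A.quadIdeal)
    (n5 : A.num 5 = 0)
    (tau : ∀ τ : σ → MvPolynomial σ ℚ, (∀ r s, A.w r = 2 → A.w s = 2 →
      ℓ * (∑ j, if A.d j = 4 then τ j * pderiv r (pderiv s (A.u j)) else 0) ∈ A.quadIdeal) →
        ∀ j, A.d j = 4 → ℓ * τ j ∈ A.quadIdeal)
    {v : σ} {ζ : ℚ} (hv : A.d v = 6) (hζ0 : ζ ≠ 0) (hζ : pderiv z (pderiv z (A.u v)) = C ζ) :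
    ℓ * g z ∈ A.quadIdeal := by
  classical
  have hz := (h.w_eq z).2 rfl
  obtain ⟨a, ha, hsum⟩ := hD.exists_rep v
  rw [hv, show (6 : ℤ) - 1 = 5 by norm_num] at ha
  have key := tau a fun r s hr hs => by
    have h1 := congrArg (fun f => pderiv r (pderiv s f)) hsum
    simp only [map_sum, term_five_two_two (ha _) hr hs, Finset.sum_add_distrib,
      sum_ite_eq_zero n5, add_zero] at h1
    rw [pderiv_two_vectorField' h hD hm hs, pderiv_two_vectorField' h hD hm hr] at h1
    have hw := ((A.hom v).pderiv_sub s).pderiv_sub r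
    rw [hv, hr, hs, show (6 : ℤ) - 2 - 2 = 2 by norm_num] at hw
    rw [← sub_eq_iff_eq_add'.2 h1, mul_sub]
    refine sub_mem (mul_vectorField_mem_of_weight_two h hD hg H2 hw) ?_
    rw [Finset.mul_sum]
    refine sum_mem fun k _ => ?_
    split_ifs with hk
    · rw [mul_add, mul_left_comm, mul_left_comm ℓ]
      exact add_mem (Ideal.mul_mem_left _ _ (H1 k hk r hr)) (Ideal.mul_mem_left _ _ (H1 k hk s hs))
    · rw [mul_zero]
      exact zero_mem _
  have h1 := congrArg (pderiv z) hsum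
  simp only [map_sum, term_five_three (ha _) hz, Finset.sum_add_distrib,
      sum_ite_eq_zero n5, add_zero] at h1
  rw [pderiv_three_vectorField h hD, vectorField_apply,
    ← Finset.add_sum_erase _ _ (Finset.mem_univ z), hζ] at h1
  refine mem_of_C_mul_mem hζ0 ?_
  rw [mul_comm, mul_assoc, eq_sub_of_add_eq h1, mul_sub, mul_add]
  refine sub_mem (add_mem ?_ ?_) ?_
  · refine Ideal.mul_mem_left _ _ (sum_mem fun k _ => ?_)
    split_ifs with hk
    · exact Ideal.mul_mem_left _ _ (Ideal.subset_span ⟨k, hk, rfl⟩)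
    · exact zero_mem _
  · rw [Finset.mul_sum]
    refine sum_mem fun k _ => ?_
    split_ifs with hk
    · rw [← mul_assoc]
      exact Ideal.mul_mem_right _ _ (key k hk)
    · rw [mul_zero]
      exact zero_mem _
  · rw [Finset.mul_sum]
    refine sum_mem fun s hs => ?_
    rw [← mul_assoc]
    exact Ideal.mul_mem_right _ _ (mul_coeff_mem h hD hg H2 (Finset.ne_of_mem_erase hs))

end Syzygy

section Unique

variable (h : A.IsType z) (hD : A.IsNegDer g 1) (hm : ∀ r, A.w r = 2 → pderiv r (g z) = 0)
include h hD

theorem mul_pderiv_mem_of_unique {y : σ} (hy : ∀ s, A.w s = 2 ↔ s = y) {k : σ} (hk : A.d k = 3)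
    {s : σ} (hs : A.w s = 2) : g y * pderiv s (A.u k) ∈ A.quadIdeal := by
  obtain rfl := (hy s).1 hs
  have h1 := (A.hom k).vectorField hD.hom
  have h2 := hD.map_u k
  have hz := (h.w_eq z).2 rfl
  rw [vectorField_apply, Finset.sum_eq_single s] at h1 h2
  · rw [hk] at h1
    exact mem_quadIdeal h2 h1
  · intro t _ ht
    rcases h.w_or t with h' | h' | h'
    · rw [hD.coeff_eq_zero h'.le, zero_mul]
    · exact absurd ((hy t).1 h') ht
    · rw [pderiv_u_eq_zero (by omega), mul_zero]
  · simp
  · intro t _ ht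
    rcases h.w_or t with h' | h' | h'
    · rw [hD.coeff_eq_zero h'.le, zero_mul]
    · exact absurd ((hy t).1 h') ht
    · rw [pderiv_u_eq_zero (by omega), mul_zero]
  · simp

include hm

/-- The linear form is `ℓ = g y`. Differentiating `D (u i)` along `y` once if `d i = 4`, twice if `d
i = 6`, turns the left side into a non-zero multiple of `g y`; then `H1` gives `g y * g y` in
`quadIdeal`. -/
theorem false_of_unique {y : σ} (hy : ∀ s, A.w s = 2 ↔ s = y) (hgy : g y ≠ 0)
    (n5 : A.num 5 = 0) {e : σ → ℂ} (he : ∀ s, e s ≠ 0 → A.w s = 2)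
    {i j : σ} (hi : A.d i = 4 ∧ A.num 4 ≤ 1 ∨ A.d i = 6 ∧ A.num 3 ≤ 1 ∧ A.num 4 = 0)
    (hne : aeval (plane z e 0) (A.u i) ≠ 0) (hj : A.d j = 3)
    {a : σ → MvPolynomial σ ℚ} (ha : ∀ k, IsWeightedHomogeneous A.w (a k) (A.d i - 1 - A.d k))
    (hsum : vectorField g (A.u i) = ∑ k, a k * A.u k) (haj : aeval (plane z e 0) (a j) ≠ 0)
    {v : σ} {ζ : ℚ} (hv : A.d v = 6) (hζ0 : ζ ≠ 0) (hζ : pderiv z (pderiv z (A.u v)) = C ζ) :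
    False := by
  have hyw := (hy y).2 rfl
  have hℓ : IsWeightedHomogeneous A.w (g y) 1 := by
    have := hD.hom y
    rwa [hyw] at this
  have hg : ∀ s, A.w s = 2 → g s = C ((fun _ => 1 : σ → ℚ) s) * g y := fun s hs => by
    rw [(hy s).1 hs, C_1, one_mul]
  have H1 : ∀ k, A.d k = 3 → ∀ s, A.w s = 2 → g y * pderiv s (A.u k) ∈ A.quadIdeal :=
    fun k hk s hs => mul_pderiv_mem_of_unique h hD hy hk hs
  have ne4 : ∀ f : MvPolynomial σ ℚ, IsWeightedHomogeneous A.w f 4 →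
      aeval (plane z e 0) f ≠ 0 → ∃ q : ℚ, q ≠ 0 ∧ pderiv y (pderiv y f) = C q := by
    intro f hf hf0
    have hw := (hf.pderiv_sub y).pderiv_sub y
    rw [hyw, show (4 : ℤ) - 2 - 2 = 0 by norm_num] at hw
    refine ⟨_, fun hq => hf0 ?_, hw.eq_C A.w_pos⟩
    have := h.aeval_plane_four he hf 0
    rw [sum_mul_eq_zero_of_two he] at this
    · simpa using this
    · intro s hs
      refine sum_mul_eq_zero_of_two he fun r hr => ?_
      rw [(hy s).1 hs, (hy r).1 hr, hq]
      simp
  have H2tau : g y * g y ∈ A.quadIdeal ∧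
      (∀ τ : σ → MvPolynomial σ ℚ, (∀ r s, A.w r = 2 → A.w s = 2 →
      g y * (∑ j, if A.d j = 4 then τ j * pderiv r (pderiv s (A.u j)) else 0) ∈ A.quadIdeal) →
        ∀ j, A.d j = 4 → g y * τ j ∈ A.quadIdeal) := by
    rcases hi with ⟨hi, n4⟩ | ⟨hi, n3, n4⟩
    · have hu := A.hom i
      rw [hi] at hu ha
      obtain ⟨q, hq, hqC⟩ := ne4 _ hu hne
      refine ⟨?_, fun τ hτ k hk => ?_⟩
      · have h1 := congrArg (pderiv y) hsum
        simp only [map_sum, term_three_two (ha _) hyw] at h1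
        have hw := hu.pderiv_sub y
        rw [hyw] at hw
        rw [pderiv_two_vectorField' h hD hm hyw, vectorField_two_of_unique h hD hy hw, hqC] at h1
        refine mem_of_C_mul_mem hq ?_
        rw [mul_comm, mul_assoc, h1, Finset.mul_sum]
        refine sum_mem fun k _ => ?_
        split_ifs with hk
        · rw [mul_left_comm]
          exact Ideal.mul_mem_left _ _ (H1 k hk y hyw)
        · rw [mul_zero]
          exact zero_mem _
      · obtain rfl := eq_of_num_le_one n4 hi hk
        have := hτ y y hyw hyw
        rw [sum_ite_eq_single n4 hi, hqC] at this
        refine mem_of_C_mul_mem hq ?_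
        rwa [mul_comm, mul_assoc]
    · refine ⟨?_, fun τ hτ k hk => absurd hk (ne_of_num_eq_zero n4 k)⟩
      have hu := A.hom i
      rw [hi] at hu ha
      have hw := hu.pderiv_sub y
      rw [hyw, show (6 : ℤ) - 2 = 4 by norm_num] at hw
      have hw2 := hw.pderiv_sub y
      rw [hyw] at hw2
      have h0 : aeval (plane z e 0) (pderiv y (A.u i)) ≠ 0 := by
        intro h0
        have h1 := h.euler_plane he hu 0
        rw [sum_mul_eq_zero_of_two he fun s hs => by rw [(hy s).1 hs, h0]] at h1
        simp at h1
        exact hne h1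
      obtain ⟨q, hq, hqC⟩ := ne4 _ hw h0
      have h1 := congrArg (fun f => pderiv y (pderiv y f)) hsum
      simp only [map_sum, term_five_two_two (ha _) hyw hyw, Finset.sum_add_distrib,
        sum_ite_eq_zero n5, sum_ite_eq_zero n4, add_zero] at h1
      rw [pderiv_two_vectorField' h hD hm hyw, pderiv_two_vectorField' h hD hm hyw,
        vectorField_two_of_unique h hD hy hw2, hqC] at h1
      refine mem_of_C_mul_mem hq ?_
      rw [mul_comm, mul_assoc, h1, Finset.mul_sum]
      refine sum_mem fun k _ => ?_
      split_ifs with hk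
      · rw [← two_mul, mul_left_comm, mul_left_comm (g y)]
        exact Ideal.mul_mem_left _ _ (Ideal.mul_mem_left _ _ (H1 k hk y hyw))
      · rw [mul_zero]
        exact zero_mem _
  obtain ⟨H2, tau⟩ := H2tau
  have hgz := mul_coeff_three_mem h hD hg H2 hm H1 n5 tau hv hζ0 hζ
  exact h.false_of_mul_mem he hℓ hgy hj (mul_vectorField_mem h hD hg H2 hgz _) ha hsum haj
    (hi.imp And.left fun h => ⟨h.1, h.2.1⟩)

end Unique

end PureCI

/-! ### Two variables and two relations of weight 4 and 2 respectively interchanged: the pencil of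
relations of weight 4. -/

namespace PureCI

variable {σ : Type*} [Fintype σ] {A : PureCI σ} {z : σ} {g : σ → MvPolynomial σ ℚ}

theorem exists_pair_of_numVar_eq_two {n : ℤ} (hn : A.numVar n = 2) :
    ∃ r s, r ≠ s ∧ ∀ t, A.w t = n ↔ t = r ∨ t = s := by
  classical
  rw [numVar, Finset.card_eq_two] at hn
  obtain ⟨r, s, hrs, h⟩ := hn
  refine ⟨r, s, hrs, fun t => ?_⟩
  have := Finset.ext_iff.1 h t
  simpa using this

theorem exists_other_of_num_eq_two {n : ℤ} (hn : A.num n = 2) {i : σ} (hi : A.d i = n) :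
    ∃ k, k ≠ i ∧ ∀ t, A.d t = n ↔ t = i ∨ t = k := by
  classical
  rw [num, Finset.card_eq_two] at hn
  obtain ⟨r, s, hrs, h⟩ := hn
  have h' : ∀ t, A.d t = n ↔ t = r ∨ t = s := fun t => by
    have := Finset.ext_iff.1 h t
    simpa using this
  rcases (h' i).1 hi with rfl | rfl
  · exact ⟨s, hrs.symm, h'⟩
  · exact ⟨r, hrs, fun t => (h' t).trans or_comm⟩

theorem const_of_four {f : MvPolynomial σ ℚ} (hf : IsWeightedHomogeneous A.w f 4) {r s : σ}
    (hr : A.w r = 2) (hs : A.w s = 2) :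
    pderiv r (pderiv s f) = C (constantCoeff (pderiv r (pderiv s f))) := by
  have := (hf.pderiv_sub s).pderiv_sub r
  rw [hr, hs] at this
  exact this.eq_C A.w_pos

/-- The relations of weight `4` have no common pencil when all others vanish for degree reasons. -/
theorem IsType.exists_ne_of_pencil (h : A.IsType z) {y₁ y₂ : σ} (hy : y₁ ≠ y₂)
    (hyw : ∀ t, A.w t = 2 ↔ t = y₁ ∨ t = y₂) {i k v : σ} (hk : A.d k = 4) (hi : A.d i = 4)
    (h4 : ∀ t, A.d t = 4 ↔ t = i ∨ t = k) (hv : ∀ t ≠ v, A.d t ≤ 4) (lam : ℚ) :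
    ∃ r s, A.w r = 2 ∧ A.w s = 2 ∧
      constantCoeff (pderiv s (pderiv r (A.u k - C lam * A.u i))) ≠ 0 := by
  classical
  by_contra! hQ
  have hui := A.hom i
  have huk := A.hom k
  rw [hi] at hui
  rw [hk] at huk
  -- In two variables `u i` has a non-trivial zero `e`. If `u k - lam * u i` had no quadratic part
  -- there, both relations of weight 4 would vanish on the plane spanned by `e` and `z`.
  obtain ⟨e, he, hne, he0⟩ : ∃ e : σ → ℂ, (∀ s, e s ≠ 0 → A.w s = 2) ∧ e ≠ 0 ∧
      aeval (plane z e 0) (A.u i) = 0 := by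
    have hz := (h.w_eq z).2 rfl
    have hp : ∀ e : σ → ℂ, plane z e 0 = e := fun e => by
      funext s
      simp [plane]
    rcases hui.exists_zero (p := 2) (q := 2) two_pos (by norm_num)
      (fun s => if s = y₁ then 1 else 0) (fun s => if s = y₂ then 1 else 0)
      (fun s hs => by simpa using (hyw s).2 (Or.inl (by simpa using hs)))
      (fun s hs => by simpa using (hyw s).2 (Or.inr (by simpa using hs))) with ⟨t, ht⟩ | ht
    · refine ⟨fun s => (if s = y₁ then 1 else 0) + (if s = y₂ then 1 else 0) * t, fun s hs => ?_,
        fun h0 => ?_, ?_⟩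
      · refine (hyw s).2 ?_
        by_contra! hc
        simp [hc] at hs
      · have := congrFun h0 y₁
        simp [hy] at this
      · rw [hp]
        exact ht
    · refine ⟨fun s => (if s = y₂ then 1 else 0), fun s hs => (hyw s).2 (Or.inr (by simpa using
        hs)),
        fun h0 => ?_, ?_⟩
      · have := congrFun h0 y₂
        simp at this
      · rw [hp]
        exact ht
  refine h.not_forall_aeval_plane he hne v fun j hj r t => ?_
  have her : ∀ s, (r • e) s ≠ 0 → A.w s = 2 := fun s hs => he s fun h0 => hs (by simp [h0])
  have hi0 := h.aeval_plane_smul_eq_zero he hui he0 r t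
  by_cases hj4 : A.d j = 4
  · rcases (h4 j).1 hj4 with rfl | rfl
    · exact hi0
    · have hU : IsWeightedHomogeneous A.w (A.u j - C lam * A.u i) 4 := by
        refine huk.sub ?_
        simpa using (isWeightedHomogeneous_C A.w lam).mul hui
      have h1 := h.aeval_plane_four her hU t
      rw [sum_mul_eq_zero_of_two her] at h1
      · have h2 : aeval (plane z (r • e) t) (A.u j - C lam * A.u i) = 0 := by simpa using h1
        rw [map_sub, map_mul, hi0, mul_zero, sub_zero] at h2
        exact h2
      · intro s hs
        refine sum_mul_eq_zero_of_two her fun r hr => ?_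
        rw [hQ s r hs hr]
        simp
  · have := hv j hj
    exact h.aeval_plane_u_of_le her (by omega) t

section Pair

variable {ℓ : MvPolynomial σ ℚ} {c : σ → ℚ} (h : A.IsType z) (hD : A.IsNegDer g 1)
  (hg : ∀ y, A.w y = 2 → g y = C (c y) * ℓ) (hc : ∀ s, A.w s ≠ 2 → c s = 0)
include h hD hg hc

theorem vectorField_eq_C_mul {f : MvPolynomial σ ℚ} (hf : IsWeightedHomogeneous A.w f 2) :
    vectorField g f = C (∑ s, c s * constantCoeff (pderiv s f)) * ℓ := by
  rw [vectorField_two h hD hf (φ := fun s => C (c s * constantCoeff (pderiv s f)) * ℓ),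
    map_sum, Finset.sum_mul]
  · intro s hs
    have := hf.pderiv_sub s
    rw [hs] at this
    rw [hg s hs, C_mul, ← (this.eq_C A.w_pos)]
    ring
  · intro s hs
    rw [hc s hs]
    simp

end Pair

theorem false_of_pair (h : A.IsType z) (hD : A.IsNegDer g 1)
    (hm : ∀ r, A.w r = 2 → pderiv r (g z) = 0) {y₀ : σ} (hy₀ : A.w y₀ = 2) (hgy : g y₀ ≠ 0)
    (n2 : A.numVar 2 = 2) (n3 : A.num 3 ≤ 1) (n4 : A.num 4 = 2) (n5 : A.num 5 = 0)
    {e : σ → ℂ} (he : ∀ s, e s ≠ 0 → A.w s = 2) {i j : σ} (hi : A.d i = 4) (hj : A.d j = 3)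
    (hDj : vectorField g (A.u j) ≠ 0)
    {a : σ → MvPolynomial σ ℚ} (ha : ∀ k, IsWeightedHomogeneous A.w (a k) (A.d i - 1 - A.d k))
    (hsum : vectorField g (A.u i) = ∑ k, a k * A.u k) (haj : aeval (plane z e 0) (a j) ≠ 0)
    {v : σ} {ζ : ℚ} (hv : A.d v = 6) (hlt : ∀ t ≠ v, A.d t ≤ 4) (hζ0 : ζ ≠ 0)
    (hζ : pderiv z (pderiv z (A.u v)) = C ζ) : False := by
  classical
  have hz := (h.w_eq z).2 rfl
  obtain ⟨y₁, y₂, hy, hyw⟩ := exists_pair_of_numVar_eq_two n2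
  obtain ⟨k, hki, h4⟩ := exists_other_of_num_eq_two n4 hi
  have hk : A.d k = 4 := (h4 k).2 (Or.inr rfl)
  have hui := A.hom i
  have huk := A.hom k
  rw [hi] at hui
  rw [hk] at huk
  have cj : ∀ {b : MvPolynomial σ ℚ}, IsWeightedHomogeneous A.w b (4 - 1 - A.d j) →
      b = C (constantCoeff b) := fun hb => by
    rw [hj] at hb
    exact hb.eq_C A.w_pos
  have hDf : ∀ {i : σ} {b : σ → MvPolynomial σ ℚ}, A.d i = 4 →
      (∀ k, IsWeightedHomogeneous A.w (b k) (A.d i - 1 - A.d k)) →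
      vectorField g (A.u i) = ∑ k, b k * A.u k → ∀ f, A.w f = 2 →
      vectorField g (pderiv f (A.u i)) = C (constantCoeff (b j)) * pderiv f (A.u j) := by
    intro i b hi hb hsum f hf
    rw [hi] at hb
    have h1 := congrArg (pderiv f) hsum
    simp only [map_sum, term_three_two (hb _) hf] at h1
    rw [sum_ite_eq_single n3 hj, pderiv_two_vectorField' h hD hm hf] at h1
    rw [h1, ← cj (hb j)]
  obtain ⟨a', ha', hsum'⟩ := hD.exists_rep k
  have e1 := hDf hi ha hsum
  have e2 := hDf hk ha' hsum'
  have hc1 : constantCoeff (a j) ≠ 0 := fun h0 => haj (by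
    have := ha j
    rw [hi] at this
    rw [cj this, h0]
    simp)
  set c1 := constantCoeff (a j)
  -- By `e1` and `e2`, this member of the pencil has weight 2 derivatives killed by `D`. As its
  -- quadratic part is non-zero, this is a linear relation between the two coefficients `g s₀` and
  -- `g t₀`.
  set lam := constantCoeff (a' j) / c1 with hlam
  set U := A.u k - C lam * A.u i with hUdef
  have hU : IsWeightedHomogeneous A.w U 4 := by
    refine huk.sub ?_
    simpa using (isWeightedHomogeneous_C A.w lam).mul hui
  have hDU : ∀ f, A.w f = 2 → vectorField g (pderiv f U) = 0 := fun f hf => by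
    rw [hUdef, map_sub, pderiv_C_mul, map_sub, C_mul', Derivation.map_smul, e1 f hf, e2 f hf,
        smul_eq_C_mul,
      ← mul_assoc, ← C_mul, hlam, div_mul_cancel₀ _ hc1, sub_self]
  obtain ⟨r₀, s₀, hr₀, hs₀, hQ⟩ := h.exists_ne_of_pencil hy hyw hk hi h4 hlt lam
  -- all coefficients are multiples of a single one
  obtain ⟨t₀, ht₀, hst⟩ : ∃ t₀, t₀ ≠ s₀ ∧ ∀ t, A.w t = 2 ↔ t = s₀ ∨ t = t₀ := by
    rcases (hyw s₀).1 hs₀ with rfl | rfl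
    · exact ⟨y₂, hy.symm, hyw⟩
    · exact ⟨y₁, hy, fun t => (hyw t).trans or_comm⟩
  have hrel : g s₀ * pderiv s₀ (pderiv r₀ U) + g t₀ * pderiv t₀ (pderiv r₀ U) = 0 := by
    have hf := hU.pderiv_sub r₀
    rw [hr₀] at hf
    rw [← hDU r₀ hr₀, vectorField_two h hD hf
      (φ := fun s => if s ∈ ({s₀, t₀} : Finset σ) then g s * pderiv s (pderiv r₀ U) else 0),
      Finset.sum_ite_mem, Finset.univ_inter, Finset.sum_pair ht₀.symm]
    · intro s hs
      rw [if_pos (by simpa using (hst s).1 hs)]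
    · intro s hs
      rw [if_neg fun h => hs ((hst s).2 (by simpa using h))]
  rw [const_of_four hU hs₀ hr₀, const_of_four hU ((hst t₀).2 (Or.inr rfl)) hr₀] at hrel
  set q := constantCoeff (pderiv s₀ (pderiv r₀ U))
  set q' := constantCoeff (pderiv t₀ (pderiv r₀ U))
  set ℓ := g t₀ with hℓdef
  have hℓ : IsWeightedHomogeneous A.w ℓ 1 := by
    have := hD.hom t₀
    rwa [(hst t₀).2 (Or.inr rfl)] at this
  set c : σ → ℚ := fun s => if s = t₀ then 1 else if s = s₀ then -(q' / q) else 0 with hcdef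
  have hgs : g s₀ = C (-(q' / q)) * ℓ := by
    have hq1 : (C q : MvPolynomial σ ℚ) * C q⁻¹ = 1 := by rw [← C_mul, mul_inv_cancel₀ hQ, C_1]
    rw [div_eq_mul_inv, C_neg, C_mul]
    linear_combination C q⁻¹ * hrel - g s₀ * hq1
  have hg : ∀ y, A.w y = 2 → g y = C (c y) * ℓ := fun y hy => by
    rcases (hst y).1 hy with rfl | rfl
    · rw [hgs, hcdef]
      simp [ht₀.symm]
    · simp [hcdef, hℓdef]
  have hc : ∀ s, A.w s ≠ 2 → c s = 0 := fun s hs => by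
    simp only [ne_eq, hst, not_or] at hs
    simp [hcdef, hs]
  have hℓ0 : ℓ ≠ 0 := fun h0 => hgy (by rw [hg y₀ hy₀, h0, mul_zero])
  have two : ∀ {F : MvPolynomial σ ℚ} {f : σ}, IsWeightedHomogeneous A.w F 4 → A.w f = 2 →
      IsWeightedHomogeneous A.w (pderiv f F) 2 := fun {F f} hF hf => by
    have := hF.pderiv_sub f
    rwa [hf] at this
  -- The constant-coefficient derivative in the direction `c`; on forms of weight 2, `D` is `K`
  -- times `ℓ`.
  set K : MvPolynomial σ ℚ → ℚ := fun F => ∑ s, c s * constantCoeff (pderiv s F) with hK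
  have hDK : ∀ F, IsWeightedHomogeneous A.w F 2 → vectorField g F = C (K F) * ℓ :=
    fun F hF => vectorField_eq_C_mul h hD hg hc hF
  have hKU : ∀ f, A.w f = 2 → K (pderiv f U) = 0 := fun f hf => by
    have := hDU f hf
    rw [hDK _ (two hU hf)] at this
    simpa using (mul_eq_zero.1 this).resolve_right hℓ0
  have huj : ∀ f, A.w f = 2 → pderiv f (A.u j) = C (K (pderiv f (A.u i)) / c1) * ℓ :=
    fun f hf => by
      have := e1 f hf
      rw [hDK _ (two hui hf)] at this
      have hq1 : (C c1 : MvPolynomial σ ℚ) * C c1⁻¹ = 1 := by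
        rw [← C_mul, mul_inv_cancel₀ hc1, C_1]
      rw [div_eq_mul_inv, C_mul]
      linear_combination -C c1⁻¹ * this - pderiv f (A.u j) * hq1
  set κ : ℚ := ∑ s, c s * (K (pderiv s (A.u i)) / c1) with hκ
  have hDuj : vectorField g (A.u j) = C κ * (ℓ * ℓ) := by
    rw [vectorField_apply, hκ, map_sum, Finset.sum_mul]
    refine Finset.sum_congr rfl fun s _ => ?_
    rcases h.w_or s with hs | hs | hs
    · rw [hD.coeff_eq_zero hs.le, hc s (by omega)]
      simp
    · rw [hg s hs, huj s hs, C_mul]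
      ring
    · rw [pderiv_u_eq_zero (by omega), hc s (by omega)]
      simp
  have hκ0 : κ ≠ 0 := fun h0 => hDj (by rw [hDuj, h0, C_0, zero_mul])
  have H2 : ℓ * ℓ ∈ A.quadIdeal := by
    refine mem_of_C_mul_mem hκ0 ?_
    rw [← hDuj]
    refine mem_quadIdeal (hD.map_u j) ?_
    have := (A.hom j).vectorField hD.hom
    rwa [hj] at this
  have H1 : ∀ k, A.d k = 3 → ∀ y, A.w y = 2 → ℓ * pderiv y (A.u k) ∈ A.quadIdeal :=
    fun k hk y hy => by
      obtain rfl := eq_of_num_le_one n3 hj hk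
      rw [huj y hy, mul_left_comm]
      exact Ideal.mul_mem_left _ _ H2
  have hgz := mul_coeff_three_mem h hD hg H2 hm H1 n5 (fun τ hτ => by
    have hτ' : ∀ r s, A.w r = 2 → A.w s = 2 →
        ℓ * (τ i + C lam * τ k) * C (constantCoeff (pderiv r (pderiv s (A.u i)))) +
          ℓ * τ k * C (constantCoeff (pderiv r (pderiv s U))) ∈ A.quadIdeal := fun r s hr hs => by
      have h1 := hτ r s hr hs
      have h2 : (∑ t, if A.d t = 4 then τ t * pderiv r (pderiv s (A.u t)) else 0) =
          τ i * pderiv r (pderiv s (A.u i)) + τ k * pderiv r (pderiv s (A.u k)) := by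
        rw [← Finset.sum_pair hki.symm (f := fun t => τ t * pderiv r (pderiv s (A.u t))),
          ← Finset.sum_filter]
        refine Finset.sum_congr ?_ fun _ _ => rfl
        ext t
        simp [h4]
      rw [h2] at h1
      rw [← const_of_four hU hr hs, ← const_of_four hui hr hs]
      convert h1 using 1
      rw [hUdef, map_sub, pderiv_C_mul, map_sub, pderiv_C_mul]
      ring
    -- Contract the Hessians twice with `c`: the part of `U` drops out by `hKU`, and that of `u i`
    -- becomes `c1 * κ ≠ 0`. The entry `(s₀, r₀)`, where `U` has a non-zero Hessian, afterwards
    -- isolates `ℓ * τ k`.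
    have h1 : ℓ * (τ i + C lam * τ k) ∈ A.quadIdeal := by
      have h2 : ∑ s, C (c s) * ∑ r, C (c r) *
        (ℓ * (τ i + C lam * τ k) * C (constantCoeff (pderiv r (pderiv s (A.u i)))) +
          ℓ * τ k * C (constantCoeff (pderiv r (pderiv s U)))) ∈ A.quadIdeal := by
        refine sum_mem fun s _ => ?_
        by_cases hs : A.w s = 2
        · refine Ideal.mul_mem_left _ _ (sum_mem fun r _ => ?_)
          by_cases hr : A.w r = 2
          · exact Ideal.mul_mem_left _ _ (hτ' r s hr hs)
          · simp [hc r hr]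
        · simp [hc s hs]
      have h3 : ∀ s, ∑ r, C (c r) *
        (ℓ * (τ i + C lam * τ k) * C (constantCoeff (pderiv r (pderiv s (A.u i)))) +
          ℓ * τ k * C (constantCoeff (pderiv r (pderiv s U)))) =
          ℓ * (τ i + C lam * τ k) * C (K (pderiv s (A.u i))) +
            ℓ * τ k * C (K (pderiv s U)) := fun s => by
        rw [hK]
        simp only [map_sum, Finset.mul_sum, C_mul, ← Finset.sum_add_distrib]
        exact Finset.sum_congr rfl fun _ _ => by ring
      have h4' : ∑ s, C (c s) * ∑ r, C (c r) *
        (ℓ * (τ i + C lam * τ k) * C (constantCoeff (pderiv r (pderiv s (A.u i)))) +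
          ℓ * τ k * C (constantCoeff (pderiv r (pderiv s U)))) =
          C (c1 * κ) * (ℓ * (τ i + C lam * τ k)) := by
        rw [hκ, Finset.mul_sum, map_sum, Finset.sum_mul]
        refine Finset.sum_congr rfl fun s _ => ?_
        rw [h3]
        by_cases hs : A.w s = 2
        · rw [hKU s hs, show c1 * (c s * (K (pderiv s (A.u i)) / c1)) =
            c s * K (pderiv s (A.u i)) by field_simp, C_mul, C_0]
          ring
        · simp [hc s hs]
      rw [h4'] at h2
      exact mem_of_C_mul_mem (mul_ne_zero hc1 hκ0) h2
    have h5 : ℓ * τ k ∈ A.quadIdeal := by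
      have h6 := hτ' s₀ r₀ hs₀ hr₀
      have h7 := (Ideal.add_mem_iff_right _ (Ideal.mul_mem_right _ _ h1)).1 h6
      rw [mul_comm] at h7
      exact mem_of_C_mul_mem hQ h7
    intro t ht
    rcases (h4 t).1 ht with rfl | rfl
    · rw [mul_add, mul_left_comm] at h1
      exact (Ideal.add_mem_iff_left _ (Ideal.mul_mem_left _ _ h5)).1 h1
    · exact h5) hv hζ0 hζ
  exact h.false_of_mul_mem he hℓ hℓ0 hj (mul_vectorField_mem h hD hg H2 hgz _) ha hsum haj
    (Or.inl hi)

end PureCI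

/-! ### Conclusion for weights 1, 2, 3. -/

namespace PureCI

variable {σ : Type*} [Fintype σ] {A : PureCI σ} {z : σ} {g : σ → MvPolynomial σ ℚ}

/-- A derivation of degree `-1` annihilates the variables of weight `2`. -/
theorem IsType.coeff_eq_zero_of_weight_two (h : A.IsType z) (hD : A.IsNegDer g 1) {y₀ : σ}
    (hy₀ : A.w y₀ = 2) : g y₀ = 0 := by
  classical
  by_contra hgy
  have hm : ∀ r, A.w r = 2 → pderiv r (g z) = 0 :=
    fun r hr => pderiv_coeff_eq_zero h hD hy₀ hgy hr
  have hg1 := hD.hom y₀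
  rw [hy₀, show (2 : ℤ) - 1 = 1 by norm_num] at hg1
  obtain ⟨x, hx, hxg⟩ := h.exists_pderiv_ne_zero hg1 hgy
  have he : ∀ s, dir A g x s ≠ 0 → A.w s = 2 := fun s => w_of_dir_ne_zero
  have h0 : dir A g x ≠ 0 := fun h0 => hxg (by
    have h1 := congrFun h0 y₀
    rw [dir, if_pos hy₀] at h1
    have h2 := hg1.pderiv_sub x
    rw [hx] at h2
    rw [h2.eq_C A.w_pos, show constantCoeff (pderiv x (g y₀)) = 0 by simpa using h1, C_0])
  have hP : plane z (dir A g x) 0 ≠ 0 := by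
    have : plane z (dir A g x) 0 = dir A g x := by
      funext s
      simp [plane]
    rwa [this]
  obtain ⟨i, hi, hmin⟩ : ∃ i, aeval (plane z (dir A g x) 0) (A.u i) ≠ 0 ∧
      ∀ j, A.d j < A.d i → aeval (plane z (dir A g x) 0) (A.u j) = 0 := by
    obtain ⟨i, hi, hmin⟩ := Finset.exists_min_image
      (Finset.univ.filter fun i => aeval (plane z (dir A g x) 0) (A.u i) ≠ 0) A.d
      ((A.exists_ne _ hP).imp fun i hi => by simpa using hi)
    refine ⟨i, by simpa using hi, fun j hj => ?_⟩
    by_contra hne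
    exact absurd (hmin j (by simpa using hne)) (by omega)
  have heven := even_of_aeval_plane_ne_zero he (A.hom i) hi
  have hge : 4 ≤ A.d i := by
    by_contra hlt
    have h3 : A.d i ≤ 3 := by omega
    exact hi (h.aeval_plane_u_of_le he h3 0)
  obtain ⟨c1, c2, c3, c4⟩ := h.count
  have hb := h.numVar_two_pos
  have n1 := numVar_pos hx
  obtain ⟨a, ha, hsum, hrel⟩ : ∃ a : σ → MvPolynomial σ ℚ,
      (∀ j, IsWeightedHomogeneous A.w (a j) (A.d i - 1 - A.d j)) ∧
      vectorField g (A.u i) = ∑ j, a j * A.u j ∧ (A.d i = 6 → ∀ r, A.w r = 2 →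
        (∑ j, if A.d j = 5 then a j * pderiv r (pderiv z (A.u j)) else 0) = 0) := by
    by_cases h6 : A.d i = 6
    · have hw := ((A.hom i).pderiv_sub z).pderiv_sub z
      rw [h6, (h.w_eq z).2 rfl, show (6 : ℤ) - 3 - 3 = 0 by norm_num] at hw
      obtain ⟨a, ha, hsum, hrel⟩ := exists_weight_five h hD h6 (hw.eq_C A.w_pos)
      refine ⟨a, fun j => ?_, hsum, fun _ r hr => ?_⟩
      · rw [h6]
        exact ha j
      · rw [hrel r hr, hm r hr, zero_mul]
    · obtain ⟨a, ha, hsum⟩ := hD.exists_rep i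
      exact ⟨a, ha, hsum, fun h => absurd h h6⟩
  obtain ⟨j, hjodd, hji, haj, hxj⟩ := exists_odd_term h hD hm hx hi hmin ha hsum
  have hj2 := two_le_d (A := A) j
  obtain ⟨q, hq⟩ := heven
  obtain ⟨p, hp⟩ := hjodd
  -- If `d i ≥ 8`, relations of weights `d i` and `d j` and the one monic in `z` exceed the count;
  -- `d j = 5` with `d i = 6` is `false_of_weight_five`.
  have hcases : A.d j = 3 ∧ (A.d i = 4 ∨ A.d i = 6) := by
    by_cases hi8 : 8 ≤ A.d i
    · exfalso
      have m1 : 0 < A.num 3 ∨ 0 < A.num 5 ∨ 0 < A.num 7 ∨ 0 < A.num 9 ∨ 0 < A.numIco 10 12 ∨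
          0 < A.numGe := by
        rcases (by omega : A.d j = 3 ∨ A.d j = 5 ∨ A.d j = 7 ∨ A.d j = 9 ∨
          (10 ≤ A.d j ∧ A.d j < 12) ∨ 12 ≤ A.d j) with h' | h' | h' | h' | h' | h'
        · exact Or.inl (num_pos_of_eq h')
        · exact Or.inr (Or.inl (num_pos_of_eq h'))
        · exact Or.inr (Or.inr (Or.inl (num_pos_of_eq h')))
        · exact Or.inr (Or.inr (Or.inr (Or.inl (num_pos_of_eq h'))))
        · exact Or.inr (Or.inr (Or.inr (Or.inr (Or.inl (numIco_pos h'.1 h'.2)))))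
        · exact Or.inr (Or.inr (Or.inr (Or.inr (Or.inr (numGe_pos h')))))
      have m2 : 0 < A.num 8 ∨ 0 < A.numIco 10 12 ∨ 0 < A.numGe := by
        rcases (by omega : A.d i = 8 ∨ (10 ≤ A.d i ∧ A.d i < 12) ∨ 12 ≤ A.d i) with h' | h' | h'
        · exact Or.inl (num_pos_of_eq h')
        · exact Or.inr (Or.inl (numIco_pos h'.1 h'.2))
        · exact Or.inr (Or.inr (numGe_pos h'))
      have m3 : 0 < A.num 6 ∨ 0 < A.num 9 := by
        rcases h.exists_monic_cases with ⟨v, c, hd, -⟩ | ⟨v, c, hd, -⟩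
        · exact Or.inl (num_pos_of_eq hd)
        · exact Or.inr (num_pos_of_eq hd)
      omega
    rcases (by omega : A.d j = 3 ∧ (A.d i = 4 ∨ A.d i = 6) ∨ A.d i = 6 ∧ A.d j = 5) with h' | h'
    · exact h'
    · exfalso
      rw [h'.1] at hmin
      refine false_of_weight_five h hD hm hx h0 h'.1 hmin (fun k => ?_) (hrel h'.1) h'.2
        (fun h0 => haj (by rw [h0, map_zero]))
      have := ha k
      rwa [h'.1] at this
  obtain ⟨hj, hi46⟩ := hcases
  have hDj := vectorField_ne_zero h hD hm hx hj hxj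
  have hn3 := num_pos_of_eq hj
  -- `D (u j)` is a non-zero element of weight 2 in the ideal. The resulting relation of weight 2
  -- also excludes the cubic case below.
  have hn2 : 0 < A.num 2 := by
    have := (A.hom j).vectorField hD.hom
    rw [hj] at this
    exact num_two_pos (hD.map_u j) this hDj
  have hn46 : 0 < A.num 4 ∨ 0 < A.num 6 := hi46.imp num_pos_of_eq num_pos_of_eq
  obtain ⟨v, ζ, hv, hζ0, hζ⟩ : ∃ v ζ, A.d v = 6 ∧ ζ ≠ 0 ∧ pderiv z (pderiv z (A.u v)) = C ζ := by
    rcases h.exists_monic_cases with h' | ⟨v, c, hd, -⟩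
    · exact h'
    · exfalso
      have := num_pos_of_eq hd
      omega
  have n6 := num_pos_of_eq hv
  rcases hi46 with hi4 | hi6
  · have n4 := num_pos_of_eq hi4
    by_cases hb1 : A.numVar 2 = 1
    · obtain ⟨y, hy⟩ := h.exists_unique_weight_two hb1
      rw [hy] at hy₀
      subst hy₀
      exact false_of_unique h hD hm hy hgy (by omega) he (Or.inl ⟨hi4, by omega⟩) hi hj ha hsum haj
        hv hζ0 hζ
    · refine false_of_pair h hD hm hy₀ hgy (by omega) (by omega) (by omega) (by omega) he hi4 hj hDj
        ha hsum haj hv (fun t ht => ?_) hζ0 hζ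
      by_contra! ht4
      rcases (by omega : A.d t = 5 ∨ 6 ≤ A.d t) with h' | h'
      · have := num_pos_of_eq h'
        omega
      · have := six_le_count h' hv ht
        omega
  · rw [hi6] at hmin
    have n5 : A.num 5 = 0 := by
      by_contra n5
      exact false_of_num_four_eq_zero h hD hm hx h0 hi6 hmin (by omega) (by omega)
    obtain ⟨k, hk, hk6⟩ := h.exists_second_relation h0 i hmin
      fun k hk => absurd hk (ne_of_num_eq_zero n5 k)
    have := six_le_count hk6 hi6 hk
    obtain ⟨y, hy⟩ := h.exists_unique_weight_two (by omega)
    rw [hy] at hy₀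
    subst hy₀
    exact false_of_unique h hD hm hy hgy n5 he (Or.inr ⟨hi6, by omega, by omega⟩) hi hj ha hsum haj
      hv hζ0 hζ

theorem IsType.forall_mem [Nontrivial σ] (h : A.IsType z) {e : ℤ} (hD : A.IsNegDer g e) (s : σ) :
    g s ∈ A.ideal := by
  have hg : ∀ s ≠ z, g s = 0 := fun s hs => by
    rcases h.w_or s with h1 | h1 | h1
    · exact hD.coeff_eq_zero (by have := hD.pos; omega)
    · rcases (by have := hD.pos; omega : e = 1 ∨ 2 ≤ e) with rfl | h2
      · exact h.coeff_eq_zero_of_weight_two hD h1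
      · exact hD.coeff_eq_zero (by omega)
    · exact absurd ((h.w_eq s).1 h1) hs
  by_cases hs : s = z
  · exact hs ▸ h.mem_of_forall_ne hD hg
  · rw [hg s hs]
    exact zero_mem _

end PureCI

/-! ### From a pure model to halved degrees, and lifting derivations. -/

namespace MvPolynomial

variable {σ : Type*} {w : σ → ℕ} {w' : σ → ℤ}

theorem weight_eq_two_mul (h : ∀ s, (w s : ℤ) = 2 * w' s) (m : σ →₀ ℕ) :
    ((Finsupp.weight w m : ℕ) : ℤ) = 2 * Finsupp.weight w' m := by
  simp only [Finsupp.weight_apply, Finsupp.sum, smul_eq_mul, nsmul_eq_mul, Nat.cast_sum,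
    Nat.cast_mul, h, Finset.mul_sum]
  exact Finset.sum_congr rfl fun _ _ => by ring

theorem IsWeightedHomogeneous.of_two_mul (h : ∀ s, (w s : ℤ) = 2 * w' s) {f : MvPolynomial σ ℚ}
    {n : ℕ} (hf : IsWeightedHomogeneous w f n) {n' : ℤ} (hn : (n : ℤ) = 2 * n') :
    IsWeightedHomogeneous w' f n' := fun m hm => by
  have h1 := hf hm
  have h2 := weight_eq_two_mul h m
  omega

theorem IsWeightedHomogeneous.even_of_ne_zero (h : ∀ s, (w s : ℤ) = 2 * w' s)
    {f : MvPolynomial σ ℚ} {n : ℕ} (hf : IsWeightedHomogeneous w f n) (h0 : f ≠ 0) : Even n := by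
  obtain ⟨m, hm⟩ := exists_coeff_ne_zero h0
  have h1 := hf hm
  have h2 := weight_eq_two_mul h m
  exact ⟨(Finsupp.weight w' m).toNat, by omega⟩

theorem vectorField_X [Fintype σ] (g : σ → MvPolynomial σ ℚ) (s : σ) :
    vectorField g (X s) = g s := by
  classical
  rw [vectorField_apply, Finset.sum_eq_single s]
  · rw [pderiv_X_self, mul_one]
  · intro t _ ht
    rw [pderiv_X_of_ne ht.symm, mul_zero]
  · simp

end MvPolynomial

namespace EllipticPresentation

variable {k : ℕ} {P : EllipticPresentation k}

theorem IsPureModel.relDeg_pos (hP : P.IsPureModel) (i : Fin k) : 0 < P.relDeg i := by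
  have := hP.two_mul_deg_le i
  have := P.deg_pos i
  omega

theorem IsPureModel.regular (hP : P.IsPureModel) (S : Set (Fin k)) (i : Fin k) (hi : i ∉ S)
    (a : MvPolynomial (Fin k) ℚ) (ha : a * P.rel i ∈ Ideal.span (P.rel '' S)) :
    a ∈ Ideal.span (P.rel '' S) :=
  mem_span_of_mul_mem_span hP.relDeg_pos P.rel_homogeneous P.rel_regular S i hi a ha

theorem IsPureModel.formalDim_spec (hP : P.IsPureModel) :
    P.formalDim + ∑ s, P.deg s = ∑ i, P.relDeg i ∧ P.piece P.formalDim ≠ ⊥ ∧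
      ∀ n, P.formalDim < n → P.piece n = ⊥ := by
  have key (n : ℕ) : PowerSeries.coeff n (hilbertSeries P.deg P.relIdeal) =
      (Module.finrank ℚ (P.piece n) : ℤ) := PowerSeries.coeff_mk _ _
  obtain ⟨N, hN, hne, htop⟩ := PowerSeries.exists_top_of_mul_prod rfl
    (fun n => by
      change 0 ≤ PowerSeries.coeff n (hilbertSeries P.deg P.relIdeal)
      rw [key]
      positivity) P.deg_pos hP.relDeg_pos
    (hilbertSeries_mul_prod P.deg_pos P.rel_homogeneous hP.regular)
  have hne' : P.piece N ≠ ⊥ := fun h => hne (by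
    have := key N
    rw [h, finrank_bot] at this
    exact this)
  have htop' : ∀ n, N < n → P.piece n = ⊥ := fun n hn => by
    have h1 := htop n hn
    have h2 : FiniteDimensional ℚ (P.piece n) :=
      finiteDimensional_gradedPiece P.deg_pos P.relIdeal n
    refine Submodule.finrank_eq_zero.1 ?_
    have := key n
    exact_mod_cast this.symm.trans h1
  rw [P.formalDim_eq htop' hne']
  exact ⟨hN, hne', htop'⟩

theorem IsPureModel.relIdeal_ne_top (hP : P.IsPureModel) : P.relIdeal ≠ ⊤ := fun h => by
  refine hP.formalDim_spec.2.1 ?_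
  have := Ideal.Quotient.subsingleton_iff.2 h
  exact Subsingleton.elim _ _

/-- Needed for the degrees of the relations to be even, since zero is homogeneous of every degree.
-/
theorem IsPureModel.rel_ne_zero (hP : P.IsPureModel) (i : Fin k) : P.rel i ≠ 0 := fun h => by
  refine hP.relIdeal_ne_top ((Ideal.eq_top_iff_one _).2 ?_)
  have := hP.regular {i}ᶜ i (by simp) 1 (by simp [h])
  exact Ideal.span_mono (Set.image_subset_range _ _) this

theorem IsPureModel.exists_X_pow_mem (hP : P.IsPureModel) (s : Fin k) :
    ∃ n, X s ^ n ∈ P.relIdeal := by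
  refine ⟨P.formalDim + 1, ?_⟩
  have h1 := (isWeightedHomogeneous_X ℚ P.deg s).pow (P.formalDim + 1)
  have h2 : Ideal.Quotient.mk P.relIdeal (X s ^ (P.formalDim + 1)) ∈
      P.piece ((P.formalDim + 1) • P.deg s) := ⟨_, h1, rfl⟩
  rw [hP.formalDim_spec.2.2 _ (by
    have := P.deg_pos s
    rw [smul_eq_mul]
    nlinarith)] at h2
  exact Ideal.Quotient.eq_zero_iff_mem.1 h2

theorem two_mul_half_deg (P : EllipticPresentation k) (s : Fin k) :
    (P.deg s : ℤ) = 2 * ((P.deg s / 2 : ℕ) : ℤ) := by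
  obtain ⟨n, hn⟩ := P.deg_even s
  omega

theorem IsPureModel.two_mul_half_relDeg (hP : P.IsPureModel) (i : Fin k) :
    (P.relDeg i : ℤ) = 2 * ((P.relDeg i / 2 : ℕ) : ℤ) := by
  obtain ⟨n, hn⟩ := (P.rel_homogeneous i).even_of_ne_zero P.two_mul_half_deg (hP.rel_ne_zero i)
  omega

/-- The complete intersection defined by a pure model, in halved degrees. -/
noncomputable def IsPureModel.toPureCI (hP : P.IsPureModel) (hfd : P.formalDim ≤ 20) :
    PureCI (Fin k) where
  w s := (P.deg s / 2 : ℕ)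
  d i := (P.relDeg i / 2 : ℕ)
  u := P.rel
  w_pos s := by
    have := P.two_mul_half_deg s
    have := P.deg_pos s
    omega
  hom i := (P.rel_homogeneous i).of_two_mul P.two_mul_half_deg (hP.two_mul_half_relDeg i)
  two_mul_le i := by
    have h1 := P.two_mul_half_deg i
    have h2 := hP.two_mul_half_relDeg i
    have h3 := hP.two_mul_deg_le i
    omega
  sum_le := by
    have h1 := congrArg (Nat.cast : ℕ → ℤ) hP.formalDim_spec.1
    push_cast only [Nat.cast_add, Nat.cast_sum] at h1
    rw [Finset.sum_congr rfl fun s _ => P.two_mul_half_deg s,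
      Finset.sum_congr rfl fun s _ => hP.two_mul_half_relDeg s, ← Finset.mul_sum,
      ← Finset.mul_sum] at h1
    omega
  lin i s := by
    by_contra h
    have h1 : coeff (Finsupp.single s 1) (P.rel i) ≠ 0 := fun h0 => h (by
      rw [constantCoeff_eq, coeff_pderiv]
      simp [h0])
    have := hP.two_le_length i _ (mem_support_iff.2 h1)
    simp at this
  regular := hP.regular
  exists_ne Q hQ := by
    by_contra! h0
    refine hQ (funext fun s => ?_)
    obtain ⟨n, hn⟩ := hP.exists_X_pow_mem s
    have h1 : P.relIdeal ≤ RingHom.ker (aeval Q : MvPolynomial (Fin k) ℚ →ₐ[ℚ] ℂ) := by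
      rw [relIdeal, Ideal.span_le]
      rintro _ ⟨i, rfl⟩
      exact h0 i
    have h2 := h1 hn
    rw [RingHom.mem_ker, map_pow, aeval_X] at h2
    exact eq_zero_of_pow_eq_zero h2

section Derivation

variable {δ : Derivation ℚ P.Alg P.Alg} {e : ℤ}

theorem mk_vectorField {g : Fin k → MvPolynomial (Fin k) ℚ}
    (hg : ∀ s, Ideal.Quotient.mk P.relIdeal (g s) = δ (Ideal.Quotient.mk P.relIdeal (X s)))
    (f : MvPolynomial (Fin k) ℚ) :
    Ideal.Quotient.mk P.relIdeal (vectorField g f) = δ (Ideal.Quotient.mk P.relIdeal f) := by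
  induction f using MvPolynomial.induction_on with
  | C a =>
    rw [← algebraMap_eq, Derivation.map_algebraMap, map_zero]
    exact (δ.map_algebraMap a).symm
  | add p q hp hq => rw [map_add, map_add, map_add, map_add, hp, hq]
  | mul_X p s hp =>
    rw [Derivation.leibniz, map_mul, Derivation.leibniz, vectorField_X, smul_eq_mul, smul_eq_mul,
        smul_eq_mul,
      smul_eq_mul, map_add, map_mul, map_mul, hp, hg]

/-- A derivation of negative degree lifts to a vector field with weighted homogeneous coefficients
in halved degrees. -/
theorem IsPureModel.exists_lift (hP : P.IsPureModel) (hfd : P.formalDim ≤ 20) (he : e < 0)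
    (hδ : P.HasDegree δ e) (hne : δ ≠ 0) :
    ∃ g e', (hP.toPureCI hfd).IsNegDer g e' ∧ ∃ s, g s ∉ (hP.toPureCI hfd).ideal := by
  have hex : ∀ s, ∃ g : MvPolynomial (Fin k) ℚ,
      Ideal.Quotient.mk P.relIdeal g = δ (Ideal.Quotient.mk P.relIdeal (X s)) ∧
        (g ≠ 0 → ∃ m : ℕ, (m : ℤ) = P.deg s + e ∧ IsWeightedHomogeneous P.deg g m) := fun s => by
    have hX : Ideal.Quotient.mk P.relIdeal (X s) ∈ P.piece (P.deg s) :=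
      ⟨X s, isWeightedHomogeneous_X ℚ P.deg s, rfl⟩
    by_cases hlt : (P.deg s : ℤ) + e < 0
    · exact ⟨0, by rw [map_zero, (hδ _ _ hX).2 hlt], fun h => absurd rfl h⟩
    · obtain ⟨m, hm⟩ := Int.eq_ofNat_of_zero_le (not_lt.1 hlt)
      obtain ⟨g, hg, e⟩ := (hδ _ _ hX).1 m hm.symm
      exact ⟨g, e, fun _ => ⟨m, hm.symm, hg⟩⟩
  choose g hg hhom using hex
  have hmk := mk_vectorField hg
  obtain ⟨s₀, hs₀⟩ : ∃ s, g s ∉ P.relIdeal := by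
    by_contra! h0
    refine hne (Derivation.ext fun x => ?_)
    obtain ⟨f, rfl⟩ := Ideal.Quotient.mk_surjective x
    rw [← hmk, Derivation.zero_apply, Ideal.Quotient.eq_zero_iff_mem, vectorField_apply]
    exact sum_mem fun s _ => Ideal.mul_mem_right _ _ (h0 s)
  obtain ⟨e', he'⟩ : ∃ e', e = -(2 * e') := by
    have h0 : g s₀ ≠ 0 := fun h0 => hs₀ (h0 ▸ zero_mem _)
    obtain ⟨m, hm, hgm⟩ := hhom s₀ h0
    obtain ⟨n, hn⟩ := hgm.even_of_ne_zero P.two_mul_half_deg h0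
    exact ⟨((P.deg s₀ / 2 : ℕ) : ℤ) - n, by
      have := P.two_mul_half_deg s₀
      omega⟩
  refine ⟨g, e', ⟨by omega, fun s => ?_, fun s => ?_, fun i => ?_⟩, s₀, hs₀⟩
  · by_cases h0 : g s = 0
    · rw [h0]
      exact isWeightedHomogeneous_zero ..
    · obtain ⟨m, hm, hgm⟩ := hhom s h0
      refine hgm.of_two_mul P.two_mul_half_deg ?_
      have := P.two_mul_half_deg s
      change (m : ℤ) = 2 * (((P.deg s / 2 : ℕ) : ℤ) - e')
      omega
  · by_contra hc
    have h0 : g s ≠ 0 := fun h0 => hc (by rw [h0, map_zero])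
    obtain ⟨m, hm, hgm⟩ := hhom s h0
    obtain rfl : m = 0 := by
      have := hgm (d := 0) hc
      rw [map_zero] at this
      exact this.symm
    have hgC : g s = C (constantCoeff (g s)) := by
      refine hgm.eq_monomial_of_unique_weight (d₀ := 0) fun m hm => Finsupp.ext ?_
      exact (weightedDegree_eq_zero_iff (nonTorsionWeight_of fun s => (P.deg_pos s).ne')).1 hm
    classical
    -- For the least `n` with `X s ^ n` in the ideal, a non-zero constant `g s` would put the
    -- derivative `n * g s * X s ^ (n - 1)`, hence `X s ^ (n - 1)`, in the ideal.
    have hpow := hP.exists_X_pow_mem s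
    have hmin := Nat.find_spec hpow
    have hpos : Nat.find hpow ≠ 0 := fun h0 => by
      rw [h0, pow_zero] at hmin
      exact hP.relIdeal_ne_top ((Ideal.eq_top_iff_one _).2 hmin)
    refine Nat.find_min hpow (m := Nat.find hpow - 1) (by omega) ?_
    have h1 := hmk (X s ^ Nat.find hpow)
    rw [Ideal.Quotient.eq_zero_iff_mem.2 hmin, map_zero, Ideal.Quotient.eq_zero_iff_mem,
      Derivation.leibniz_pow] at h1
    rw [vectorField_X, hgC] at h1
    refine PureCI.mem_of_C_mul_mem (c := (Nat.find hpow : ℚ) * constantCoeff (g s))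
      (mul_ne_zero (by exact_mod_cast hpos) hc) ?_
    convert h1 using 1
    rw [C_mul, smul_eq_mul, nsmul_eq_mul, map_natCast]
    ring
  · change vectorField g (P.rel i) ∈ P.relIdeal
    rw [← Ideal.Quotient.eq_zero_iff_mem, hmk,
      Ideal.Quotient.eq_zero_iff_mem.2 (show P.rel i ∈ P.relIdeal from Ideal.subset_span ⟨i, rfl⟩),
      map_zero]

end Derivation

end EllipticPresentation

theorem corollary4p4 (k : ℕ) (hk : 2 ≤ k) (P : EllipticPresentation k)
    (hpure : P.IsPureModel) (hsplit : ¬ P.Splits)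
    (hdeg : P.deg ⟨k - 2, by omega⟩ + P.deg ⟨k - 1, by omega⟩ = 10)
    (hder : ∃ (δ : Derivation ℚ P.Alg P.Alg) (d : ℤ), d < 0 ∧ P.HasDegree δ d ∧ δ ≠ 0) :
    20 < P.formalDim := by
  by_contra hlt
  have hfd : P.formalDim ≤ 20 := not_lt.1 hlt
  obtain ⟨δ, e, he, hδ, hne⟩ := hder
  obtain ⟨g, e', hD, s, hs⟩ := hpure.exists_lift hfd he hδ hne
  have : Nontrivial (Fin k) := Fin.nontrivial_iff_two_le.2 hk
  let z : Fin k := ⟨k - 1, by omega⟩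
  let y : Fin k := ⟨k - 2, by omega⟩
  have hyz : y ≠ z := fun h => by
    have : k - 2 = k - 1 := Fin.ext_iff.1 h
    omega
  have hle : ∀ t, t ≠ z → P.deg t ≤ P.deg y := fun t ht => hpure.deg_mono (by
    have h1 : t.val ≠ k - 1 := fun h => ht (Fin.ext h)
    have := t.isLt
    change t.val ≤ k - 2
    omega)
  have hw : ∀ t, (P.deg t : ℤ) = 2 * (hpure.toPureCI hfd).w t := P.two_mul_half_deg
  have hyz' : P.deg y ≤ P.deg z := hpure.deg_mono (by change k - 2 ≤ k - 1; omega)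
  change P.deg y + P.deg z = 10 at hdeg
  have w1 := hw y
  have w2 := hw z
  have hpos := P.deg_pos
  rcases (by have := hpos y; omega : P.deg y = 2 ∧ P.deg z = 8 ∨ P.deg y = 4 ∧ P.deg z = 6) with
      h | h
  · refine hs (PureCI.forall_mem_of_weight_four (z := z) (by omega) (fun t ht => ?_) hD s)
    have := hw t
    have := hle t ht
    have := hpos t
    omega
  · refine hs (PureCI.IsType.forall_mem (z := z) ⟨fun t => ⟨fun ht => ?_, ?_⟩, fun t => ?_, y,
      ?_⟩ hD s)
    · by_contra hne
      have := hle t hne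
      have := hw t
      omega
    · rintro rfl
      omega
    · by_cases ht : t = z
      · subst ht
        omega
      · have := hle t ht
        have := hw t
        have := hpos t
        omega
    · omega
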